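/- All groups below are given by presentations. For $m \ge 6$ let $$\mathcal N_{II}(m;e_1,\dots,e_5)=\langle p,q,r \mid p^{2^{m-2}}=q^2=1,\ r^2=p^{2^{m-3}e_5},\ q^{-1}pq=p^{1+2^{m-3}e_2},\ r^{-1}pr=p^{e_1+2^{m-3}e_3},\ r^{-1}qr=qp^{2^{m-3}e_4}\rangle,$$ and let $\mathcal N_{II,n}(m)$ be this group with $(e_1,\dots,e_5)=(-1,0,0,1,0),\ (-1,1,1,0,0),\ (-1,0,0,0,0)$ for $n=3,4,5$. For $m \ge 7$ put $a=2^{m-4}$, $b=2^{m-5}$; in all of the following groups $p^{2^{m-3}}=1$ is a relation. The further relations and parameters are: * $\mathcal M_{II\text{-}A,n}(m)$, generators $p,q,r$: $q^4=1$, $r^2=q^{2e_3}p^{ae_4}$, $q^{-1}pq=p^{1+be_7}$, $r^{-1}pr=q^{2e_1}p^{e_8+ae_5}$, $r^{-1}qr=q^{1+2e_2}p^{be_6}$; $(e_1,\dots,e_8)=(0,1,0,0,0,0,0,-1)$ for $n=39$ and $(0,1,0,0,0,0,2,-1)$ for $n=40$. * $\mathcal M_{II\text{-}B,n}(m)$,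 generators $p,q,r$: $q^4=1$, $r^2=q^{2e_3}$, $q^{-1}pq=p^{-1+be_6}$, $r^{-1}pr=q^{2e_1}p^{e_7+ae_5}$, $r^{-1}qr=q^{1+2e_2}p^{ae_4}$; $(e_1,\dots,e_7)=(0,1,0,0,0,0,1)$ for $n=19$ and $(0,1,0,0,1,2,1)$ for $n=20$. * $\mathcal M_{II\text{-}C,5}(m)$, generators $p,q,r$: $q^4=p^a$, $r^2=1$, $q^{-1}pq=p^{-1}$, $r^{-1}pr=p$, $r^{-1}qr=q^{-1}$. * $\mathcal M_{II\text{-}D,n}(m)$, generators $p,q,r$: $q^4=1$, $r^2=q^{2e_3}$, $q^{-1}pq=q^2p^{-1+ae_7}$, $q^{-2}pq^2=p^{1+ae_6}$, $r^{-1}pr=q^{2e_1}p^{e_8+ae_5}$, $r^{-1}qr=q^{1+2e_2}p^{ae_4}$; $(e_1,\dots,e_8)=(1,1,0,0,0,1,0,1)$, $(1,1,0,0,1,0,0,1)$, $(0,0,0,0,0,0,0,-1)$, $(1,1,0,0,0,0,0,1)$ for $n=3,17,18,19$. * $\mathcal M_{II\text{-}E,1}(m)$, generators $p,q,r$: $q^4=r^2=1$,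 $q^{-1}pq=q^2p^{1-b}$, $q^{-2}pq^2=p^{1+a}$, $r^{-1}pr=p^{-1}$, $r^{-1}qr=qp^{b}$. * $\mathcal M_{II\text{-}F,n}(m)$, generators $p,q,r$: $q^4=p^a$, $r^2=1$, $q^{-1}pq=q^2p^{-1+ae_5}$, $q^{-2}pq^2=p^{1+ae_1}$, $r^{-1}pr=q^{2e_3}p^{1+ae_2}$, $r^{-1}qr=q^{1+2e_3}p^{ae_4}$; $(e_1,\dots,e_5)=(0,0,1,1,0)$ for $n=8$ and $(0,1,1,1,0)$ for $n=9$. * $\mathcal M_{III,n}(m)$, generators $p,q,r,s$: $q^2=1$, $r^2=p^{ae_8}$, $s^2=p^{ae_5}$, $q^{-1}pq=p$, $r^{-1}pr=p^{e_2+ae_3}$, $s^{-1}ps=p^{e_1+ae_6}$, $r^{-1}qr=q$, $s^{-1}qs=qp^{ae_4}$, $s^{-1}rs=rp^{ae_7}$; $(e_1,\dots,e_8)=(-1,1,0,0,0,0,1,0)$, $(-1,1,1,0,0,1,0,0)$, $(-1,1,0,0,0,0,0,0)$, $(1,-1,0,1,1,0,0,0)$, $(1,-1,1,1,1,0,0,0)$,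 $(-1,1,1,1,0,0,0,0)$, $(-1,-1,0,1,0,0,0,1)$ for $n=3,4,5,10,11,13,14$. Let $\Gamma$ be the set of these 22 families ($m\ge 6$ for $\mathcal N_{II}$, $m\ge 7$ for the others). Distinct involutions $s_0,\dots,s_{n-1}$ ($n\ge1$) of a group have a connected string diagram if $s_js_k$ has order $2$ whenever $|j-k|\ge2$ and $s_js_{j+1}$ has order greater than $2$ for all $j$. A group $G$ is a connected string C-group if it is generated by some such $s_0,\dots,s_{n-1}$ with a connected string diagram that satisfy the intersection condition $\langle s_j\mid j\in J\rangle\cap\langle s_k\mid k\in K\rangle=\langle s_i\mid i\in J\cap K\rangle$ for all $J,K\subseteq\{0,\dots,n-1\}$. Write $x^y=y^{-1}xy$. **Proposition.** For every $m\ge7$ the groups $\mathcal M_{II\text{-}D,3}(m)$ and $\mathcal M_{II\text{-}D,19}(m)$ are connected string C-groups; no other group in $\Gamma$ is a connected string C-group. More precisely: 1. In $\mathcal N_{II,3}(m)$, $\mathcal N_{II,4}(m)$, $\mathcal N_{II,5}(m)$ ($m\ge6$), $p^{2^{m-3}}$ is a central involution, and for all non-commuting involutions $t_0,t_1$ the equation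 $(t_0t_1)^{2x}=p^{2^{m-3}}$ is solvable in $x\in\mathbb Z$. 2. In $\mathcal M_{II\text{-}A,39}(m)$, $\mathcal M_{II\text{-}A,40}(m)$, $\mathcal M_{II\text{-}B,19}(m)$, $\mathcal M_{II\text{-}B,20}(m)$, $\mathcal M_{II\text{-}D,17}(m)$, $\mathcal M_{II\text{-}D,18}(m)$ ($m\ge 7$), for all involutions $s_0,s_1,s_2$ with a connected string diagram there is a central involution $\zeta$ such that $(s_0s_1)^{2x_1}=(s_1s_2)^{2x_2}=\zeta$ is solvable in $x_1,x_2\in\mathbb Z$. 3. In $\mathcal M_{II\text{-}C,5}(m)$, $\mathcal M_{II\text{-}F,8}(m)$, $\mathcal M_{II\text{-}F,9}(m)$ and $\mathcal M_{III,n}(m)$, $n\in\{3,4,5,10,11,13,14\}$ ($m\ge7$), $p^{2^{m-4}}$ is a central involution, and for all non-commuting involutions $t_0,t_1$ the equation $(t_0t_1)^{2x}=p^{2^{m-4}}$ is solvable in $x\in\mathbb Z$. 4. In $\mathcal M_{II\text{-}E,1}(m)$ ($m\ge7$), $p^{2^{m-4}}$ is a central involution, and for all involutions $s_0,s_1,s_2$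 with a connected string diagram either $(s_0s_1)^{2x_1}=(s_1s_2)^{2x_2}=p^{2^{m-4}}$ is solvable in $x_1,x_2\in\mathbb Z$, or $s_1^{s_0}=s_1^{s_2}$. Consequently, in each of these 20 groups, for every triple of involutions $s_0,s_1,s_2$ with a connected string diagram, there is a central involution in $\langle s_0,s_1\rangle\cap\langle s_1,s_2\rangle$ or $s_1^{s_0}=s_1^{s_2}$, and in either case $\langle s_0,s_1\rangle\cap\langle s_1,s_2\rangle\ne\langle s_1\rangle$. -/

import Mathlib

/-! ### String diagrams and string C-groups -/

/-- `z` is an involution commuting with every element of the group. -/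
def IsCentralInvolution {G : Type*} [Group G] (z : G) : Prop :=
  orderOf z = 2 ∧ ∀ g : G, g * z = z * g

/-- The distinct involutions `s 0, …, s (n - 1)` have a string diagram: `s j` and `s k` are
not joined, i.e. their product has order `2`, whenever `|j - k| ≥ 2`. -/
structure IsStringDiagram {G : Type*} [Group G] {n : ℕ} (s : Fin n → G) : Prop where
  injective : Function.Injective s
  involution : ∀ j, orderOf (s j) = 2
  string : ∀ j k : Fin n, (j : ℕ) + 2 ≤ k → orderOf (s j * s k) = 2

/-- A string diagram is connected if consecutive involutions have a product of order greater
than `2` (in Lean, `orderOf g = 0` means that `g` has infinite order). -/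
structure IsConnectedStringDiagram {G : Type*} [Group G] {n : ℕ} (s : Fin n → G) : Prop
    extends IsStringDiagram s where
  connected : ∀ j k : Fin n, (k : ℕ) = j + 1 →
    2 < orderOf (s j * s k) ∨ orderOf (s j * s k) = 0

/-- The intersection condition
`⟨s j | j ∈ J⟩ ∩ ⟨s k | k ∈ K⟩ = ⟨s i | i ∈ J ∩ K⟩` for all sets of indices `J`, `K`. -/
def IntersectionCondition {G : Type*} [Group G] {n : ℕ} (s : Fin n → G) : Prop :=
  ∀ J K : Set (Fin n), Subgroup.closure (s '' J) ⊓ Subgroup.closure (s '' K) =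
    Subgroup.closure (s '' (J ∩ K))

/-- `G` is a connected string C-group with respect to some finite nonempty family of
distinguished generators (of any length). -/
def IsConnectedStringCGroup (G : Type*) [Group G] : Prop :=
  ∃ n : ℕ, 1 ≤ n ∧ ∃ s : Fin n → G, Subgroup.closure (Set.range s) = ⊤ ∧
    IsConnectedStringDiagram s ∧ IntersectionCondition s

/-! ### The two ways in which a triple of involutions violates the intersection condition -/

/-- For all non-commuting involutions `t₀`, `t₁` of `G`, the equation `(t₀ t₁)^(2x) = z` has an
integer solution `x`. -/
def NonCommutingProductsReach {G : Type*} [Group G] (z : G) : Prop :=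
  ∀ t₀ t₁ : G, orderOf t₀ = 2 → orderOf t₁ = 2 → t₀ * t₁ ≠ t₁ * t₀ →
    ∃ x : ℤ, (t₀ * t₁) ^ (2 * x) = z

/-- `(s₀ s₁)^(2x₁) = (s₁ s₂)^(2x₂) = z` has an integer solution `x₁`, `x₂`. -/
def CommonEvenPower {G : Type*} [Group G] (s₀ s₁ s₂ z : G) : Prop :=
  ∃ x₁ x₂ : ℤ, (s₀ * s₁) ^ (2 * x₁) = z ∧ (s₁ * s₂) ^ (2 * x₂) = z

/-- Every triple of involutions with a connected string diagram satisfies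
`(s₀ s₁)^(2x₁) = (s₁ s₂)^(2x₂) = z` for some integers `x₁`, `x₂` and some central involution `z`,
which may depend on the triple. -/
def TriplesHaveCommonCentralPower (G : Type*) [Group G] : Prop :=
  ∀ s₀ s₁ s₂ : G, IsConnectedStringDiagram ![s₀, s₁, s₂] →
    ∃ z : G, IsCentralInvolution z ∧ CommonEvenPower s₀ s₁ s₂ z

/-- The conjugates of `s₁` by `s₀` and by `s₂` are equal. -/
def ConjugatesAgree {G : Type*} [Group G] (s₀ s₁ s₂ : G) : Prop :=
  s₀⁻¹ * s₁ * s₀ = s₂⁻¹ * s₁ * s₂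

/-- For every triple of involutions with a connected string diagram, a central involution lies in
`⟨s₀, s₁⟩ ∩ ⟨s₁, s₂⟩` or the conjugates of `s₁` by `s₀` and `s₂` agree; and the intersection
condition fails for the triple, namely `⟨s₀, s₁⟩ ∩ ⟨s₁, s₂⟩ ≠ ⟨s₁⟩`. -/
def TriplesViolateIntersection (G : Type*) [Group G] : Prop :=
  ∀ s₀ s₁ s₂ : G, IsConnectedStringDiagram ![s₀, s₁, s₂] →
    ((∃ z : G, IsCentralInvolution z ∧
        z ∈ Subgroup.closure {s₀, s₁} ⊓ Subgroup.closure {s₁, s₂}) ∨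
      ConjugatesAgree s₀ s₁ s₂) ∧
    Subgroup.closure {s₀, s₁} ⊓ Subgroup.closure {s₁, s₂} ≠ Subgroup.closure {s₁}

/-! ### The presentations

A relation `lhs = rhs` is written as the relator `lhs * rhs⁻¹`, i.e. `lhs / rhs`. The generators
`p, q, r` (and `s`) are the generators `0, 1, 2` (and `3`) of the free group. -/

def relNII (m : ℕ) (e₁ e₂ e₃ e₄ e₅ : ℤ) : Set (FreeGroup (Fin 3)) :=
  let p : FreeGroup (Fin 3) := FreeGroup.of 0
  let q : FreeGroup (Fin 3) := FreeGroup.of 1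
  let r : FreeGroup (Fin 3) := FreeGroup.of 2
  { p ^ 2 ^ (m - 2),
    q ^ 2,
    r ^ 2 / p ^ (2 ^ (m - 3) * e₅),
    (q⁻¹ * p * q) / p ^ (1 + 2 ^ (m - 3) * e₂),
    (r⁻¹ * p * r) / p ^ (e₁ + 2 ^ (m - 3) * e₃),
    (r⁻¹ * q * r) / (q * p ^ (2 ^ (m - 3) * e₄)) }

def relMIIA (m : ℕ) (e₁ e₂ e₃ e₄ e₅ e₆ e₇ e₈ : ℤ) : Set (FreeGroup (Fin 3)) :=
  let p : FreeGroup (Fin 3) := FreeGroup.of 0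
  let q : FreeGroup (Fin 3) := FreeGroup.of 1
  let r : FreeGroup (Fin 3) := FreeGroup.of 2
  { p ^ 2 ^ (m - 3),
    q ^ 4,
    r ^ 2 / (q ^ (2 * e₃) * p ^ (2 ^ (m - 4) * e₄)),
    (q⁻¹ * p * q) / p ^ (1 + 2 ^ (m - 5) * e₇),
    (r⁻¹ * p * r) / (q ^ (2 * e₁) * p ^ (e₈ + 2 ^ (m - 4) * e₅)),
    (r⁻¹ * q * r) / (q ^ (1 + 2 * e₂) * p ^ (2 ^ (m - 5) * e₆)) }

def relMIIB (m u : ℕ) (e₁ e₂ e₃ e₄ e₅ e₆ e₇ : ℤ) : Set (FreeGroup (Fin 3)) :=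
  let p : FreeGroup (Fin 3) := FreeGroup.of 0
  let q : FreeGroup (Fin 3) := FreeGroup.of 1
  let r : FreeGroup (Fin 3) := FreeGroup.of 2
  { p ^ 2 ^ (m - 3),
    q ^ 4,
    r ^ 2 / q ^ (2 * e₃),
    (q⁻¹ * p * q) / p ^ (-1 + 2 ^ (m - 5) * e₆),
    (r⁻¹ * p * r) / (q ^ (2 * e₁) * p ^ (e₇ + 2 ^ (m - 4) * e₅)),
    (r⁻¹ * q * r) / (q ^ (1 + 2 * e₂) * p ^ (2 ^ u * e₄)) }

def relMIIC (m : ℕ) (e₁ e₂ : ℤ) : Set (FreeGroup (Fin 3)) :=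
  let p : FreeGroup (Fin 3) := FreeGroup.of 0
  let q : FreeGroup (Fin 3) := FreeGroup.of 1
  let r : FreeGroup (Fin 3) := FreeGroup.of 2
  { p ^ 2 ^ (m - 3),
    q ^ 4 / p ^ 2 ^ (m - 4),
    r ^ 2,
    (q⁻¹ * p * q) / p⁻¹,
    (r⁻¹ * p * r) / p ^ (1 + 2 ^ (m - 4) * e₂),
    (r⁻¹ * q * r) / q ^ (1 + 2 * e₁) }

def relMIID (m u : ℕ) (e₁ e₂ e₃ e₄ e₅ e₆ e₇ e₈ : ℤ) : Set (FreeGroup (Fin 3)) :=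
  let p : FreeGroup (Fin 3) := FreeGroup.of 0
  let q : FreeGroup (Fin 3) := FreeGroup.of 1
  let r : FreeGroup (Fin 3) := FreeGroup.of 2
  { p ^ 2 ^ (m - 3),
    q ^ 4,
    r ^ 2 / q ^ (2 * e₃),
    (q⁻¹ * p * q) / (q ^ 2 * p ^ (-1 + 2 ^ (m - 4) * e₇)),
    ((q ^ 2)⁻¹ * p * q ^ 2) / p ^ (1 + 2 ^ (m - 4) * e₆),
    (r⁻¹ * p * r) / (q ^ (2 * e₁) * p ^ (e₈ + 2 ^ (m - 4) * e₅)),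
    (r⁻¹ * q * r) / (q ^ (1 + 2 * e₂) * p ^ (2 ^ u * e₄)) }

def relMIIE (m : ℕ) (e₁ e₂ e₃ e₄ : ℤ) : Set (FreeGroup (Fin 3)) :=
  let p : FreeGroup (Fin 3) := FreeGroup.of 0
  let q : FreeGroup (Fin 3) := FreeGroup.of 1
  let r : FreeGroup (Fin 3) := FreeGroup.of 2
  { p ^ 2 ^ (m - 3),
    q ^ 4,
    r ^ 2,
    (q⁻¹ * p * q) / (q ^ 2 * p ^ (1 - 2 ^ (m - 5) * e₂)),
    ((q ^ 2)⁻¹ * p * q ^ 2) / p ^ (1 + 2 ^ (m - 4) * e₂),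
    (r⁻¹ * p * r) / p ^ (e₁ + 2 ^ (m - 4) * e₄),
    (r⁻¹ * q * r) / (q * p ^ (2 ^ (m - 5) * e₃)) }

def relMIIF (m : ℕ) (e₁ e₂ e₃ e₄ e₅ : ℤ) : Set (FreeGroup (Fin 3)) :=
  let p : FreeGroup (Fin 3) := FreeGroup.of 0
  let q : FreeGroup (Fin 3) := FreeGroup.of 1
  let r : FreeGroup (Fin 3) := FreeGroup.of 2
  { p ^ 2 ^ (m - 3),
    q ^ 4 / p ^ 2 ^ (m - 4),
    r ^ 2,
    (q⁻¹ * p * q) / (q ^ 2 * p ^ (-1 + 2 ^ (m - 4) * e₅)),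
    ((q ^ 2)⁻¹ * p * q ^ 2) / p ^ (1 + 2 ^ (m - 4) * e₁),
    (r⁻¹ * p * r) / (q ^ (2 * e₃) * p ^ (1 + 2 ^ (m - 4) * e₂)),
    (r⁻¹ * q * r) / (q ^ (1 + 2 * e₃) * p ^ (2 ^ (m - 4) * e₄)) }

def relMIII (m : ℕ) (e₁ e₂ e₃ e₄ e₅ e₆ e₇ e₈ : ℤ) : Set (FreeGroup (Fin 4)) :=
  let p : FreeGroup (Fin 4) := FreeGroup.of 0
  let q : FreeGroup (Fin 4) := FreeGroup.of 1
  let r : FreeGroup (Fin 4) := FreeGroup.of 2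
  let s : FreeGroup (Fin 4) := FreeGroup.of 3
  { p ^ 2 ^ (m - 3),
    q ^ 2,
    r ^ 2 / p ^ (2 ^ (m - 4) * e₈),
    s ^ 2 / p ^ (2 ^ (m - 4) * e₅),
    (q⁻¹ * p * q) / p,
    (r⁻¹ * p * r) / p ^ (e₂ + 2 ^ (m - 4) * e₃),
    (s⁻¹ * p * s) / p ^ (e₁ + 2 ^ (m - 4) * e₆),
    (r⁻¹ * q * r) / q,
    (s⁻¹ * q * s) / (q * p ^ (2 ^ (m - 4) * e₄)),
    (s⁻¹ * r * s) / (r * p ^ (2 ^ (m - 4) * e₇)) }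

/-! ### The parameters of the groups in `Γ`

Only the rows of the parameter tables that belong to groups in `Γ` occur; the value for the other
`n` is never used. For these rows the exponent `u` equals `m - 4`. -/

def tableNII (m : ℕ) : ℕ → Set (FreeGroup (Fin 3))
  | 3 => relNII m (-1) 0 0 1 0
  | 4 => relNII m (-1) 1 1 0 0
  | 5 => relNII m (-1) 0 0 0 0
  | _ => ∅

def tableMIIA (m : ℕ) : ℕ → Set (FreeGroup (Fin 3))
  | 39 => relMIIA m 0 1 0 0 0 0 0 (-1)
  | 40 => relMIIA m 0 1 0 0 0 0 2 (-1)
  | _ => ∅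

def tableMIIB (m : ℕ) : ℕ → Set (FreeGroup (Fin 3))
  | 19 => relMIIB m (m - 4) 0 1 0 0 0 0 1
  | 20 => relMIIB m (m - 4) 0 1 0 0 1 2 1
  | _ => ∅

def tableMIIC (m : ℕ) : ℕ → Set (FreeGroup (Fin 3))
  | 5 => relMIIC m (-1) 0
  | _ => ∅

def tableMIID (m : ℕ) : ℕ → Set (FreeGroup (Fin 3))
  | 3 => relMIID m (m - 4) 1 1 0 0 0 1 0 1
  | 17 => relMIID m (m - 4) 1 1 0 0 1 0 0 1
  | 18 => relMIID m (m - 4) 0 0 0 0 0 0 0 (-1)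
  | 19 => relMIID m (m - 4) 1 1 0 0 0 0 0 1
  | _ => ∅

def tableMIIE (m : ℕ) : ℕ → Set (FreeGroup (Fin 3))
  | 1 => relMIIE m (-1) 1 1 0
  | _ => ∅

def tableMIIF (m : ℕ) : ℕ → Set (FreeGroup (Fin 3))
  | 8 => relMIIF m 0 0 1 1 0
  | 9 => relMIIF m 0 1 1 1 0
  | _ => ∅

def tableMIII (m : ℕ) : ℕ → Set (FreeGroup (Fin 4))
  | 3 => relMIII m (-1) 1 0 0 0 0 1 0
  | 4 => relMIII m (-1) 1 1 0 0 1 0 0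
  | 5 => relMIII m (-1) 1 0 0 0 0 0 0
  | 10 => relMIII m 1 (-1) 0 1 1 0 0 0
  | 11 => relMIII m 1 (-1) 1 1 1 0 0 0
  | 13 => relMIII m (-1) 1 1 1 0 0 0 0
  | 14 => relMIII m (-1) (-1) 0 1 0 0 0 1
  | _ => ∅

/-! ### The groups -/

/-! `NII n m` is the group denoted `N_{II,n}(m)`, `MIIA n m` the group `M_{II-A,n}(m)`, etc. -/

abbrev NII (n m : ℕ) : Type := PresentedGroup (tableNII m n)
abbrev MIIA (n m : ℕ) : Type := PresentedGroup (tableMIIA m n)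
abbrev MIIB (n m : ℕ) : Type := PresentedGroup (tableMIIB m n)
abbrev MIIC (n m : ℕ) : Type := PresentedGroup (tableMIIC m n)
abbrev MIID (n m : ℕ) : Type := PresentedGroup (tableMIID m n)
abbrev MIIE (n m : ℕ) : Type := PresentedGroup (tableMIIE m n)
abbrev MIIF (n m : ℕ) : Type := PresentedGroup (tableMIIF m n)
abbrev MIII (n m : ℕ) : Type := PresentedGroup (tableMIII m n)

/-! The generator `p` of the groups for which it occurs in the statement. -/

abbrev pNII (n m : ℕ) : NII n m := PresentedGroup.of 0
abbrev pMIIC (n m : ℕ) : MIIC n m := PresentedGroup.of 0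
abbrev pMIIE (n m : ℕ) : MIIE n m := PresentedGroup.of 0
abbrev pMIIF (n m : ℕ) : MIIF n m := PresentedGroup.of 0
abbrev pMIII (n m : ℕ) : MIII n m := PresentedGroup.of 0

/-! ### Triples of involutions and the intersection condition -/

section StringDiagrams

variable {G : Type*} [Group G]

/-! Negative half. A connected triple breaks the intersection condition as soon as ⟨s₀, s₁⟩ ∩ ⟨s₁,
s₂⟩ contains something besides 1 and s₁. A central involution z will do, since s₁ is not central,
and so will a common conjugate of s₁ by s₀ and s₂. Every group in Γ maps onto the elementary abelian
group of order 8, so a generating family has at least three members, and its first three form a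
connected triple. Thus it suffices to spoil all triples (`not_isConnectedStringCGroup`).

The involution z is found in one of four ways. (a) In N_II and M_III the subgroup ⟨p⟩ is normal with
elementary abelian quotient. Every square lies in ⟨p⟩, and each nontrivial element of this cyclic
2-group has the involution of ⟨p⟩ as a power (`reach_of_cyclic_normal`). (b) In the A, B and D
groups there is a sign character whose kernel contains only central involutions. Then s₀, s₁, s₂ all
have sign -1, so s₀s₂ is central, (s₀s₁)² is inverse to (s₁s₂)², and a power of it is a central
involution (`triplesHaveCommonCentralPower_of_character`). (c) In the C and F groups q⁴ is the
involution of ⟨p⟩. Squares have the form pᴬ(q²)ᴮ, and those not yet in ⟨p⟩ enter it nontrivially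
when squared once more (`reach_of_quartic_involution`). (d) In M_{II-E,1} the argument splits
according to a sign of s₁: one sign leads back to squares in ⟨p⟩, the other makes s₀s₂ commute with
s₁ (`commonEvenPower_or_conjugatesAgree`).

Relations bound the order of p only from above. Where the exact order matters, explicit permutations
of finitely many copies of ℤ/2^(k+4) bound it from below. Quotients inside products of dihedral
groups of order 8 decide which cosets can contain involutions.

Positive half. In M_{II-D,3} and M_{II-D,19} the triple r, qr, qp works. Sign characters dual to it
reduce the intersection condition to ⟨(s₀s₁)²⟩ ∩ ⟨(s₂s₁)²⟩ = 1, which is visible in a product of two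
dihedral groups (`intersectionCondition_of_characters`). -/

lemma IsConnectedStringDiagram.triple {s₀ s₁ s₂ : G}
    (h : IsConnectedStringDiagram ![s₀, s₁, s₂]) :
    orderOf s₀ = 2 ∧ orderOf s₁ = 2 ∧ orderOf s₂ = 2 ∧ orderOf (s₀ * s₂) = 2 ∧
      s₀ * s₁ ≠ s₁ * s₀ ∧ s₁ * s₂ ≠ s₂ * s₁ := by
  have key : ∀ a b : G, orderOf a = 2 → orderOf b = 2 →
      (2 < orderOf (a * b) ∨ orderOf (a * b) = 0) → a * b ≠ b * a := by
    intro a b ha hb hab hc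
    have h1 : (a * b) ^ 2 = 1 := by
      rw [(show Commute a b from hc).mul_pow, ← ha, pow_orderOf_eq_one, ha, ← hb,
        pow_orderOf_eq_one, one_mul]
    have h2 := orderOf_le_of_pow_eq_one (by norm_num) h1
    have h3 := orderOf_pos_iff.2 (isOfFinOrder_iff_pow_eq_one.2 ⟨2, by norm_num, h1⟩)
    omega
  have h0 := h.involution 0
  have h1 := h.involution 1
  have h2 := h.involution 2
  have h02 := h.string 0 2 (by decide)
  have h01 := h.connected 0 1 (by decide)
  have h12 := h.connected 1 2 (by decide)
  exact ⟨h0, h1, h2, h02, key _ _ h0 h1 h01, key _ _ h1 h2 h12⟩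

lemma orderOf_eq_two_iff' {x : G} : orderOf x = 2 ↔ x * x = 1 ∧ x ≠ 1 := by
  rw [← pow_two]
  exact orderOf_eq_prime_iff (p := 2)

lemma mem_closure_singleton_of_orderOf_eq_two {s x : G} (hs : orderOf s = 2)
    (hx : x ∈ Subgroup.closure {s}) : x = 1 ∨ x = s := by
  obtain ⟨k, rfl⟩ := Subgroup.mem_closure_singleton.1 hx
  have h2 : s ^ (2 : ℤ) = 1 := by
    have := pow_orderOf_eq_one s
    rw [hs] at this
    exact_mod_cast this
  rcases Int.even_or_odd' k with ⟨c, rfl | rfl⟩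
  · left; rw [zpow_mul, h2, one_zpow]
  · right; rw [zpow_add, zpow_mul, h2, one_zpow, one_mul, zpow_one]

lemma sq_mul_ne_one_of_not_commute {a b : G} (ha : orderOf a = 2) (hb : orderOf b = 2)
    (hab : a * b ≠ b * a) : (a * b) ^ 2 ≠ 1 := by
  intro h
  apply hab
  rw [pow_two] at h
  have := eq_inv_of_mul_eq_one_left h
  rwa [mul_inv_rev, inv_eq_self_of_orderOf_eq_two ha, inv_eq_self_of_orderOf_eq_two hb] at this

/-- The only candidates in ⟨s₁⟩ are 1 and s₁; if z were s₁, then s₁ would be central, against `h01`.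
-/
lemma violates_of_central {s₀ s₁ s₂ z : G} (h1 : orderOf s₁ = 2)
    (h01 : s₀ * s₁ ≠ s₁ * s₀) (hz : IsCentralInvolution z) (hc : CommonEvenPower s₀ s₁ s₂ z) :
    z ∈ Subgroup.closure {s₀, s₁} ⊓ Subgroup.closure {s₁, s₂} ∧
    Subgroup.closure {s₀, s₁} ⊓ Subgroup.closure {s₁, s₂} ≠ Subgroup.closure {s₁} := by
  have hmem : z ∈ Subgroup.closure {s₀, s₁} ⊓ Subgroup.closure {s₁, s₂} := by
    obtain ⟨x, y, hx, hy⟩ := hc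
    constructor
    · rw [← hx]
      exact zpow_mem (mul_mem (Subgroup.subset_closure (by simp))
        (Subgroup.subset_closure (by simp))) _
    · rw [← hy]
      exact zpow_mem (mul_mem (Subgroup.subset_closure (by simp))
        (Subgroup.subset_closure (by simp))) _
  refine ⟨hmem, fun h => ?_⟩
  rw [h] at hmem
  rcases mem_closure_singleton_of_orderOf_eq_two h1 hmem with h | h
  · exact (orderOf_eq_two_iff'.1 hz.1).2 h
  · exact h01 (h ▸ hz.2 s₀)

/-- The common conjugate lies in both dihedral groups. If it were 1 or s₁, then s₁ = 1 or s₁ would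
commute with s₀. -/
lemma violates_of_conjugatesAgree {s₀ s₁ s₂ : G} (h1 : orderOf s₁ = 2)
    (h01 : s₀ * s₁ ≠ s₁ * s₀) (hc : ConjugatesAgree s₀ s₁ s₂) :
    Subgroup.closure {s₀, s₁} ⊓ Subgroup.closure {s₁, s₂} ≠ Subgroup.closure {s₁} := by
  intro h
  have m : ∀ {s : G}, s⁻¹ * s₁ * s ∈ Subgroup.closure ({s, s₁} : Set G) := by
    intro s
    exact mul_mem (mul_mem (inv_mem (Subgroup.subset_closure (by simp)))
      (Subgroup.subset_closure (by simp))) (Subgroup.subset_closure (by simp))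
  have hmem : s₀⁻¹ * s₁ * s₀ ∈ Subgroup.closure {s₀, s₁} ⊓ Subgroup.closure {s₁, s₂} := by
    refine ⟨m, ?_⟩
    rw [hc, Set.pair_comm]
    exact m
  rw [h] at hmem
  rcases mem_closure_singleton_of_orderOf_eq_two h1 hmem with h | h
  · apply (orderOf_eq_two_iff'.1 h1).2
    rw [mul_assoc, inv_mul_eq_one] at h
    exact (mul_eq_right.1 h.symm)
  · apply h01
    rw [mul_assoc, inv_mul_eq_iff_eq_mul] at h
    exact h.symm

lemma NonCommutingProductsReach.commonEvenPower {z : G} (h : NonCommutingProductsReach z)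
    {s₀ s₁ s₂ : G} (hs : IsConnectedStringDiagram ![s₀, s₁, s₂]) :
    CommonEvenPower s₀ s₁ s₂ z := by
  obtain ⟨h0, h1, h2, -, h01, h12⟩ := hs.triple
  obtain ⟨x, hx⟩ := h _ _ h0 h1 h01
  obtain ⟨y, hy⟩ := h _ _ h1 h2 h12
  exact ⟨x, y, hx, hy⟩

lemma triplesViolateIntersection_of_central_or_agree
    (h : ∀ s₀ s₁ s₂ : G, IsConnectedStringDiagram ![s₀, s₁, s₂] →
      (∃ z : G, IsCentralInvolution z ∧ CommonEvenPower s₀ s₁ s₂ z) ∨ ConjugatesAgree s₀ s₁ s₂) :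
    TriplesViolateIntersection G := by
  intro s₀ s₁ s₂ hs
  obtain ⟨-, h1, -, -, h01, -⟩ := hs.triple
  rcases h s₀ s₁ s₂ hs with ⟨z, hz, hc⟩ | hc
  · have := violates_of_central h1 h01 hz hc
    exact ⟨Or.inl ⟨z, hz, this.1⟩, this.2⟩
  · exact ⟨Or.inr hc, violates_of_conjugatesAgree h1 h01 hc⟩

lemma TriplesHaveCommonCentralPower.violates (h : TriplesHaveCommonCentralPower G) :
    TriplesViolateIntersection G :=
  triplesViolateIntersection_of_central_or_agree fun s₀ s₁ s₂ hs => Or.inl (h s₀ s₁ s₂ hs)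

lemma NonCommutingProductsReach.violates {z : G} (hz : IsCentralInvolution z)
    (h : NonCommutingProductsReach z) : TriplesViolateIntersection G :=
  triplesViolateIntersection_of_central_or_agree fun _ _ _ hs =>
    Or.inl ⟨z, hz, h.commonEvenPower hs⟩

/-- The elementary abelian group of order `8`. -/
abbrev ElementaryAbelianEight : Type := ℤˣ × ℤˣ × ℤˣ

lemma closure_pair_ne_top (x y : ElementaryAbelianEight) : Subgroup.closure {x, y} ≠ ⊤ := by
  intro h
  let K : Subgroup ElementaryAbelianEight :=
    { carrier := {v | v = 1 ∨ v = x ∨ v = y ∨ v = x * y}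
      mul_mem' := by
        have : ∀ x y a b : ElementaryAbelianEight, (a = 1 ∨ a = x ∨ a = y ∨ a = x * y) →
            (b = 1 ∨ b = x ∨ b = y ∨ b = x * y) →
            (a * b = 1 ∨ a * b = x ∨ a * b = y ∨ a * b = x * y) := by
          have hsq : ∀ a : ElementaryAbelianEight, a * a = 1 := by decide
          rintro x y a b (rfl | rfl | rfl | rfl) (rfl | rfl | rfl | rfl) <;>
            simp [hsq, mul_comm, mul_left_comm]
        intro a b; exact this x y a b
      one_mem' := Or.inl rfl
      inv_mem' := by
        have : ∀ a : ElementaryAbelianEight, a⁻¹ = a := by decide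
        intro a ha
        rw [this]
        exact ha }
  have hK : (⊤ : Subgroup ElementaryAbelianEight) ≤ K := by
    rw [← h, Subgroup.closure_le]
    rintro v (rfl | rfl)
    · exact Or.inr (Or.inl rfl)
    · exact Or.inr (Or.inr (Or.inl rfl))
  have : ∀ x y : ElementaryAbelianEight, ∃ v, ¬ (v = 1 ∨ v = x ∨ v = y ∨ v = x * y) := by decide
  obtain ⟨v, hv⟩ := this x y
  exact hv (hK (Subgroup.mem_top v))

/-- The quotient of rank three rules out strings of length at most two. For longer ones the index
sets {0, 1} and {1, 2} give the equality that `hv` forbids. -/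
lemma not_isConnectedStringCGroup (hv : TriplesViolateIntersection G)
    {φ : G →* ElementaryAbelianEight} (hφ : Function.Surjective φ) :
    ¬ IsConnectedStringCGroup G := by
  rintro ⟨n, hn, s, hgen, hs, hint⟩
  have hmap : Subgroup.closure (Set.range (φ ∘ s)) = ⊤ := by
    rw [Set.range_comp, ← MonoidHom.map_closure, hgen, ← MonoidHom.range_eq_map,
      MonoidHom.range_eq_top.2 hφ]
  rcases Nat.lt_or_ge n 3 with h3 | h3
  · obtain ⟨x, y, hxy⟩ : ∃ x y, Set.range (φ ∘ s) ⊆ {x, y} := by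
      -- With at most two members, the first and the last (possibly equal) exhaust the family.
      refine ⟨φ (s ⟨0, by omega⟩), φ (s ⟨n - 1, by omega⟩), ?_⟩
      rintro _ ⟨⟨i, hi⟩, rfl⟩
      rcases (by omega : i = 0 ∨ i = n - 1) with rfl | rfl
      · exact Or.inl rfl
      · exact Or.inr rfl
    exact closure_pair_ne_top x y (top_le_iff.1 (hmap ▸ Subgroup.closure_mono hxy))
  · obtain ⟨k, rfl⟩ : ∃ k, n = k + 3 := ⟨n - 3, by omega⟩
    have e : ∀ j : Fin 3, (![s 0, s 1, s 2] : Fin 3 → G) j = s (Fin.castLE (by omega) j) := by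
      intro j; fin_cases j <;> rfl
    have hd : IsConnectedStringDiagram ![s 0, s 1, s 2] :=
      { injective := fun i j hij => by
          rw [e, e] at hij
          exact Fin.castLE_injective _ (hs.injective hij)
        involution := fun j => by rw [e]; exact hs.involution _
        string := fun i j hij => by rw [e, e]; exact hs.string _ _ (by simpa using hij)
        connected := fun i j hij => by rw [e, e]; exact hs.connected _ _ (by simpa using hij) }
    apply (hv _ _ _ hd).2
    have := hint {0, 1} {1, 2}
    have h012 : ({0, 1} ∩ {1, 2} : Set (Fin (k + 3))) = {1} := by
      ext i
      simp only [Set.mem_inter_iff, Set.mem_insert_iff, Set.mem_singleton_iff, Fin.ext_iff]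
      simp only [Fin.val_zero, Fin.val_one, Fin.val_two]
      omega
    rwa [h012, Set.image_pair, Set.image_pair, Set.image_singleton] at this

end StringDiagrams

/-! ### Groups given by generators and a normal subgroup -/

section Generators

variable {G : Type*} [Group G]

/-- The relations only provide x⁻¹Nx ⊆ N. The reverse conjugation comes from a power of x lying in
N: x n x⁻¹ is the conjugate of x⁻ᵏ n xᵏ by xᵏ⁺¹ ∈ N. Finiteness of the group is therefore not
needed. -/
lemma normal_of_generators {N : Subgroup G} {S : Set G} (hS : Subgroup.closure S = ⊤)
    (hconj : ∀ x ∈ S, ∀ n ∈ N, x⁻¹ * n * x ∈ N) (hfin : ∀ x ∈ S, ∃ k : ℕ, x ^ (k + 1) ∈ N) :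
    N.Normal := by
  have hpow : ∀ x ∈ S, ∀ k : ℕ, ∀ n ∈ N, (x ^ k)⁻¹ * n * x ^ k ∈ N := by
    intro x hx k
    induction k with
    | zero => intro n hn; simpa using hn
    | succ k ih =>
      intro n hn
      have := hconj x hx _ (ih n hn)
      rwa [show x⁻¹ * ((x ^ k)⁻¹ * n * x ^ k) * x = (x ^ (k + 1))⁻¹ * n * x ^ (k + 1) by
        rw [pow_succ]; group] at this
  have hconj' : ∀ x ∈ S, ∀ n ∈ N, x * n * x⁻¹ ∈ N := by
    intro x hx n hn
    obtain ⟨k, hk⟩ := hfin x hx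
    have := mul_mem (mul_mem hk (hpow x hx k n hn)) (inv_mem hk)
    rwa [show x ^ (k + 1) * ((x ^ k)⁻¹ * n * x ^ k) * (x ^ (k + 1))⁻¹ = x * n * x⁻¹ by
      rw [pow_succ']; group] at this
  refine ⟨fun n hn g => ?_⟩
  have hg : g ∈ Subgroup.closure S := hS ▸ Subgroup.mem_top g
  have hboth : ∀ g ∈ Subgroup.closure S,
      (∀ n ∈ N, g * n * g⁻¹ ∈ N) ∧ ∀ n ∈ N, g⁻¹ * n * g ∈ N := by
    intro g hg
    induction hg using Subgroup.closure_induction with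
    | mem x hx => exact ⟨hconj' x hx, hconj x hx⟩
    | one => simp
    | mul x y _ _ hx hy =>
      refine ⟨fun n hn => ?_, fun n hn => ?_⟩
      · simpa only [mul_inv_rev, mul_assoc] using hx.1 _ (hy.1 n hn)
      · simpa only [mul_inv_rev, mul_assoc] using hy.2 _ (hx.2 n hn)
    | inv x _ hx => exact ⟨by simpa using hx.2, by simpa using hx.1⟩
  exact (hboth g hg).1 n hn

lemma commute_of_generators {z : G} {S : Set G} (hS : Subgroup.closure S = ⊤)
    (h : ∀ x ∈ S, Commute x z) (g : G) : g * z = z * g := by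
  have : Subgroup.closure S ≤ Subgroup.centralizer {z} := by
    rw [Subgroup.closure_le]
    intro x hx
    exact Subgroup.mem_centralizer_singleton_iff.2 (h x hx)
  exact Subgroup.mem_centralizer_singleton_iff.1 (this (hS ▸ Subgroup.mem_top g))

lemma commute_of_commutator_mem {N : Subgroup G} [N.Normal] {x y : G}
    (h : y⁻¹ * (x⁻¹ * y * x) ∈ N) : Commute (x : G ⧸ N) (y : G ⧸ N) := by
  have h1 := (QuotientGroup.eq_one_iff _).2 h
  simp only [QuotientGroup.mk_mul, QuotientGroup.mk_inv] at h1
  rw [inv_mul_eq_one, mul_assoc, eq_inv_mul_iff_mul_eq] at h1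
  exact h1

/-- Modulo N the generators commute and square to 1, so the quotient is abelian of exponent dividing
2. -/
lemma sq_mem_of_generators {N : Subgroup G} (hN : N.Normal) {S : Set G}
    (hS : Subgroup.closure S = ⊤) (hsq : ∀ x ∈ S, x ^ 2 ∈ N)
    (hcomm : ∀ x ∈ S, ∀ y ∈ S, Commute (x : G ⧸ N) (y : G ⧸ N)) (g : G) : g ^ 2 ∈ N := by
  have hcomm' : ∀ a b : G, Commute (a : G ⧸ N) (b : G ⧸ N) := by
    have h1 : ∀ x ∈ S, ∀ b : G, Commute (b : G ⧸ N) (x : G ⧸ N) := by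
      intro x hx b
      have hb : b ∈ Subgroup.closure S := hS ▸ Subgroup.mem_top b
      induction hb using Subgroup.closure_induction with
      | mem y hy => exact hcomm y hy x hx
      | one => exact Commute.one_left _
      | mul a b _ _ ha hb => exact Commute.mul_left ha hb
      | inv a _ ha => exact Commute.inv_left ha
    intro a b
    have hb : b ∈ Subgroup.closure S := hS ▸ Subgroup.mem_top b
    induction hb using Subgroup.closure_induction with
    | mem y hy => exact h1 y hy a
    | one => exact Commute.one_right _
    | mul x b _ _ ha hb => exact Commute.mul_right ha hb
    | inv x _ ha => exact Commute.inv_right ha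
  have hg : g ∈ Subgroup.closure S := hS ▸ Subgroup.mem_top g
  rw [← QuotientGroup.eq_one_iff, QuotientGroup.mk_pow]
  induction hg using Subgroup.closure_induction with
  | mem x hx => rw [← QuotientGroup.mk_pow, QuotientGroup.eq_one_iff]; exact hsq x hx
  | one => simp
  | mul a b _ _ ha hb => rw [QuotientGroup.mk_mul, (hcomm' a b).mul_pow, ha, hb, one_mul]
  | inv a _ ha => rw [QuotientGroup.mk_inv, inv_pow, ha, inv_one]

lemma exists_coset_representative {N : Subgroup G} (hN : N.Normal) {p q r : G}
    (hgen : Subgroup.closure {p, q, r} = ⊤) (hp : p ∈ N) (hq : q ^ 2 ∈ N) (hr : r ^ 2 ∈ N)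
    (hqr : q⁻¹ * (r⁻¹ * q * r) ∈ N) (g : G) :
    ∃ n ∈ N, g = n ∨ g = n * q ∨ g = n * r ∨ g = n * (q * r) := by
  have hc := (commute_of_commutator_mem hqr).symm
  have key : ∃ a b : ℤ, (g : G ⧸ N) = (q : G ⧸ N) ^ a * (r : G ⧸ N) ^ b := by
    have hg : g ∈ Subgroup.closure {p, q, r} := hgen ▸ Subgroup.mem_top g
    induction hg using Subgroup.closure_induction with
    | mem x hx =>
      rcases hx with rfl | rfl | rfl
      · exact ⟨0, 0, by simpa using (QuotientGroup.eq_one_iff _).2 hp⟩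
      · exact ⟨1, 0, by simp⟩
      · exact ⟨0, 1, by simp⟩
    | one => exact ⟨0, 0, by simp⟩
    | mul x y _ _ hx hy =>
      obtain ⟨a, b, h⟩ := hx
      obtain ⟨c, d, h'⟩ := hy
      refine ⟨a + c, b + d, ?_⟩
      rw [QuotientGroup.mk_mul, h, h', zpow_add, zpow_add, mul_assoc, mul_assoc,
        ← mul_assoc (_ ^ b), ((hc.zpow_zpow c b).eq).symm, mul_assoc]
    | inv x _ hx =>
      obtain ⟨a, b, h⟩ := hx
      refine ⟨-a, -b, ?_⟩
      rw [QuotientGroup.mk_inv, h, mul_inv_rev, zpow_neg, zpow_neg]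
      exact ((hc.zpow_zpow a b).inv_inv.eq).symm
  have hq' : (q : G ⧸ N) ^ (2 : ℤ) = 1 := by
    rw [← QuotientGroup.mk_zpow, QuotientGroup.eq_one_iff]; exact_mod_cast hq
  have hr' : (r : G ⧸ N) ^ (2 : ℤ) = 1 := by
    rw [← QuotientGroup.mk_zpow, QuotientGroup.eq_one_iff]; exact_mod_cast hr
  have hrep : ∀ t : G, (g : G ⧸ N) = t → ∃ n ∈ N, g = n * t := by
    intro t ht
    refine ⟨g * t⁻¹, ?_, by simp⟩
    rw [← QuotientGroup.eq_one_iff, QuotientGroup.mk_mul, ht, QuotientGroup.mk_inv, mul_inv_cancel]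
  obtain ⟨a, b, h⟩ := key
  rcases Int.even_or_odd' a with ⟨c, rfl | rfl⟩ <;> rcases Int.even_or_odd' b with ⟨d, rfl | rfl⟩ <;>
    simp only [zpow_add, zpow_mul, hq', hr', one_zpow, one_mul, mul_one, zpow_one] at h
  · exact ⟨g, (QuotientGroup.eq_one_iff _).1 h, Or.inl rfl⟩
  · obtain ⟨n, hn, e⟩ := hrep r h
    exact ⟨n, hn, Or.inr (Or.inr (Or.inl e))⟩
  · obtain ⟨n, hn, e⟩ := hrep q h
    exact ⟨n, hn, Or.inr (Or.inl e)⟩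
  · obtain ⟨n, hn, e⟩ := hrep (q * r) (by simpa using h)
    exact ⟨n, hn, Or.inr (Or.inr (Or.inr e))⟩

/-! ### Powers in cyclic `2`-groups -/

lemma exists_zpow_eq_involution {p : G} {k : ℕ} (hp : p ^ 2 ^ (k + 1) = 1) {i : ℤ}
    (hi : p ^ i ≠ 1) : ∃ x : ℤ, (p ^ i) ^ x = p ^ 2 ^ k := by
  have hp' : p ^ (2 ^ (k + 1) : ℤ) = 1 := by exact_mod_cast hp
  have hi0 : i ≠ 0 := by rintro rfl; simp at hi
  obtain ⟨n, hin, hn⟩ := (Int.finiteMultiplicity_iff.2 ⟨by norm_num, hi0⟩ :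
    FiniteMultiplicity (2 : ℤ) i).exists_eq_pow_mul_and_not_dvd
  obtain ⟨c, rfl⟩ : Odd n := by rwa [← Int.not_even_iff_odd, even_iff_two_dvd]
  obtain ⟨v, hv⟩ : ∃ v, multiplicity 2 i = v := ⟨_, rfl⟩
  rw [hv] at hin
  clear hv
  have hv : v ≤ k := by
    by_contra hv
    apply hi
    obtain ⟨w, rfl⟩ : ∃ w, v = k + 1 + w := ⟨v - (k + 1), by omega⟩
    rw [hin, pow_add, mul_assoc, zpow_mul, hp', one_zpow]
  -- With i = 2ᵛ · odd and v ≤ k, this exponent turns i into an odd multiple of 2ᵏ.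
  refine ⟨2 ^ (k - v), ?_⟩
  rw [← zpow_mul, hin,
    show (2 : ℤ) ^ v * (2 * c + 1) * 2 ^ (k - v) = 2 ^ (k + 1) * c + 2 ^ k by
      rw [pow_succ]
      nth_rewrite 2 [show k = v + (k - v) by omega]
      nth_rewrite 3 [show k = v + (k - v) by omega]
      rw [pow_add]; ring,
    zpow_add, zpow_mul, hp', one_zpow, one_mul]
  exact_mod_cast rfl

lemma two_pow_dvd_of_zpow_eq_one {p : G} {k : ℕ} (hp : p ^ 2 ^ (k + 1) = 1)
    (hz : p ^ 2 ^ k ≠ 1) {i : ℤ} (hi : p ^ i = 1) : (2 ^ (k + 1) : ℤ) ∣ i := by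
  have := orderOf_dvd_iff_zpow_eq_one.2 hi
  rw [orderOf_eq_prime_pow hz hp] at this
  exact_mod_cast this

lemma zpow_eq_one_or_of_sq {p : G} {k : ℕ} (hp : p ^ 2 ^ (k + 1) = 1)
    (hz : p ^ 2 ^ k ≠ 1) {i : ℤ} (hi : p ^ (2 * i) = 1) : p ^ i = 1 ∨ p ^ i = p ^ 2 ^ k := by
  have h := two_pow_dvd_of_zpow_eq_one hp hz hi
  rw [pow_succ', mul_dvd_mul_iff_left (by norm_num)] at h
  obtain ⟨c, rfl⟩ := h
  have hp' : p ^ (2 ^ (k + 1) : ℤ) = 1 := by exact_mod_cast hp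
  rcases Int.even_or_odd' c with ⟨d, rfl | rfl⟩
  · left
    rw [← mul_assoc, ← pow_succ, zpow_mul, hp', one_zpow]
  · right
    rw [mul_add, ← mul_assoc, ← pow_succ, zpow_add, zpow_mul, hp', one_zpow, one_mul, mul_one]
    exact_mod_cast rfl

lemma exists_zpow_orderOf_eq_two {y : G} {k : ℕ} (hy : y ^ 2 ^ k = 1) (hne : y ≠ 1) :
    ∃ x : ℤ, orderOf (y ^ x) = 2 := by
  induction k with
  | zero => simp at hy; exact absurd hy hne
  | succ k ih =>
    by_cases h : y ^ 2 ^ k = 1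
    · exact ih h
    · refine ⟨2 ^ k, ?_⟩
      rw [orderOf_eq_two_iff', ← zpow_add, ← two_mul, ← pow_succ']
      exact ⟨by exact_mod_cast hy, by exact_mod_cast h⟩

/-! ### Sufficient conditions for the two kinds of solvability -/

lemma nonCommutingProductsReach_of_sq {z : G}
    (h : ∀ g : G, g ^ 2 ≠ 1 → ∃ x : ℤ, (g ^ 2) ^ x = z) : NonCommutingProductsReach z := by
  intro a b ha hb hab
  obtain ⟨x, hx⟩ := h _ (sq_mul_ne_one_of_not_commute ha hb hab)
  refine ⟨x, ?_⟩
  rw [zpow_mul]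
  exact_mod_cast hx

/-- If `s₀ s₂` commutes with `s₁`, then `(s₀ s₁)² = (s₁ s₂)⁻²`. -/
lemma sq_eq_of_commute {s₀ s₁ s₂ : G} (h0 : orderOf s₀ = 2) (h1 : orderOf s₁ = 2)
    (h2 : orderOf s₂ = 2) (hc : Commute (s₀ * s₂) s₁) :
    (s₀ * s₁) ^ 2 = ((s₁ * s₂) ^ 2)⁻¹ := by
  have e0 : s₀ * s₀ = 1 := (orderOf_eq_two_iff'.1 h0).1
  have e1 : s₁ * s₁ = 1 := (orderOf_eq_two_iff'.1 h1).1
  have e2 : s₂ * s₂ = 1 := (orderOf_eq_two_iff'.1 h2).1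
  have e : (s₀ * s₁) ^ 2 * (s₁ * s₂) ^ 2 = 1 := by
    calc (s₀ * s₁) ^ 2 * (s₁ * s₂) ^ 2
        = s₀ * s₁ * s₀ * (s₁ * s₁) * s₂ * s₁ * s₂ := by simp only [pow_two, mul_assoc]
      _ = s₀ * (s₁ * (s₀ * s₂)) * s₁ * s₂ := by rw [e1]; simp only [mul_assoc, one_mul]
      _ = s₀ * s₀ * s₂ * (s₁ * s₁) * s₂ := by rw [← hc.eq]; simp only [mul_assoc]
      _ = s₀ * s₀ * (s₂ * s₂) := by rw [e1]; simp only [mul_assoc, one_mul]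
      _ = 1 := by rw [e0, e2, one_mul]
  exact eq_inv_of_mul_eq_one_left e

lemma conjugatesAgree_of_commute {s₀ s₁ s₂ : G} (h2 : orderOf s₂ = 2)
    (hc : Commute (s₀ * s₂) s₁) : ConjugatesAgree s₀ s₁ s₂ := by
  have e2 : s₂⁻¹ = s₂ := inv_eq_self_of_orderOf_eq_two h2
  calc s₀⁻¹ * s₁ * s₀ = s₀⁻¹ * (s₁ * (s₀ * s₂)) * s₂⁻¹ := by group
    _ = s₂ * s₁ * s₂⁻¹ := by rw [← hc.eq]; group
    _ = s₂⁻¹ * s₁ * s₂ := by rw [e2]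

/-- No member of a connected triple is central, so all three have sign -1. Then s₀s₂ is an
involution in ker χ, hence central, and (s₀s₁)² = (s₁s₂)⁻². The involution among the powers of this
square again lies in ker χ and is therefore central. -/
lemma triplesHaveCommonCentralPower_of_character (χ : G →* ℤˣ)
    (hcent : ∀ x : G, orderOf x = 2 → χ x = 1 → ∀ g, g * x = x * g)
    (htors : ∀ g : G, ∃ k : ℕ, g ^ 2 ^ k = 1) : TriplesHaveCommonCentralPower G := by
  intro s₀ s₁ s₂ hs
  obtain ⟨h0, h1, h2, h02, h01, h12⟩ := hs.triple
  have hneg : ∀ a b : G, orderOf a = 2 → a * b ≠ b * a → χ a = -1 := by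
    intro a b ha hab
    exact (Int.units_eq_one_or (χ a)).resolve_left fun h => hab (hcent a ha h b).symm
  have c0 := hneg _ _ h0 h01
  have c1 := hneg _ _ h1 h12
  have c2 := hneg _ _ h2 h12.symm
  have hsq := sq_eq_of_commute h0 h1 h2
    (hcent _ h02 (by rw [map_mul, c0, c2]; rfl) s₁).symm
  obtain ⟨k, hk⟩ := htors ((s₀ * s₁) ^ 2)
  obtain ⟨x, hx⟩ := exists_zpow_orderOf_eq_two hk (sq_mul_ne_one_of_not_commute h0 h1 h01)
  refine ⟨_, ⟨hx, hcent _ hx ?_⟩, x, -x, ?_, ?_⟩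
  · simp [c0, c1]
  · rw [zpow_mul]; exact_mod_cast rfl
  · rw [hsq, inv_zpow, ← zpow_neg, zpow_mul]; exact_mod_cast rfl

/-! ### Products of two cyclic subgroups -/

/-- Normalising is enough here, and is all that is available in M_{II-E,1}, where q² does not
commute with p. -/
lemma mem_zpowers_sup_iff {p u : G} (h : u ∈ Subgroup.normalizer (Subgroup.zpowers p : Set G))
    {x : G} :
    x ∈ Subgroup.zpowers p ⊔ Subgroup.zpowers u ↔ ∃ i j : ℤ, x = p ^ i * u ^ j := by
  rw [← SetLike.mem_coe, Subgroup.coe_mul_of_right_le_normalizer_left _ _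
    (by rwa [Subgroup.zpowers_le]), Set.mem_mul]
  constructor
  · rintro ⟨_, ⟨i, rfl⟩, _, ⟨j, rfl⟩, rfl⟩
    exact ⟨i, j, rfl⟩
  · rintro ⟨i, j, rfl⟩
    exact ⟨_, ⟨i, rfl⟩, _, ⟨j, rfl⟩, rfl⟩

lemma conj_zpow_mul_zpow {p u t : G} (h : Commute p u) {κ ε δ : ℤ}
    (hp : t * p * t⁻¹ = u ^ ε * p ^ κ) (hu : t * u * t⁻¹ = u ^ δ) (i j : ℤ) :
    t * (p ^ i * u ^ j) * t⁻¹ = p ^ (κ * i) * u ^ (ε * i + δ * j) := by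
  rw [← conj_mul, ← conj_zpow, ← conj_zpow, hp, hu, ((h.symm).zpow_zpow ε κ).mul_zpow, ← zpow_mul,
    ← zpow_mul, ← zpow_mul, zpow_add, ((h.symm).zpow_zpow (ε * i) (κ * i)).eq, mul_assoc]

/-- The square of an element of the coset `⟨p, u⟩ t`. -/
lemma sq_zpow_mul_zpow_mul {p u t : G} (h : Commute p u) {κ ε δ : ℤ}
    (hp : t * p * t⁻¹ = u ^ ε * p ^ κ) (hu : t * u * t⁻¹ = u ^ δ) (i j : ℤ) :
    (p ^ i * u ^ j * t) ^ 2 = p ^ ((1 + κ) * i) * u ^ (ε * i + (1 + δ) * j) * t ^ 2 := by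
  have e : (p ^ i * u ^ j * t) ^ 2 = p ^ i * u ^ j * (t * (p ^ i * u ^ j) * t⁻¹) * t ^ 2 := by
    rw [pow_two, pow_two]; group
  rw [e, conj_zpow_mul_zpow h hp hu, mul_assoc (p ^ i), ← mul_assoc (u ^ j),
    ((h.symm).zpow_zpow j (κ * i)).eq, mul_assoc (p ^ (κ * i)), ← zpow_add, ← mul_assoc (p ^ i),
    ← zpow_add, show i + κ * i = (1 + κ) * i by ring,
    show j + (ε * i + δ * j) = ε * i + (1 + δ) * j by ring]

end Generators

/-! ### Homomorphisms out of presented groups -/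

section Presented

variable {α : Type*} (rels : Set (FreeGroup α))

lemma PresentedGroup.lift_of_eq_one :
    ∀ x ∈ rels, FreeGroup.lift (PresentedGroup.of : α → PresentedGroup rels) x = 1 := by
  intro x hx
  have e : FreeGroup.lift (PresentedGroup.of : α → PresentedGroup rels) =
      PresentedGroup.mk rels := by
    ext a; simp [PresentedGroup.of]
  rw [e]
  exact PresentedGroup.one_of_mem hx

lemma PresentedGroup.exists_hom {rels : Set (FreeGroup α)} {H : Type*} [Group H] (f : α → H)
    (h : ∀ x ∈ rels, FreeGroup.lift f x = 1) :
    ∃ φ : PresentedGroup rels →* H, ∀ a, φ (PresentedGroup.of a) = f a :=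
  ⟨PresentedGroup.toGroup h, fun _ => PresentedGroup.toGroup.of h⟩

lemma PresentedGroup.closure_of_three (rels : Set (FreeGroup (Fin 3))) :
    Subgroup.closure {(PresentedGroup.of 0 : PresentedGroup rels), PresentedGroup.of 1,
      PresentedGroup.of 2} = ⊤ := by
  rw [← PresentedGroup.closure_range_of rels]
  congr 1
  ext x
  simp [Fin.exists_fin_succ, eq_comm]

lemma PresentedGroup.closure_of_four (rels : Set (FreeGroup (Fin 4))) :
    Subgroup.closure {(PresentedGroup.of 0 : PresentedGroup rels), PresentedGroup.of 1,
      PresentedGroup.of 2, PresentedGroup.of 3} = ⊤ := by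
  rw [← PresentedGroup.closure_range_of rels]
  congr 1
  ext x
  simp [Fin.exists_fin_succ, eq_comm]

end Presented

/-! ### Permutations that are affine on the fibres -/

section AffinePerm

variable {R W : Type*} [CommRing R]

/-- The permutation `(x, w) ↦ (αx + c w, f w)`, where `α² = 1`. -/
@[simps]
def affinePerm (α : R) (hα : α * α = 1) (c : W → R) (f : Equiv.Perm W) : Equiv.Perm (R × W) where
  toFun y := (α * y.1 + c y.2, f y.2)
  invFun y := (α * (y.1 - c (f.symm y.2)), f.symm y.2)
  left_inv := by rintro ⟨x, w⟩; simp [← mul_assoc, hα]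
  right_inv := by rintro ⟨x, w⟩; simp [← mul_assoc, hα]

/-- The permutation `(x, w) ↦ (x + c w, w)`. -/
def fibreShift (c : W → R) : Equiv.Perm (R × W) := affinePerm 1 (one_mul 1) c 1

@[simp]
lemma fibreShift_apply (c : W → R) (y : R × W) : fibreShift c y = (y.1 + c y.2, y.2) := by
  simp [fibreShift]

lemma fibreShift_zpow (c : W → R) (n : ℤ) :
    fibreShift c ^ n = fibreShift fun w => n * c w := by
  have hadd : ∀ c d : W → R, fibreShift c * fibreShift d = fibreShift fun w => d w + c w := by
    intro c d
    ext ⟨x, w⟩ <;> simp [add_assoc]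
  have h0 : fibreShift (fun _ : W => (0 : R)) = 1 := by ext ⟨x, w⟩ <;> simp
  have hneg : ∀ c : W → R, (fibreShift c)⁻¹ = fibreShift fun w => - c w := by
    intro c
    rw [inv_eq_iff_mul_eq_one, hadd]
    simp [h0]
  have hnat : ∀ n : ℕ, fibreShift c ^ n = fibreShift fun w => n * c w := by
    intro n
    induction n with
    | zero => simp [h0]
    | succ n ih => rw [pow_succ, ih, hadd]; push_cast; congr 1; funext w; ring
  obtain ⟨n, rfl | rfl⟩ := n.eq_nat_or_neg
  · rw [zpow_natCast, hnat]; simp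
  · rw [zpow_neg, zpow_natCast, hnat, hneg]; simp

lemma fibreShift_pow (c : W → R) (n : ℕ) :
    fibreShift c ^ n = fibreShift fun w => n * c w := by
  have := fibreShift_zpow c n
  rw [zpow_natCast] at this
  simpa using this

lemma fibreShift_inv (c : W → R) : (fibreShift c)⁻¹ = fibreShift fun w => - c w := by
  have := fibreShift_zpow c (-1)
  rw [zpow_neg_one] at this
  simpa using this

lemma Equiv.Perm.pow_four_eq {X : Type*} (f : Equiv.Perm X) : f ^ 4 = f * (f * (f * f)) := by
  rw [pow_succ', pow_three]

end AffinePerm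

/-- The transposition of the two booleans. -/
def boolSwap : Equiv.Perm Bool := ⟨not, not, Bool.not_not, Bool.not_not⟩

@[simp] lemma boolSwap_apply (v : Bool) : boolSwap v = !v := rfl

/-- With m = k + 7 (or k + 6 for N_II) the order of p should be 2^(k+4). Writing b = 2^(k+2), the
central involution acts as translation by 2b. These facts are all that the representations need once
b has been replaced by a letter. -/
lemma ZMod.two_pow_facts (k : ℕ) :
    (4 : ZMod (2 ^ (k + 4))) * 2 ^ (k + 2) = 0 ∧
    (2 : ZMod (2 ^ (k + 4))) ^ (k + 3) = 2 * 2 ^ (k + 2) ∧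
    (2 : ZMod (2 ^ (k + 4))) ^ (k + 2) = 4 * 2 ^ k ∧
    (2 : ZMod (2 ^ (k + 4))) ^ (k + 4) = 0 ∧ (2 : ZMod (2 ^ (k + 4))) * 2 ^ (k + 2) ≠ 0 := by
  have h4 : (2 : ZMod (2 ^ (k + 4))) ^ (k + 4) = 0 := by
    have := ZMod.natCast_self (2 ^ (k + 4))
    exact_mod_cast this
  refine ⟨by rw [← h4]; ring, by ring, by ring, h4, ?_⟩
  have h3 : ((2 ^ (k + 3) : ℕ) : ZMod (2 ^ (k + 4))) ≠ 0 := by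
    rw [Ne, ZMod.natCast_eq_zero_iff, Nat.pow_dvd_pow_iff_le_right (by norm_num)]
    omega
  push_cast at h3
  rwa [show (2 : ZMod (2 ^ (k + 4))) ^ (k + 3) = 2 * 2 ^ (k + 2) by ring] at h3

lemma one_add_two_mul_mul_self {R : Type*} [CommRing R] {b : R} (hb : 4 * b = 0) :
    (1 + 2 * b) * (1 + 2 * b) = 1 := by
  linear_combination (1 + b) * hb

lemma neg_one_add_two_mul_mul_self {R : Type*} [CommRing R] {b : R} (hb : 4 * b = 0) :
    (-1 + 2 * b) * (-1 + 2 * b) = 1 := by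
  linear_combination (-1 + b) * hb

lemma neg_one_mul_neg_one' {R : Type*} [CommRing R] : (-1 : R) * -1 = 1 := by ring

/-- A representation in which the first generator acts by a shift that is `1` on some fibre. -/
lemma pow_ne_one_of_fibreShift {n k : ℕ} {W : Type*} {rels : Set (FreeGroup (Fin (n + 1)))}
    (c : W → ZMod (2 ^ (k + 4))) (f : Fin n → Equiv.Perm (ZMod (2 ^ (k + 4)) × W)) (w : W)
    (hc : c w = 1) (h : ∀ x ∈ rels, FreeGroup.lift (Matrix.vecCons (fibreShift c) f) x = 1) :
    (PresentedGroup.of 0 : PresentedGroup rels) ^ 2 ^ (k + 3) ≠ 1 := by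
  obtain ⟨-, hh, -, -, hne⟩ := ZMod.two_pow_facts k
  obtain ⟨φ, hφ⟩ := PresentedGroup.exists_hom _ h
  intro h
  -- The power of p moves 0 on the fibre over w to 2^(k+3) = 2b, which is not 0.
  have := congrArg (fun g => (φ g (0, w)).1) h
  simp only [map_pow, hφ, Matrix.cons_val_zero, fibreShift_pow, fibreShift_apply, hc, map_one,
    Equiv.Perm.coe_one, id] at this
  push_cast at this
  rw [zero_add, mul_one, hh] at this
  exact hne this

/-! ### The power of `p` of order two is not trivial -/

set_option linter.unusedSimpArgs false

/-- A nontrivial commutator p^(2^(k+3)) of q and r needs two sheets: q translates by 2b on one sheet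
only, and r exchanges the sheets while negating. The same device serves the commutators in the M_III
groups. -/
lemma NII_three_pow_ne_one (k : ℕ) :
    (PresentedGroup.of 0 : NII 3 (k + 6)) ^ 2 ^ (k + 3) ≠ 1 := by
  obtain ⟨hb, hh, -, hM, -⟩ := ZMod.two_pow_facts k
  generalize (2 : ZMod (2 ^ (k + 4))) ^ (k + 2) = b at *
  refine pow_ne_one_of_fibreShift (W := Bool) (fun _ => 1)
    ![fibreShift fun v => cond v (2 * b) 0,
      affinePerm (-1) neg_one_mul_neg_one' 0 boolSwap] true rfl ?_
  simp [tableNII, relNII, div_eq_one, inv_mul_eq_iff_eq_mul, mul_assoc]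
  simp [fibreShift_pow, fibreShift_zpow, fibreShift_inv, Equiv.Perm.pow_four_eq, pow_three,
    pow_two, Equiv.Perm.ext_iff, hM, hh]
  split_ands <;> grind

lemma NII_four_pow_ne_one (k : ℕ) :
    (PresentedGroup.of 0 : NII 4 (k + 6)) ^ 2 ^ (k + 3) ≠ 1 := by
  obtain ⟨hb, hh, -, hM, -⟩ := ZMod.two_pow_facts k
  generalize (2 : ZMod (2 ^ (k + 4))) ^ (k + 2) = b at *
  refine pow_ne_one_of_fibreShift (W := Unit) (fun _ => 1)
    ![affinePerm (1 + 2 * b) (one_add_two_mul_mul_self hb) 0 1,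
      affinePerm (-1 + 2 * b) (neg_one_add_two_mul_mul_self hb) 0 1] () rfl ?_
  simp [tableNII, relNII, div_eq_one, inv_mul_eq_iff_eq_mul, mul_assoc]
  simp [fibreShift_pow, fibreShift_zpow, fibreShift_inv, Equiv.Perm.pow_four_eq, pow_three,
    pow_two, Equiv.Perm.ext_iff, hM, hh]
  split_ands <;> grind

lemma NII_five_pow_ne_one (k : ℕ) :
    (PresentedGroup.of 0 : NII 5 (k + 6)) ^ 2 ^ (k + 3) ≠ 1 := by
  obtain ⟨hb, hh, -, hM, -⟩ := ZMod.two_pow_facts k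
  generalize (2 : ZMod (2 ^ (k + 4))) ^ (k + 2) = b at *
  refine pow_ne_one_of_fibreShift (W := Unit) (fun _ => 1)
    ![1,
      affinePerm (-1) neg_one_mul_neg_one' 0 1] () rfl ?_
  simp [tableNII, relNII, div_eq_one, inv_mul_eq_iff_eq_mul, mul_assoc]
  simp [fibreShift_pow, fibreShift_zpow, fibreShift_inv, Equiv.Perm.pow_four_eq, pow_three,
    pow_two, Equiv.Perm.ext_iff, hM, hh]

lemma MIII_three_pow_ne_one (k : ℕ) :
    (PresentedGroup.of 0 : MIII 3 (k + 7)) ^ 2 ^ (k + 3) ≠ 1 := by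
  obtain ⟨hb, hh, -, hM, -⟩ := ZMod.two_pow_facts k
  generalize (2 : ZMod (2 ^ (k + 4))) ^ (k + 2) = b at *
  refine pow_ne_one_of_fibreShift (W := Bool) (fun _ => 1)
    ![1,
      fibreShift fun v => cond v (2 * b) 0,
      affinePerm (-1) neg_one_mul_neg_one' 0 boolSwap] true rfl ?_
  simp [tableMIII, relMIII, div_eq_one, inv_mul_eq_iff_eq_mul, mul_assoc]
  simp [fibreShift_pow, fibreShift_zpow, fibreShift_inv, Equiv.Perm.pow_four_eq, pow_three,
    pow_two, Equiv.Perm.ext_iff, hM, hh]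
  split_ands <;> grind

lemma MIII_four_pow_ne_one (k : ℕ) :
    (PresentedGroup.of 0 : MIII 4 (k + 7)) ^ 2 ^ (k + 3) ≠ 1 := by
  obtain ⟨hb, hh, -, hM, -⟩ := ZMod.two_pow_facts k
  generalize (2 : ZMod (2 ^ (k + 4))) ^ (k + 2) = b at *
  refine pow_ne_one_of_fibreShift (W := Unit) (fun _ => 1)
    ![1,
      affinePerm (1 + 2 * b) (one_add_two_mul_mul_self hb) 0 1,
      affinePerm (-1 + 2 * b) (neg_one_add_two_mul_mul_self hb) 0 1] () rfl ?_
  simp [tableMIII, relMIII, div_eq_one, inv_mul_eq_iff_eq_mul, mul_assoc]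
  simp [fibreShift_pow, fibreShift_zpow, fibreShift_inv, Equiv.Perm.pow_four_eq, pow_three,
    pow_two, Equiv.Perm.ext_iff, hM, hh]
  split_ands <;> grind

lemma MIII_five_pow_ne_one (k : ℕ) :
    (PresentedGroup.of 0 : MIII 5 (k + 7)) ^ 2 ^ (k + 3) ≠ 1 := by
  obtain ⟨hb, hh, -, hM, -⟩ := ZMod.two_pow_facts k
  generalize (2 : ZMod (2 ^ (k + 4))) ^ (k + 2) = b at *
  refine pow_ne_one_of_fibreShift (W := Unit) (fun _ => 1)
    ![1,
      1,
      affinePerm (-1) neg_one_mul_neg_one' 0 1] () rfl ?_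
  simp [tableMIII, relMIII, div_eq_one, inv_mul_eq_iff_eq_mul, mul_assoc]
  simp [fibreShift_pow, fibreShift_zpow, fibreShift_inv, Equiv.Perm.pow_four_eq, pow_three,
    pow_two, Equiv.Perm.ext_iff, hM, hh]

/-- Exchanging the sheets with a translation by 2b in one direction only has square the translation
by 2b on both; this gives s² = p^(2^(k+3)). -/
lemma MIII_ten_pow_ne_one (k : ℕ) :
    (PresentedGroup.of 0 : MIII 10 (k + 7)) ^ 2 ^ (k + 3) ≠ 1 := by
  obtain ⟨hb, hh, -, hM, -⟩ := ZMod.two_pow_facts k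
  generalize (2 : ZMod (2 ^ (k + 4))) ^ (k + 2) = b at *
  refine pow_ne_one_of_fibreShift (W := Bool) (fun _ => 1)
    ![fibreShift fun v => cond v (2 * b) 0,
      affinePerm (-1) neg_one_mul_neg_one' 0 1,
      affinePerm 1 (one_mul 1) (fun v => cond v (2 * b) 0) boolSwap] true rfl ?_
  simp [tableMIII, relMIII, div_eq_one, inv_mul_eq_iff_eq_mul, mul_assoc]
  simp [fibreShift_pow, fibreShift_zpow, fibreShift_inv, Equiv.Perm.pow_four_eq, pow_three,
    pow_two, Equiv.Perm.ext_iff, hM, hh]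
  split_ands <;> grind

lemma MIII_eleven_pow_ne_one (k : ℕ) :
    (PresentedGroup.of 0 : MIII 11 (k + 7)) ^ 2 ^ (k + 3) ≠ 1 := by
  obtain ⟨hb, hh, -, hM, -⟩ := ZMod.two_pow_facts k
  generalize (2 : ZMod (2 ^ (k + 4))) ^ (k + 2) = b at *
  refine pow_ne_one_of_fibreShift (W := Bool) (fun _ => 1)
    ![fibreShift fun v => cond v (2 * b) 0,
      affinePerm (-1 + 2 * b) (neg_one_add_two_mul_mul_self hb) 0 1,
      affinePerm 1 (one_mul 1) (fun v => cond v (2 * b) 0) boolSwap] true rfl ?_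
  simp [tableMIII, relMIII, div_eq_one, inv_mul_eq_iff_eq_mul, mul_assoc]
  simp [fibreShift_pow, fibreShift_zpow, fibreShift_inv, Equiv.Perm.pow_four_eq, pow_three,
    pow_two, Equiv.Perm.ext_iff, hM, hh]
  split_ands <;> grind

lemma MIII_thirteen_pow_ne_one (k : ℕ) :
    (PresentedGroup.of 0 : MIII 13 (k + 7)) ^ 2 ^ (k + 3) ≠ 1 := by
  obtain ⟨hb, hh, -, hM, -⟩ := ZMod.two_pow_facts k
  generalize (2 : ZMod (2 ^ (k + 4))) ^ (k + 2) = b at *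
  refine pow_ne_one_of_fibreShift (W := Bool) (fun _ => 1)
    ![fibreShift fun v => cond v (2 * b) 0,
      affinePerm (1 + 2 * b) (one_add_two_mul_mul_self hb) 0 1,
      affinePerm (-1) neg_one_mul_neg_one' 0 boolSwap] true rfl ?_
  simp [tableMIII, relMIII, div_eq_one, inv_mul_eq_iff_eq_mul, mul_assoc]
  simp [fibreShift_pow, fibreShift_zpow, fibreShift_inv, Equiv.Perm.pow_four_eq, pow_three,
    pow_two, Equiv.Perm.ext_iff, hM, hh]
  split_ands <;> grind

/-- Here q negates, exchanges sheets and adds b in one direction, so q² translates by -b and b on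
the two sheets. Hence q⁴ translates both by 2b, because 4b = 0. -/
lemma MIIC_five_pow_ne_one (k : ℕ) :
    (PresentedGroup.of 0 : MIIC 5 (k + 7)) ^ 2 ^ (k + 3) ≠ 1 := by
  obtain ⟨hb, hh, -, hM, -⟩ := ZMod.two_pow_facts k
  generalize (2 : ZMod (2 ^ (k + 4))) ^ (k + 2) = b at *
  refine pow_ne_one_of_fibreShift (W := Bool) (fun _ => 1)
    ![affinePerm (-1) neg_one_mul_neg_one' (fun v => cond v b 0) boolSwap,
      affinePerm 1 (one_mul 1) 0 boolSwap] true rfl ?_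
  simp [tableMIIC, relMIIC, div_eq_one, inv_mul_eq_iff_eq_mul, mul_assoc]
  simp [fibreShift_pow, fibreShift_zpow, fibreShift_inv, Equiv.Perm.pow_four_eq, pow_three,
    pow_two, Equiv.Perm.ext_iff, hM, hh]
  split_ands <;> grind

/-- The translation lengths of p on the two sheets differ by b, so that conjugation by q turns p
into p⁻¹ corrected by q². The term 2b² that arises vanishes because b = 4 · 2ᵏ, which is why the
power 2ᵏ is kept. -/
lemma MIIF_eight_pow_ne_one (k : ℕ) :
    (PresentedGroup.of 0 : MIIF 8 (k + 7)) ^ 2 ^ (k + 3) ≠ 1 := by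
  obtain ⟨hb, hh, hd, hM, -⟩ := ZMod.two_pow_facts k
  generalize (2 : ZMod (2 ^ (k + 4))) ^ (k + 2) = b at *
  generalize (2 : ZMod (2 ^ (k + 4))) ^ k = d at *
  refine pow_ne_one_of_fibreShift (W := Bool) (fun v => cond v 1 (1 + b))
    ![affinePerm (-1) neg_one_mul_neg_one' (fun v => cond v b 0) boolSwap,
      affinePerm (1 + 2 * b) (one_add_two_mul_mul_self hb) 0 boolSwap] true rfl ?_
  simp [tableMIIF, relMIIF, div_eq_one, inv_mul_eq_iff_eq_mul, mul_assoc]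
  simp [fibreShift_pow, fibreShift_zpow, fibreShift_inv, Equiv.Perm.pow_four_eq, pow_three,
    pow_two, Equiv.Perm.ext_iff, hM, hh]
  split_ands <;> grind

lemma MIIF_nine_pow_ne_one (k : ℕ) :
    (PresentedGroup.of 0 : MIIF 9 (k + 7)) ^ 2 ^ (k + 3) ≠ 1 := by
  obtain ⟨hb, hh, hd, hM, -⟩ := ZMod.two_pow_facts k
  generalize (2 : ZMod (2 ^ (k + 4))) ^ (k + 2) = b at *
  generalize (2 : ZMod (2 ^ (k + 4))) ^ k = d at *
  refine pow_ne_one_of_fibreShift (W := Bool) (fun v => cond v 1 (1 + b))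
    ![affinePerm (-1) neg_one_mul_neg_one' (fun v => cond v b 0) boolSwap,
      affinePerm 1 (one_mul 1) 0 boolSwap] true rfl ?_
  simp [tableMIIF, relMIIF, div_eq_one, inv_mul_eq_iff_eq_mul, mul_assoc]
  simp [fibreShift_pow, fibreShift_zpow, fibreShift_inv, Equiv.Perm.pow_four_eq, pow_three,
    pow_two, Equiv.Perm.ext_iff, hM, hh]
  split_ands <;> grind

/-- Four sheets: one boolean carries the commutator of q and s. The other lets r invert p and still
satisfy r² = p^(2^(k+3)), which is impossible on one copy, where every map x ↦ c - x is an
involution. -/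
lemma MIII_fourteen_pow_ne_one (k : ℕ) :
    (PresentedGroup.of 0 : MIII 14 (k + 7)) ^ 2 ^ (k + 3) ≠ 1 := by
  obtain ⟨hb, hh, -, hM, -⟩ := ZMod.two_pow_facts k
  generalize (2 : ZMod (2 ^ (k + 4))) ^ (k + 2) = b at *
  refine pow_ne_one_of_fibreShift (W := Bool × Bool) (fun _ => 1)
    ![fibreShift fun v : Bool × Bool => cond v.1 (2 * b) 0,
      affinePerm (-1) neg_one_mul_neg_one' (fun v => cond v.2 (2 * b) 0) (.prodCongr 1 boolSwap),
      affinePerm (-1) neg_one_mul_neg_one' 0 (.prodCongr boolSwap 1)] (true, true) rfl ?_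
  simp [tableMIII, relMIII, div_eq_one, inv_mul_eq_iff_eq_mul, mul_assoc]
  simp [fibreShift_pow, fibreShift_zpow, fibreShift_inv, Equiv.Perm.pow_four_eq, pow_three,
    pow_two, Equiv.Perm.ext_iff, hM, hh]
  split_ands <;> grind

/-- Only p is tested, so q² may act trivially and a single sheet is enough. -/
lemma MIID_seventeen_pow_ne_one (k : ℕ) :
    (PresentedGroup.of 0 : MIID 17 (k + 7)) ^ 2 ^ (k + 3) ≠ 1 := by
  obtain ⟨hb, hh, -, hM, -⟩ := ZMod.two_pow_facts k
  generalize (2 : ZMod (2 ^ (k + 4))) ^ (k + 2) = b at *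
  refine pow_ne_one_of_fibreShift (W := Unit) (fun _ => 1)
    ![affinePerm (-1) neg_one_mul_neg_one' 0 1,
      affinePerm (1 + 2 * b) (one_add_two_mul_mul_self hb) 0 1] () rfl ?_
  simp [tableMIID, relMIID, div_eq_one, inv_mul_eq_iff_eq_mul, mul_assoc]
  simp [fibreShift_pow, fibreShift_zpow, fibreShift_inv, Equiv.Perm.pow_four_eq, pow_three,
    pow_two, Equiv.Perm.ext_iff, hM, hh]
  split_ands <;> grind

/-- Since q² does not commute with p, here p itself exchanges the sheets while adding 1. Only its
even powers are translations, and these contain the power in question. -/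
lemma MIIE_one_pow_ne_one (k : ℕ) :
    (PresentedGroup.of 0 : MIIE 1 (k + 7)) ^ 2 ^ (k + 3) ≠ 1 := by
  obtain ⟨hb, hh, hd, hM, hne⟩ := ZMod.two_pow_facts k
  let P : Equiv.Perm (ZMod (2 ^ (k + 4)) × Bool) := affinePerm 1 (one_mul 1) 1 boolSwap
  have hP : ∀ n : ℤ, P ^ (2 * n) = fibreShift fun _ => 2 * (n : ZMod (2 ^ (k + 4))) := by
    have h2 : P ^ (2 : ℤ) = fibreShift fun _ => 2 := by
      rw [show (2 : ℤ) = (2 : ℕ) from rfl, zpow_natCast, pow_two]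
      simp [P, Equiv.Perm.ext_iff]
      grind
    intro n
    rw [zpow_mul, h2, fibreShift_zpow]
    simp [mul_comm]
  have e (j : ℕ) : P ^ (2 ^ (j + 1) : ℤ) = fibreShift fun _ => 2 ^ (j + 1) := by
    rw [pow_succ' (2 : ℤ) j, hP]; simp [pow_succ' _ j]
  have e' (j : ℕ) : P ^ 2 ^ (j + 1) = fibreShift fun _ => 2 ^ (j + 1) := by
    rw [← zpow_natCast P]; push_cast; exact e j
  obtain ⟨φ, hφ⟩ := PresentedGroup.exists_hom (rels := tableMIIE (k + 7) 1)
    ![P, affinePerm 1 (one_mul 1) (fun v => cond v (-2 ^ (k + 2)) 0) 1,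
      affinePerm (-1) neg_one_mul_neg_one' 0 boolSwap] (by
      simp [tableMIIE, relMIIE, div_eq_one, inv_mul_eq_iff_eq_mul, mul_assoc]
      simp only [zpow_sub, zpow_add, zpow_one, e, e', hM, hh]
      generalize (2 : ZMod (2 ^ (k + 4))) ^ (k + 2) = b at *
      simp [P, fibreShift_inv, Equiv.Perm.pow_four_eq, pow_two, Equiv.Perm.ext_iff]
      split_ands <;> grind)
  intro h
  have := congrArg (fun g => (φ g (0, true)).1) h
  simp [hφ, e', hh] at this
  exact hne this

/-! ### Rank three quotients -/

section RankThree

lemma PresentedGroup.exists_surjective_of_lift {n : ℕ} {rels : Set (FreeGroup (Fin (n + 3)))}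
    (f : Fin n → ElementaryAbelianEight)
    (h : ∀ x ∈ rels, FreeGroup.lift
      (Matrix.vecCons (-1, 1, 1) (Matrix.vecCons (1, -1, 1) (Matrix.vecCons (1, 1, -1) f))) x = 1) :
    ∃ φ : PresentedGroup rels →* ElementaryAbelianEight, Function.Surjective φ ∧
      φ (.of 0) = (-1, 1, 1) ∧ φ (.of 1) = (1, -1, 1) ∧ φ (.of 2) = (1, 1, -1) := by
  obtain ⟨φ, hφ⟩ := PresentedGroup.exists_hom _ h
  refine ⟨φ, fun v => ?_, hφ 0, hφ 1, hφ 2⟩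
  have hv : ∀ v : ElementaryAbelianEight, ∃ i j k : Fin 2, v =
      (-1, 1, 1) ^ (i : ℕ) * (1, -1, 1) ^ (j : ℕ) * (1, 1, -1) ^ (k : ℕ) := by decide
  obtain ⟨i, j, k, rfl⟩ := hv v
  refine ⟨PresentedGroup.of 0 ^ (i : ℕ) * PresentedGroup.of 1 ^ (j : ℕ) *
    PresentedGroup.of 2 ^ (k : ℕ), ?_⟩
  rw [map_mul, map_mul, map_pow, map_pow, map_pow, hφ, hφ, hφ]
  rfl

/-- Signs make every relator exponent divisible by two disappear, which is how the relations are
checked for all k at once. -/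
lemma Int.units_pow_two_pow (x : ℤˣ) (k : ℕ) : x ^ 2 ^ (k + 1) = 1 := by
  rw [pow_succ', pow_mul, Int.units_sq, one_pow]

lemma Int.units_zpow_two_pow (x : ℤˣ) (k : ℕ) : x ^ (2 ^ (k + 1) : ℤ) = 1 := by
  have := Int.units_pow_two_pow x k
  exact_mod_cast this

lemma NII_exists_surjective (k : ℕ) : ∀ n ∈ ({3, 4, 5} : Set ℕ),
    ∃ φ : NII n (k + 6) →* ElementaryAbelianEight, Function.Surjective φ ∧
      φ (.of 0) = (-1, 1, 1) ∧ φ (.of 1) = (1, -1, 1) ∧ φ (.of 2) = (1, 1, -1) := by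
  rintro n (rfl | rfl | rfl) <;> refine PresentedGroup.exists_surjective_of_lift ![] ?_ <;>
    simp only [tableNII, relNII] <;>
    simp [div_eq_one, inv_mul_eq_iff_eq_mul, mul_assoc, zpow_add,
      Int.units_pow_two_pow, Int.units_zpow_two_pow]

lemma MIIA_exists_surjective (k : ℕ) : ∀ n ∈ ({39, 40} : Set ℕ),
    ∃ φ : MIIA n (k + 7) →* ElementaryAbelianEight, Function.Surjective φ ∧
      φ (.of 0) = (-1, 1, 1) ∧ φ (.of 1) = (1, -1, 1) ∧ φ (.of 2) = (1, 1, -1) := by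
  rintro n (rfl | rfl) <;> refine PresentedGroup.exists_surjective_of_lift ![] ?_ <;>
    simp only [tableMIIA, relMIIA] <;>
    simp [div_eq_one, inv_mul_eq_iff_eq_mul, mul_assoc, zpow_add, zpow_mul,
      Int.units_pow_two_pow, Int.units_zpow_two_pow] <;>
    decide

lemma MIIB_exists_surjective (k : ℕ) : ∀ n ∈ ({19, 20} : Set ℕ),
    ∃ φ : MIIB n (k + 7) →* ElementaryAbelianEight, Function.Surjective φ ∧
      φ (.of 0) = (-1, 1, 1) ∧ φ (.of 1) = (1, -1, 1) ∧ φ (.of 2) = (1, 1, -1) := by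
  rintro n (rfl | rfl) <;> refine PresentedGroup.exists_surjective_of_lift ![] ?_ <;>
    simp only [tableMIIB, relMIIB] <;>
    simp [div_eq_one, inv_mul_eq_iff_eq_mul, mul_assoc, zpow_add, zpow_mul,
      Int.units_pow_two_pow, Int.units_zpow_two_pow] <;>
    decide

lemma MIIC_exists_surjective (k : ℕ) : ∀ n ∈ ({5} : Set ℕ),
    ∃ φ : MIIC n (k + 7) →* ElementaryAbelianEight, Function.Surjective φ ∧
      φ (.of 0) = (-1, 1, 1) ∧ φ (.of 1) = (1, -1, 1) ∧ φ (.of 2) = (1, 1, -1) := by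
  rintro n rfl; refine PresentedGroup.exists_surjective_of_lift ![] ?_
  simp only [tableMIIC, relMIIC]
  simp [div_eq_one, inv_mul_eq_iff_eq_mul, mul_assoc, zpow_add, zpow_mul,
      Int.units_pow_two_pow, Int.units_zpow_two_pow]
  decide

lemma MIID_exists_surjective (k : ℕ) : ∀ n ∈ ({3, 17, 18, 19} : Set ℕ),
    ∃ φ : MIID n (k + 7) →* ElementaryAbelianEight, Function.Surjective φ ∧
      φ (.of 0) = (-1, 1, 1) ∧ φ (.of 1) = (1, -1, 1) ∧ φ (.of 2) = (1, 1, -1) := by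
  rintro n (rfl | rfl | rfl | rfl) <;> refine PresentedGroup.exists_surjective_of_lift ![] ?_ <;>
    simp only [tableMIID, relMIID] <;>
    simp [div_eq_one, inv_mul_eq_iff_eq_mul, mul_assoc, zpow_add, zpow_mul,
      Int.units_pow_two_pow, Int.units_zpow_two_pow] <;>
    decide

lemma MIIE_exists_surjective (k : ℕ) : ∀ n ∈ ({1} : Set ℕ),
    ∃ φ : MIIE n (k + 7) →* ElementaryAbelianEight, Function.Surjective φ ∧
      φ (.of 0) = (-1, 1, 1) ∧ φ (.of 1) = (1, -1, 1) ∧ φ (.of 2) = (1, 1, -1) := by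
  rintro n rfl; refine PresentedGroup.exists_surjective_of_lift ![] ?_
  simp only [tableMIIE, relMIIE]
  simp [div_eq_one, inv_mul_eq_iff_eq_mul, mul_assoc, zpow_add, zpow_sub, zpow_mul,
      Int.units_pow_two_pow, Int.units_zpow_two_pow]
  decide

lemma MIIF_exists_surjective (k : ℕ) : ∀ n ∈ ({8, 9} : Set ℕ),
    ∃ φ : MIIF n (k + 7) →* ElementaryAbelianEight, Function.Surjective φ ∧
      φ (.of 0) = (-1, 1, 1) ∧ φ (.of 1) = (1, -1, 1) ∧ φ (.of 2) = (1, 1, -1) := by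
  rintro n (rfl | rfl) <;> refine PresentedGroup.exists_surjective_of_lift ![] ?_ <;>
    simp only [tableMIIF, relMIIF] <;>
    simp [div_eq_one, inv_mul_eq_iff_eq_mul, mul_assoc, zpow_add, zpow_mul,
      Int.units_pow_two_pow, Int.units_zpow_two_pow] <;>
    decide

lemma MIII_exists_surjective (k : ℕ) : ∀ n ∈ ({3, 4, 5, 10, 11, 13, 14} : Set ℕ),
    ∃ φ : MIII n (k + 7) →* ElementaryAbelianEight, Function.Surjective φ ∧
      φ (.of 0) = (-1, 1, 1) ∧ φ (.of 1) = (1, -1, 1) ∧ φ (.of 2) = (1, 1, -1) := by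
  rintro n (rfl | rfl | rfl | rfl | rfl | rfl | rfl) <;>
    refine PresentedGroup.exists_surjective_of_lift ![1] ?_ <;>
    simp only [tableMIII, relMIII] <;>
    simp [div_eq_one, inv_mul_eq_iff_eq_mul, mul_assoc, zpow_add, zpow_mul,
      Int.units_pow_two_pow, Int.units_zpow_two_pow]

end RankThree

/-! ### Dihedral quotients -/

section DihedralQuotients

variable {H : Type*} [Group H]

lemma pow_two_pow_of_pow_four {P : H} (h : P ^ 4 = 1) (k : ℕ) :
    P ^ 2 ^ (k + 2) = 1 ∧ P ^ (2 ^ (k + 2) : ℤ) = 1 := by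
  have : P ^ 2 ^ (k + 2) = 1 := by
    rw [show 2 ^ (k + 2) = 4 * 2 ^ k by ring, pow_mul, h, one_pow]
  exact ⟨this, by exact_mod_cast this⟩

open DihedralGroup

/-- This quotient keeps q of order 4, and so shows that no element of the coset ⟨p, q²⟩q is an
involution. -/
lemma MIIA_exists_dihedral (k : ℕ) : ∀ n ∈ ({39, 40} : Set ℕ),
    ∃ φ : MIIA n (k + 7) →* DihedralGroup 4, φ (.of 0) = 1 ∧ φ (.of 1) = r 1 ∧ φ (.of 2) = sr 0 := by
  intro n hn
  obtain ⟨φ, hφ⟩ := PresentedGroup.exists_hom (rels := tableMIIA (k + 7) n)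
    ![1, (r 1 : DihedralGroup 4), sr 0] (by
      rcases hn with rfl | rfl <;> simp only [tableMIIA, relMIIA] <;> simp <;> decide)
  exact ⟨φ, hφ 0, hφ 1, hφ 2⟩

lemma MIIB_exists_dihedral (k : ℕ) : ∀ n ∈ ({19, 20} : Set ℕ),
    ∃ φ : MIIB n (k + 7) →* DihedralGroup 4, φ (.of 0) = 1 ∧ φ (.of 1) = r 1 ∧ φ (.of 2) = sr 0 := by
  intro n hn
  obtain ⟨φ, hφ⟩ := PresentedGroup.exists_hom (rels := tableMIIB (k + 7) n)
    ![1, (r 1 : DihedralGroup 4), sr 0] (by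
      rcases hn with rfl | rfl <;> simp only [tableMIIB, relMIIB] <;> simp <;> decide)
  exact ⟨φ, hφ 0, hφ 1, hφ 2⟩

/-- Only relations modulo p⁴ matter. All terms p^(2^(k+3)) then vanish, and the three presentations
impose the same conditions. -/
lemma MIID_exists_dihedral (k : ℕ) : ∀ n ∈ ({3, 17, 19} : Set ℕ),
    ∃ φ : MIID n (k + 7) →* DihedralGroup 4 × DihedralGroup 4, φ (.of 0) = (r 1, sr 0) ∧
      φ (.of 1) = (sr 0, r 1) ∧ φ (.of 2) = (1, sr 1) := by
  have key : ∀ n ∈ ({3, 17, 19} : Set ℕ), ∀ P Q R : DihedralGroup 4 × DihedralGroup 4,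
      P ^ 4 = 1 → Q ^ 4 = 1 → R ^ 2 = 1 → Q⁻¹ * P * Q = Q ^ 2 * P⁻¹ →
      (Q ^ 2)⁻¹ * P * Q ^ 2 = P → R⁻¹ * P * R = Q ^ 2 * P → R⁻¹ * Q * R = Q ^ 3 →
      ∀ x ∈ tableMIID (k + 7) n, FreeGroup.lift ![P, Q, R] x = 1 := by
    intro n hn P Q R h1 h2 h3 h4 h5 h6 h7
    rcases hn with rfl | rfl | rfl <;>
      simp [tableMIID, relMIID, zpow_add, pow_two_pow_of_pow_four h1,
        h2, h3, h4, h5, h6, h7]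
  intro n hn
  obtain ⟨φ, hφ⟩ := PresentedGroup.exists_hom _ (key n hn (r 1, sr 0) (sr 0, r 1) (1, sr 1)
    (by decide) (by decide) (by decide) (by decide) (by decide) (by decide) (by decide))
  exact ⟨φ, hφ 0, hφ 1, hφ 2⟩

lemma MIID_eighteen_exists_dihedral (k : ℕ) :
    ∃ φ : MIID 18 (k + 7) →* DihedralGroup 4 × DihedralGroup 4, φ (.of 0) = (r 1, sr 0) ∧
      φ (.of 1) = (sr 0, r 1) ∧ φ (.of 2) = (sr 0, 1) := by
  have key : ∀ P Q R : DihedralGroup 4 × DihedralGroup 4,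
      P ^ 4 = 1 → Q ^ 4 = 1 → R ^ 2 = 1 → Q⁻¹ * P * Q = Q ^ 2 * P⁻¹ →
      (Q ^ 2)⁻¹ * P * Q ^ 2 = P → R⁻¹ * P * R * P = 1 → R⁻¹ * Q * R = Q →
      ∀ x ∈ tableMIID (k + 7) 18, FreeGroup.lift ![P, Q, R] x = 1 := by
    intro P Q R h1 h2 h3 h4 h5 h6 h7
    simp [tableMIID, relMIID, pow_two_pow_of_pow_four h1,
        h2, h3, h4, h5, h6, h7]
  obtain ⟨φ, hφ⟩ := PresentedGroup.exists_hom _ (key (r 1, sr 0) (sr 0, r 1) (sr 0, 1)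
    (by decide) (by decide) (by decide) (by decide) (by decide) (by decide) (by decide))
  exact ⟨φ, hφ 0, hφ 1, hφ 2⟩

lemma MIIE_exists_dihedral (k : ℕ) :
    ∃ φ : MIIE 1 (k + 7) →* DihedralGroup 4 × DihedralGroup 4, φ (.of 0) = (r 1, sr 0) ∧
      φ (.of 1) = (1, r 1) ∧ φ (.of 2) = (sr 0, 1) := by
  have key : ∀ P Q R : DihedralGroup 4 × DihedralGroup 4,
      P ^ 4 = 1 → Q ^ 4 = 1 → R ^ 2 = 1 → Q⁻¹ * P * Q = Q ^ 2 * P →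
      (Q ^ 2)⁻¹ * P * Q ^ 2 = P → R⁻¹ * P * R * P = 1 → R⁻¹ * Q * R = Q →
      ∀ x ∈ tableMIIE (k + 7) 1, FreeGroup.lift ![P, Q, R] x = 1 := by
    intro P Q R h1 h2 h3 h4 h5 h6 h7
    simp [tableMIIE, relMIIE, zpow_add, zpow_sub, pow_two_pow_of_pow_four h1,
        h2, h3, h4, h5, h6, h7]
  obtain ⟨φ, hφ⟩ := PresentedGroup.exists_hom _ (key (r 1, sr 0) (1, r 1) (sr 0, 1)
    (by decide) (by decide) (by decide) (by decide) (by decide) (by decide) (by decide))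
  exact ⟨φ, hφ 0, hφ 1, hφ 2⟩

end DihedralQuotients

/-! ### Groups with a cyclic normal subgroup and elementary abelian quotient -/

section CyclicNormal

variable {G : Type*} [Group G]

lemma zpow_odd_mul_two_pow {p : G} {k : ℕ} (hp : p ^ 2 ^ (k + 1) = 1) {c : ℤ} (hc : Odd c) :
    (p ^ c) ^ 2 ^ k = p ^ 2 ^ k := by
  obtain ⟨d, rfl⟩ := hc
  have hp' : p ^ (2 ^ (k + 1) : ℤ) = 1 := by exact_mod_cast hp
  have : (p ^ (2 * d + 1)) ^ (2 ^ k : ℤ) = p ^ (2 ^ k : ℤ) := by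
    rw [← zpow_mul, show (2 * d + 1) * 2 ^ k = 2 ^ (k + 1) * d + 2 ^ k by ring, zpow_add, zpow_mul,
      hp', one_zpow, one_mul]
  exact_mod_cast this

lemma commute_of_inv_mul_mul_eq {x y : G} (h : x⁻¹ * y * x = y) : Commute x y := by
  rw [mul_assoc, inv_mul_eq_iff_eq_mul] at h
  exact h.symm

/-- The quotient by ⟨p⟩ is elementary abelian, so each square is a power of p, and a nontrivial one
reaches the involution. That involution is central because raising to an odd power fixes it. -/
lemma reach_of_cyclic_normal {p q r s : G} {k : ℕ} (hgen : Subgroup.closure {p, q, r, s} = ⊤)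
    (hp : p ^ 2 ^ (k + 1) = 1) (hz : p ^ 2 ^ k ≠ 1)
    (hpq : ∃ c : ℤ, Odd c ∧ q⁻¹ * p * q = p ^ c) (hpr : ∃ c : ℤ, Odd c ∧ r⁻¹ * p * r = p ^ c)
    (hps : ∃ c : ℤ, Odd c ∧ s⁻¹ * p * s = p ^ c)
    (hq : q ^ 2 ∈ Subgroup.zpowers p) (hr : r ^ 2 ∈ Subgroup.zpowers p)
    (hs : s ^ 2 ∈ Subgroup.zpowers p) (hqr : q⁻¹ * (r⁻¹ * q * r) ∈ Subgroup.zpowers p)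
    (hqs : q⁻¹ * (s⁻¹ * q * s) ∈ Subgroup.zpowers p) (hrs : r⁻¹ * (s⁻¹ * r * s) ∈ Subgroup.zpowers p) :
    IsCentralInvolution (p ^ 2 ^ k) ∧ NonCommutingProductsReach (p ^ 2 ^ k) := by
  have hconj : ∀ x ∈ ({p, q, r, s} : Set G), ∃ c : ℤ, Odd c ∧ x⁻¹ * p * x = p ^ c := by
    rintro x (rfl | rfl | rfl | rfl)
    exacts [⟨1, odd_one, by simp⟩, hpq, hpr, hps]
  have hsq : ∀ x ∈ ({p, q, r, s} : Set G), x ^ 2 ∈ Subgroup.zpowers p := by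
    rintro x (rfl | rfl | rfl | rfl)
    exacts [Subgroup.npow_mem_zpowers _ _, hq, hr, hs]
  have hN : (Subgroup.zpowers p).Normal := by
    refine normal_of_generators hgen ?_ fun x hx => ⟨1, hsq x hx⟩
    rintro x hx _ ⟨i, rfl⟩
    obtain ⟨c, -, hc⟩ := hconj x hx
    refine ⟨c * i, ?_⟩
    dsimp only
    rw [zpow_mul, ← hc]
    simpa using (conj_zpow (i := i) (a := x⁻¹) (b := p))
  refine ⟨⟨orderOf_eq_two_iff'.2 ⟨?_, hz⟩, ?_⟩, nonCommutingProductsReach_of_sq ?_⟩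
  · rw [← pow_add, ← two_mul, ← pow_succ', hp]
  · refine commute_of_generators hgen fun x hx => commute_of_inv_mul_mul_eq ?_
    obtain ⟨c, hc, h⟩ := hconj x hx
    have := conj_pow (i := 2 ^ k) (a := x⁻¹) (b := p)
    rw [inv_inv, h, zpow_odd_mul_two_pow hp hc] at this
    exact this.symm
  · intro g hg
    have hp1 : ((p : G) : G ⧸ Subgroup.zpowers p) = 1 :=
      (QuotientGroup.eq_one_iff _).2 (Subgroup.mem_zpowers p)
    have c1 := commute_of_commutator_mem hqr
    have c2 := commute_of_commutator_mem hqs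
    have c3 := commute_of_commutator_mem hrs
    obtain ⟨i, hi⟩ := sq_mem_of_generators hN hgen hsq (by
      rintro x (rfl | rfl | rfl | rfl) y (rfl | rfl | rfl | rfl) <;>
        simp only [hp1, Commute.one_left, Commute.one_right, Commute.refl, c1, c2, c3, c1.symm,
          c2.symm, c3.symm]) g
    dsimp only at hi
    rw [← hi] at hg ⊢
    exact exists_zpow_eq_involution hp hg

end CyclicNormal

/-! ### Application to N_II and M_III. -/

lemma odd_add_two_pow_mul {e : ℤ} (he : Odd e) (k : ℕ) (e' : ℤ) :
    Odd (e + 2 ^ (k + 1) * e') :=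
  he.add_even ⟨2 ^ k * e', by ring⟩

section Relations

variable {H : Type*} [Group H] {k : ℕ}

lemma relNII_relations {e₁ e₂ e₃ e₄ e₅ : ℤ} {f : Fin 3 → H}
    (h : ∀ x ∈ relNII (k + 6) e₁ e₂ e₃ e₄ e₅, FreeGroup.lift f x = 1) :
    f 0 ^ 2 ^ (k + 4) = 1 ∧ f 1 ^ 2 = 1 ∧ f 2 ^ 2 = f 0 ^ (2 ^ (k + 3) * e₅) ∧
    (f 1)⁻¹ * f 0 * f 1 = f 0 ^ (1 + 2 ^ (k + 3) * e₂) ∧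
    (f 2)⁻¹ * f 0 * f 2 = f 0 ^ (e₁ + 2 ^ (k + 3) * e₃) ∧
    (f 2)⁻¹ * f 1 * f 2 = f 1 * f 0 ^ (2 ^ (k + 3) * e₄) := by
  simpa [relNII, div_eq_one] using h

lemma relMIII_relations {e₁ e₂ e₃ e₄ e₅ e₆ e₇ e₈ : ℤ} {f : Fin 4 → H}
    (h : ∀ x ∈ relMIII (k + 7) e₁ e₂ e₃ e₄ e₅ e₆ e₇ e₈, FreeGroup.lift f x = 1) :
    f 0 ^ 2 ^ (k + 4) = 1 ∧ f 1 ^ 2 = 1 ∧ f 2 ^ 2 = f 0 ^ (2 ^ (k + 3) * e₈) ∧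
    f 3 ^ 2 = f 0 ^ (2 ^ (k + 3) * e₅) ∧ (f 1)⁻¹ * f 0 * f 1 = f 0 ∧
    (f 2)⁻¹ * f 0 * f 2 = f 0 ^ (e₂ + 2 ^ (k + 3) * e₃) ∧
    (f 3)⁻¹ * f 0 * f 3 = f 0 ^ (e₁ + 2 ^ (k + 3) * e₆) ∧
    (f 2)⁻¹ * f 1 * f 2 = f 1 ∧
    (f 3)⁻¹ * f 1 * f 3 = f 1 * f 0 ^ (2 ^ (k + 3) * e₄) ∧
    (f 3)⁻¹ * f 2 * f 3 = f 2 * f 0 ^ (2 ^ (k + 3) * e₇) := by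
  simpa [relMIII, div_eq_one] using h

end Relations

lemma relNII_reach (k : ℕ) {e₁ e₂ e₃ e₄ e₅ : ℤ} (h₁ : Odd e₁)
    (hz : (PresentedGroup.of 0 : PresentedGroup (relNII (k + 6) e₁ e₂ e₃ e₄ e₅)) ^ 2 ^ (k + 3) ≠ 1) :
    IsCentralInvolution
      ((PresentedGroup.of 0 : PresentedGroup (relNII (k + 6) e₁ e₂ e₃ e₄ e₅)) ^ 2 ^ (k + 3)) ∧
    NonCommutingProductsReach
      ((PresentedGroup.of 0 : PresentedGroup (relNII (k + 6) e₁ e₂ e₃ e₄ e₅)) ^ 2 ^ (k + 3)) := by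
  have hgen := PresentedGroup.closure_of_three (relNII (k + 6) e₁ e₂ e₃ e₄ e₅)
  obtain ⟨hp, hq, hr, hpq, hpr, hqr⟩ :=
    relNII_relations (PresentedGroup.lift_of_eq_one (relNII (k + 6) e₁ e₂ e₃ e₄ e₅))
  -- The criterion for four generators is used with the redundant generator s = 1.
  refine reach_of_cyclic_normal (q := .of 1) (r := .of 2) (s := 1) (by
      rw [eq_top_iff, ← hgen]; exact Subgroup.closure_mono (by simp [Set.insert_subset_iff]))
    hp hz ⟨_, odd_add_two_pow_mul odd_one _ _, hpq⟩ ⟨_, odd_add_two_pow_mul h₁ _ _, hpr⟩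
    ⟨1, odd_one, by simp⟩ (hq ▸ one_mem _) (hr ▸ Subgroup.zpow_mem_zpowers _ _) (by simp) ?_
    (by simp) (by simp)
  rw [hqr, inv_mul_cancel_left]
  exact Subgroup.zpow_mem_zpowers _ _

lemma relMIII_reach (k : ℕ) {e₁ e₂ e₃ e₄ e₅ e₆ e₇ e₈ : ℤ} (h₁ : Odd e₁) (h₂ : Odd e₂)
    (hz : (PresentedGroup.of 0 : PresentedGroup (relMIII (k + 7) e₁ e₂ e₃ e₄ e₅ e₆ e₇ e₈)) ^
      2 ^ (k + 3) ≠ 1) :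
    IsCentralInvolution
      ((PresentedGroup.of 0 : PresentedGroup (relMIII (k + 7) e₁ e₂ e₃ e₄ e₅ e₆ e₇ e₈)) ^
        2 ^ (k + 3)) ∧
    NonCommutingProductsReach
      ((PresentedGroup.of 0 : PresentedGroup (relMIII (k + 7) e₁ e₂ e₃ e₄ e₅ e₆ e₇ e₈)) ^
        2 ^ (k + 3)) := by
  have hgen := PresentedGroup.closure_of_four (relMIII (k + 7) e₁ e₂ e₃ e₄ e₅ e₆ e₇ e₈)
  obtain ⟨hp, hq, hr, hs, hpq, hpr, hps, hqr, hqs, hrs⟩ :=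
    relMIII_relations (PresentedGroup.lift_of_eq_one (relMIII (k + 7) e₁ e₂ e₃ e₄ e₅ e₆ e₇ e₈))
  refine reach_of_cyclic_normal hgen
    hp hz ⟨1, odd_one, by simpa using hpq⟩ ⟨_, odd_add_two_pow_mul h₂ _ _, hpr⟩
    ⟨_, odd_add_two_pow_mul h₁ _ _, hps⟩ (hq ▸ one_mem _) (hr ▸ Subgroup.zpow_mem_zpowers _ _)
    (hs ▸ Subgroup.zpow_mem_zpowers _ _) ?_ ?_ ?_
  · rw [hqr, inv_mul_cancel]; exact one_mem _
  · rw [hqs, inv_mul_cancel_left]; exact Subgroup.zpow_mem_zpowers _ _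
  · rw [hrs, inv_mul_cancel_left]; exact Subgroup.zpow_mem_zpowers _ _

lemma NII_reach (k : ℕ) : ∀ n ∈ ({3, 4, 5} : Set ℕ),
    IsCentralInvolution (pNII n (k + 6) ^ 2 ^ (k + 3)) ∧
    NonCommutingProductsReach (pNII n (k + 6) ^ 2 ^ (k + 3)) := by
  rintro n (rfl | rfl | rfl)
  · exact relNII_reach k (by decide) (NII_three_pow_ne_one k)
  · exact relNII_reach k (by decide) (NII_four_pow_ne_one k)
  · exact relNII_reach k (by decide) (NII_five_pow_ne_one k)

lemma MIII_reach (k : ℕ) : ∀ n ∈ ({3, 4, 5, 10, 11, 13, 14} : Set ℕ),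
    IsCentralInvolution (pMIII n (k + 7) ^ 2 ^ (k + 3)) ∧
    NonCommutingProductsReach (pMIII n (k + 7) ^ 2 ^ (k + 3)) := by
  rintro n (rfl | rfl | rfl | rfl | rfl | rfl | rfl)
  · exact relMIII_reach k (by decide) (by decide) (MIII_three_pow_ne_one k)
  · exact relMIII_reach k (by decide) (by decide) (MIII_four_pow_ne_one k)
  · exact relMIII_reach k (by decide) (by decide) (MIII_five_pow_ne_one k)
  · exact relMIII_reach k (by decide) (by decide) (MIII_ten_pow_ne_one k)
  · exact relMIII_reach k (by decide) (by decide) (MIII_eleven_pow_ne_one k)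
  · exact relMIII_reach k (by decide) (by decide) (MIII_thirteen_pow_ne_one k)
  · exact relMIII_reach k (by decide) (by decide) (MIII_fourteen_pow_ne_one k)

/-! ### Groups with a normal subgroup generated by `p` and `q²` -/

section PairNormal

variable {G : Type*} [Group G]

lemma zpowers_sup_le_of_conj {p u x : G} {N : Subgroup G}
    (hN : Subgroup.zpowers p ⊔ Subgroup.zpowers u = N) (hp : x⁻¹ * p * x ∈ N)
    (hu : x⁻¹ * u * x ∈ N) : ∀ n ∈ N, x⁻¹ * n * x ∈ N := by
  have : N ≤ N.comap (MulAut.conj x⁻¹).toMonoidHom := by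
    nth_rewrite 1 [← hN]
    rw [sup_le_iff, Subgroup.zpowers_le, Subgroup.zpowers_le]
    exact ⟨by simpa using hp, by simpa using hu⟩
  intro n hn
  simpa using this hn

/-- N = ⟨p⟩⟨q²⟩ is normal, with quotient generated by commuting images of q and r of order at most
two. Hence there are at most four cosets, and all squares lie in N. -/
lemma pair_structure {p q r : G} {a b c d e f : ℤ} (hgen : Subgroup.closure {p, q, r} = ⊤)
    (hu : q ^ 2 ∈ Subgroup.normalizer (Subgroup.zpowers p : Set G)) (hr2 : r ^ 2 = 1)
    (hpq : q⁻¹ * p * q = (q ^ 2) ^ a * p ^ b) (hpr : r⁻¹ * p * r = (q ^ 2) ^ c * p ^ d)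
    (hqr : r⁻¹ * q * r = q * ((q ^ 2) ^ e * p ^ f)) :
    (∀ g : G, ∃ i j : ℤ, g = p ^ i * (q ^ 2) ^ j ∨ g = p ^ i * (q ^ 2) ^ j * q ∨
      g = p ^ i * (q ^ 2) ^ j * r ∨ g = p ^ i * (q ^ 2) ^ j * (q * r)) ∧
    ∀ g : G, ∃ i j : ℤ, g ^ 2 = p ^ i * (q ^ 2) ^ j := by
  obtain ⟨N, hN⟩ : ∃ N, Subgroup.zpowers p ⊔ Subgroup.zpowers (q ^ 2) = N := ⟨_, rfl⟩
  have hmem : ∀ {x}, x ∈ N ↔ ∃ i j : ℤ, x = p ^ i * (q ^ 2) ^ j := by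
    intro x; rw [← hN]; exact mem_zpowers_sup_iff hu
  have hp : p ∈ N := hN ▸ Subgroup.mem_sup_left (Subgroup.mem_zpowers p)
  have hq : q ^ 2 ∈ N := hN ▸ Subgroup.mem_sup_right (Subgroup.mem_zpowers _)
  have hup : ∀ i j : ℤ, (q ^ 2) ^ i * p ^ j ∈ N := fun i j =>
    mul_mem (zpow_mem hq i) (zpow_mem hp j)
  have hconjq : ∀ n ∈ N, q⁻¹ * n * q ∈ N :=
    zpowers_sup_le_of_conj hN (hpq ▸ hup _ _) (by
      rwa [show q⁻¹ * q ^ 2 * q = q ^ 2 by group])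
  -- With n = (q²)ᵉpᶠ, the conjugate of q² by r is (qn)² = q² · (q⁻¹nq) · n.
  have hur : r⁻¹ * q ^ 2 * r ∈ N := by
    have h := mul_mem (mul_mem hq (hconjq _ (hup e f))) (hup e f)
    rwa [show q ^ 2 * (q⁻¹ * ((q ^ 2) ^ e * p ^ f) * q) * ((q ^ 2) ^ e * p ^ f) =
      (q * ((q ^ 2) ^ e * p ^ f)) * (q * ((q ^ 2) ^ e * p ^ f)) by group, ← hqr,
      show r⁻¹ * q * r * (r⁻¹ * q * r) = r⁻¹ * q ^ 2 * r by rw [pow_two]; group] at h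
  have hconjr : ∀ n ∈ N, r⁻¹ * n * r ∈ N :=
    zpowers_sup_le_of_conj hN (hpr ▸ hup _ _) hur
  have hr : r ^ 2 ∈ N := hr2 ▸ one_mem N
  have hsq : ∀ x ∈ ({p, q, r} : Set G), x ^ 2 ∈ N := by
    rintro x (rfl | rfl | rfl)
    exacts [pow_mem hp 2, hq, hr]
  have hnormal : N.Normal := by
    refine normal_of_generators hgen ?_ fun x hx => ⟨1, hsq x hx⟩
    rintro x (rfl | rfl | rfl)
    · exact fun n hn => mul_mem (mul_mem (inv_mem hp) hn) hp
    · exact hconjq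
    · exact hconjr
  have hqr' : q⁻¹ * (r⁻¹ * q * r) ∈ N := by rw [hqr, inv_mul_cancel_left]; exact hup _ _
  constructor
  · intro g
    obtain ⟨n, hn, h⟩ := exists_coset_representative hnormal hgen hp hq hr hqr' g
    obtain ⟨i, j, rfl⟩ := hmem.1 hn
    exact ⟨i, j, h⟩
  · intro g
    have hp1 : (p : G ⧸ N) = 1 := (QuotientGroup.eq_one_iff _).2 hp
    have c1 := commute_of_commutator_mem hqr'
    exact hmem.1 (sq_mem_of_generators hnormal hgen hsq (by
      rintro x (rfl | rfl | rfl) y (rfl | rfl | rfl) <;>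
        simp only [hp1, Commute.one_left, Commute.one_right, Commute.refl, c1, c1.symm]) g)

lemma mem_normalizer_zpowers_of_commute {p u : G} (h : Commute p u) :
    u ∈ Subgroup.normalizer (Subgroup.zpowers p : Set G) := by
  apply Subgroup.centralizer_le_normalizer
  rintro _ ⟨i, rfl⟩
  exact (h.zpow_left i).eq

lemma exists_pow_two_pow_eq_one {p u : G} {k : ℕ} (h : Commute p u) (hp : p ^ 2 ^ (k + 1) = 1)
    (hu : u ^ 2 = 1) (hsq : ∀ g : G, ∃ i j : ℤ, g ^ 2 = p ^ i * u ^ j) (g : G) :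
    ∃ k : ℕ, g ^ 2 ^ k = 1 := by
  obtain ⟨i, j, hg⟩ := hsq g
  refine ⟨k + 2, ?_⟩
  have hp' : p ^ (2 ^ (k + 1) : ℤ) = 1 := by exact_mod_cast hp
  have hu' : u ^ (2 ^ (k + 1) : ℤ) = 1 := by
    have : u ^ 2 ^ (k + 1) = 1 := by rw [pow_succ', pow_mul, hu, one_pow]
    exact_mod_cast this
  have e : (p ^ i * u ^ j) ^ (2 ^ (k + 1) : ℤ) = 1 := by
    rw [(h.zpow_zpow i j).mul_zpow, ← zpow_mul, ← zpow_mul, mul_comm i, mul_comm j, zpow_mul,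
      zpow_mul, hp', hu', one_zpow, one_zpow, one_mul]
  rw [pow_succ', pow_mul, hg]
  exact_mod_cast e

/-- Makes an arbitrary integer exponent finite, so that statements about images in a finite quotient
become decidable. -/
lemma exists_fin_zpow_eq {x : G} {n : ℕ} [NeZero n] (h : x ^ n = 1) (i : ℤ) :
    ∃ j : Fin n, x ^ i = x ^ (j : ℕ) := by
  have hn : (n : ℤ) ≠ 0 := by exact_mod_cast NeZero.ne n
  refine ⟨⟨(i % n).toNat, by
    have h1 := Int.emod_nonneg i hn
    have h2 := Int.emod_lt_of_pos i (by positivity : 0 < (n : ℤ))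
    omega⟩, ?_⟩
  have h' : x ^ (n : ℤ) = 1 := by exact_mod_cast h
  rw [← zpow_natCast, Int.toNat_of_nonneg (Int.emod_nonneg i hn)]
  conv_lhs => rw [← Int.mul_ediv_add_emod i n, zpow_add, zpow_mul, h', one_zpow, one_mul]

lemma zpow_mul_zpow_sq {p u : G} (h : Commute p u) (hu : u ^ 2 = 1) (i j : ℤ) :
    (p ^ i * u ^ j) * (p ^ i * u ^ j) = p ^ (2 * i) := by
  have hu' : u ^ (2 : ℤ) = 1 := by exact_mod_cast hu
  rw [(h.zpow_zpow i j).symm.mul_mul_mul_comm, ← zpow_add, ← zpow_add, ← two_mul, ← two_mul,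
    zpow_mul u, hu', one_zpow, mul_one]

lemma zpow_odd_of_zpow_two_mul {p : G} {i c : ℤ} (hi : p ^ (2 * i) = 1) (hc : Odd c) :
    (p ^ c) ^ i = p ^ i := by
  obtain ⟨d, rfl⟩ := hc
  rw [← zpow_mul, show (2 * d + 1) * i = 2 * i * d + i by ring, zpow_add, zpow_mul, hi, one_zpow,
    one_mul]

lemma commute_zpow_mul_zpow {p u x : G} {i j : ℤ} (hp : x⁻¹ * p ^ i * x = p ^ i)
    (hu : Commute x u) : Commute x (p ^ i * u ^ j) :=
  (commute_of_inv_mul_mul_eq hp).mul_right (hu.zpow_right j)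

lemma inv_mul_zpow_mul (x p : G) (i : ℤ) : x⁻¹ * p ^ i * x = (x⁻¹ * p * x) ^ i := by
  simpa using (conj_zpow (i := i) (a := x⁻¹) (b := p)).symm

/-- With N = ⟨p, q²⟩, the kernel of χ is N ∪ Nq. An involution pⁱ(q²)ʲ satisfies p²ⁱ = 1, so pⁱ is
fixed by the odd powers through which q and r act, and the element is central. An element of Nq has
as square in the dihedral quotient the rotation by a half turn, so it is no involution. -/
lemma commonCentralPower_of_odd_conj {p q r : G} {k : ℕ} {a b : ℤ}
    (hgen : Subgroup.closure {p, q, r} = ⊤) (hp : p ^ 2 ^ (k + 1) = 1) (hq : q ^ 4 = 1)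
    (hr : r ^ 2 = 1) (ha : Odd a) (hb : Odd b) (hpq : q⁻¹ * p * q = p ^ a)
    (hpr : r⁻¹ * p * r = p ^ b) (hqr : r⁻¹ * q * r = q ^ 3) (hpu : Commute p (q ^ 2))
    {φ : G →* DihedralGroup 4} (hφp : φ p = 1) (hφq : φ q = DihedralGroup.r 1)
    {χ : G →* ℤˣ} (hχp : χ p = 1) (hχq : χ q = 1) (hχr : χ r = -1) :
    TriplesHaveCommonCentralPower G := by
  have hu2 : (q ^ 2) ^ 2 = 1 := by rw [← pow_mul]; exact hq
  -- The value e = 1 records q³ = q · q².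
  obtain ⟨hrep, hsq⟩ := pair_structure (a := 0) (b := a) (c := 0) (d := b) (e := 1) (f := 0) hgen
    (mem_normalizer_zpowers_of_commute hpu) hr (by simpa using hpq) (by simpa using hpr)
    (by rw [hqr]; simp [pow_succ, mul_assoc])
  refine triplesHaveCommonCentralPower_of_character χ ?_
    (exists_pow_two_pow_eq_one hpu hp hu2 hsq)
  intro x hx hχx
  have hxx := (orderOf_eq_two_iff'.1 hx).1
  obtain ⟨i, j, h | h | h | h⟩ := hrep x
  · subst h
    rw [zpow_mul_zpow_sq hpu hu2] at hxx
    refine commute_of_generators hgen ?_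
    rintro y (rfl | rfl | rfl)
    · exact commute_zpow_mul_zpow (by group) hpu
    · exact commute_zpow_mul_zpow
        (by rw [inv_mul_zpow_mul, hpq, zpow_odd_of_zpow_two_mul hxx ha]) (Commute.self_pow y 2)
    · refine commute_zpow_mul_zpow
        (by rw [inv_mul_zpow_mul, hpr, zpow_odd_of_zpow_two_mul hxx hb])
        (commute_of_inv_mul_mul_eq ?_)
      have := inv_mul_zpow_mul y q 2
      rw [hqr] at this
      have e : (q ^ 3) ^ (2 : ℤ) = q ^ 2 := by
        calc (q ^ 3) ^ (2 : ℤ) = q ^ 4 * q ^ 2 := by group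
          _ = q ^ 2 := by rw [hq, one_mul]
      rw [e] at this
      exact_mod_cast this
  · exfalso
    have := congrArg φ hxx
    subst h
    simp only [map_mul, map_zpow, map_pow, hφp, hφq, one_zpow, one_mul, map_one] at this
    obtain ⟨j', hj⟩ := exists_fin_zpow_eq (n := 2)
      (by decide : ((DihedralGroup.r 1 : DihedralGroup 4) ^ 2) ^ 2 = 1) j
    rw [hj] at this
    revert this
    clear hj
    revert j'
    decide
  · exfalso; subst h; simp [hχp, hχq, hχr] at hχx
  · exfalso; subst h; simp [hχp, hχq, hχr] at hχx

end PairNormal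

/-! ### Application to M_{II-A} and M_{II-B}. -/

section Relations

variable {H : Type*} [Group H] {k : ℕ} {f : Fin 3 → H}

lemma relMIIA_relations {e₇ : ℤ}
    (h : ∀ x ∈ relMIIA (k + 7) 0 1 0 0 0 0 e₇ (-1), FreeGroup.lift f x = 1) :
    f 0 ^ 2 ^ (k + 4) = 1 ∧ f 1 ^ 4 = 1 ∧ f 2 ^ 2 = 1 ∧
    (f 1)⁻¹ * f 0 * f 1 = f 0 ^ (1 + 2 ^ (k + 2) * e₇) ∧
    (f 2)⁻¹ * f 0 * f 2 = f 0 ^ (-1 : ℤ) ∧ (f 2)⁻¹ * f 1 * f 2 = f 1 ^ 3 := by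
  have := h
  simp only [relMIIA, Set.mem_insert_iff, Set.mem_singleton_iff, forall_eq_or_imp, forall_eq] at this
  simpa [div_eq_one, mul_eq_one_iff_eq_inv] using this

lemma relMIIB_relations {e₅ e₆ : ℤ}
    (h : ∀ x ∈ relMIIB (k + 7) (k + 3) 0 1 0 0 e₅ e₆ 1, FreeGroup.lift f x = 1) :
    f 0 ^ 2 ^ (k + 4) = 1 ∧ f 1 ^ 4 = 1 ∧ f 2 ^ 2 = 1 ∧
    (f 1)⁻¹ * f 0 * f 1 = f 0 ^ (-1 + 2 ^ (k + 2) * e₆) ∧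
    (f 2)⁻¹ * f 0 * f 2 = f 0 ^ (1 + 2 ^ (k + 3) * e₅) ∧ (f 2)⁻¹ * f 1 * f 2 = f 1 ^ 3 := by
  simpa [relMIIB, div_eq_one] using h

end Relations

lemma commute_sq_of_conj {G : Type*} [Group G] {p q : G} {n a : ℤ} (hp : p ^ n = 1)
    (hpq : q⁻¹ * p * q = p ^ a) (ha : n ∣ a * a - 1) : Commute p (q ^ 2) := by
  obtain ⟨c, hc⟩ := ha
  have h : (q ^ 2)⁻¹ * p * q ^ 2 = p := by
    calc (q ^ 2)⁻¹ * p * q ^ 2 = q⁻¹ * (q⁻¹ * p * q) * q := by rw [pow_two]; group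
      _ = p ^ (a * a) := by rw [hpq, inv_mul_zpow_mul, hpq, zpow_mul]
      _ = p := by rw [show a * a = n * c + 1 by omega, zpow_add, zpow_mul, hp]; simp
  exact (commute_of_inv_mul_mul_eq h).symm

lemma relMIIA_commonCentralPower (k : ℕ) {e : ℤ}
    (hφ : ∃ φ : PresentedGroup (relMIIA (k + 7) 0 1 0 0 0 0 (2 * e) (-1)) →* DihedralGroup 4,
      φ (.of 0) = 1 ∧ φ (.of 1) = .r 1 ∧ φ (.of 2) = .sr 0)
    (hψ : ∃ φ : PresentedGroup (relMIIA (k + 7) 0 1 0 0 0 0 (2 * e) (-1)) →*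
      ElementaryAbelianEight, Function.Surjective φ ∧
      φ (.of 0) = (-1, 1, 1) ∧ φ (.of 1) = (1, -1, 1) ∧ φ (.of 2) = (1, 1, -1)) :
    TriplesHaveCommonCentralPower (PresentedGroup (relMIIA (k + 7) 0 1 0 0 0 0 (2 * e) (-1))) := by
  obtain ⟨φ, hφ0, hφ1, -⟩ := hφ
  obtain ⟨ψ, -, hψ0, hψ1, hψ2⟩ := hψ
  obtain ⟨hp, hq, hr, hpq, hpr, hqr⟩ := relMIIA_relations (PresentedGroup.lift_of_eq_one _)
  refine commonCentralPower_of_odd_conj (PresentedGroup.closure_of_three _) hp hq hr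
    (odd_add_two_pow_mul odd_one _ _) (by decide) hpq hpr hqr
    -- (1 + 2^(k+3)e)² - 1 = 2^(k+4)(e + 2^(k+2)e²).
    (commute_sq_of_conj (n := 2 ^ (k + 4)) (by exact_mod_cast hp) hpq
      ⟨e + 2 ^ (k + 2) * (e * e), by ring⟩) hφ0 hφ1
    (χ := (MonoidHom.snd _ _).comp ((MonoidHom.snd _ _).comp ψ)) ?_ ?_ ?_ <;> simp [hψ0, hψ1, hψ2]

lemma relMIIB_commonCentralPower (k : ℕ) {e₅ e : ℤ}
    (hφ : ∃ φ : PresentedGroup (relMIIB (k + 7) (k + 3) 0 1 0 0 e₅ (2 * e) 1) →* DihedralGroup 4,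
      φ (.of 0) = 1 ∧ φ (.of 1) = .r 1 ∧ φ (.of 2) = .sr 0)
    (hψ : ∃ φ : PresentedGroup (relMIIB (k + 7) (k + 3) 0 1 0 0 e₅ (2 * e) 1) →*
      ElementaryAbelianEight, Function.Surjective φ ∧
      φ (.of 0) = (-1, 1, 1) ∧ φ (.of 1) = (1, -1, 1) ∧ φ (.of 2) = (1, 1, -1)) :
    TriplesHaveCommonCentralPower
      (PresentedGroup (relMIIB (k + 7) (k + 3) 0 1 0 0 e₅ (2 * e) 1)) := by
  obtain ⟨φ, hφ0, hφ1, -⟩ := hφ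
  obtain ⟨ψ, -, hψ0, hψ1, hψ2⟩ := hψ
  obtain ⟨hp, hq, hr, hpq, hpr, hqr⟩ := relMIIB_relations (PresentedGroup.lift_of_eq_one _)
  refine commonCentralPower_of_odd_conj (PresentedGroup.closure_of_three _) hp hq hr
    (odd_add_two_pow_mul (by decide) _ _) (odd_add_two_pow_mul odd_one _ _) hpq hpr hqr
    (commute_sq_of_conj (n := 2 ^ (k + 4)) (by exact_mod_cast hp) hpq
      ⟨-e + 2 ^ (k + 2) * (e * e), by ring⟩) hφ0 hφ1
    (χ := (MonoidHom.snd _ _).comp ((MonoidHom.snd _ _).comp ψ)) ?_ ?_ ?_ <;> simp [hψ0, hψ1, hψ2]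

lemma MIIA_commonCentralPower (k : ℕ) : ∀ n ∈ ({39, 40} : Set ℕ),
    TriplesHaveCommonCentralPower (MIIA n (k + 7)) := by
  rintro n (rfl | rfl)
  · exact relMIIA_commonCentralPower k (e := 0) (MIIA_exists_dihedral k 39 (by simp))
      (MIIA_exists_surjective k 39 (by simp))
  · exact relMIIA_commonCentralPower k (e := 1) (MIIA_exists_dihedral k 40 (by simp))
      (MIIA_exists_surjective k 40 (by simp))

lemma MIIB_commonCentralPower (k : ℕ) : ∀ n ∈ ({19, 20} : Set ℕ),
    TriplesHaveCommonCentralPower (MIIB n (k + 7)) := by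
  rintro n (rfl | rfl)
  · exact relMIIB_commonCentralPower k (e := 0) (MIIB_exists_dihedral k 19 (by simp))
      (MIIB_exists_surjective k 19 (by simp))
  · exact relMIIB_commonCentralPower k (e := 1) (MIIB_exists_dihedral k 20 (by simp))
      (MIIB_exists_surjective k 20 (by simp))

/-! ### The intersection condition for three involutions -/

section Intersection

variable {G : Type*} [Group G]

lemma mem_closure_pair_of_involutions {a b x : G} (ha : a * a = 1) (hb : b * b = 1)
    (hx : x ∈ Subgroup.closure {a, b}) : ∃ n : ℤ, x = (a * b) ^ n ∨ x = (a * b) ^ n * b := by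
  have ha' : a⁻¹ = a := inv_eq_of_mul_eq_one_left ha
  have hb' : b⁻¹ = b := inv_eq_of_mul_eq_one_left hb
  have hconj : ∀ n : ℤ, b * (a * b) ^ n = (a * b) ^ (-n) * b := by
    intro n
    have := conj_zpow (i := n) (a := b) (b := a * b)
    rw [show b * (a * b) * b⁻¹ = (a * b)⁻¹ by rw [mul_inv_rev, ha', hb']; simp [mul_assoc, hb],
      inv_zpow', eq_mul_inv_iff_mul_eq] at this
    exact this.symm
  induction hx using Subgroup.closure_induction with
  | mem x hx =>
    rcases hx with rfl | rfl
    · exact ⟨1, Or.inr (by simp [mul_assoc, hb])⟩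
    · exact ⟨0, Or.inr (by simp)⟩
  | one => exact ⟨0, Or.inl (by simp)⟩
  | mul x y _ _ hx hy =>
    obtain ⟨n, rfl | rfl⟩ := hx <;> obtain ⟨m, rfl | rfl⟩ := hy
    · exact ⟨n + m, Or.inl (zpow_add _ _ _).symm⟩
    · exact ⟨n + m, Or.inr (by rw [zpow_add, mul_assoc])⟩
    · exact ⟨n + -m, Or.inr (by rw [mul_assoc, hconj, zpow_add, mul_assoc])⟩
    · exact ⟨n + -m, Or.inl (by
        rw [mul_assoc, ← mul_assoc b, hconj, mul_assoc _ b b, hb, mul_one, zpow_add])⟩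
  | inv x _ hx =>
    obtain ⟨n, rfl | rfl⟩ := hx
    · exact ⟨-n, Or.inl (zpow_neg _ _).symm⟩
    · exact ⟨n, Or.inr (by rw [mul_inv_rev, hb', ← zpow_neg, hconj, neg_neg])⟩

lemma units_neg_one_zpow_eq_one {n : ℤ} (h : (-1 : ℤˣ) ^ n = 1) : ∃ m, n = 2 * m := by
  rcases Int.even_or_odd' n with ⟨m, rfl | rfl⟩
  · exact ⟨m, rfl⟩
  · rw [zpow_add, zpow_mul] at h
    simp at h

/-- The characters are dual to the generators and detect which generators a word really needs. This
settles every pair of index sets except {0, 1} and {2, 1}. There a common element has trivial χ 0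
and χ 2, so it is an even rotation or such a rotation times s₁, and χ 1 forces the same alternative
on both sides; `hkey` finishes. -/
lemma intersectionCondition_of_characters {s : Fin 3 → G} (hs : ∀ j, s j * s j = 1)
    (hcomm : Commute (s 0) (s 2)) (χ : Fin 3 → G →* ℤˣ)
    (hχ : ∀ i j, χ i (s j) = if i = j then -1 else 1)
    (hkey : ∀ m l : ℤ, ((s 0 * s 1) ^ 2) ^ m = ((s 2 * s 1) ^ 2) ^ l → ((s 0 * s 1) ^ 2) ^ m = 1) :
    IntersectionCondition s := by
  have hF : ∀ (J : Set (Fin 3)) (j : Fin 3) (x : G), x ∈ Subgroup.closure (s '' J) →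
      χ j x ≠ 1 → j ∈ J := by
    intro J j x hx hj
    by_contra hJ
    have : Subgroup.closure (s '' J) ≤ (χ j).ker := by
      rw [Subgroup.closure_le]
      rintro _ ⟨i, hi, rfl⟩
      have : j ≠ i := by rintro rfl; exact hJ hi
      simp [MonoidHom.mem_ker, hχ, this]
    exact hj (this hx)
  have hmem : ∀ (J : Set (Fin 3)) (j : Fin 3), j ∈ J → s j ∈ Subgroup.closure (s '' J) :=
    fun J j hj => Subgroup.subset_closure ⟨j, hj, rfl⟩
  -- Without index 1 the element is s₀ᵃs₂ᵇ. A factor with odd exponent is seen by its character, so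
  -- its index lies in both sets; a factor with even exponent is trivial.
  have hno1 : ∀ J K : Set (Fin 3), 1 ∉ J → ∀ x, x ∈ Subgroup.closure (s '' J) →
      x ∈ Subgroup.closure (s '' K) → x ∈ Subgroup.closure (s '' (J ∩ K)) := by
    intro J K hJ x hxJ hxK
    have hx : x ∈ Subgroup.closure {s 0, s 2} := by
      refine Subgroup.closure_mono ?_ hxJ
      rintro _ ⟨i, hi, rfl⟩
      fin_cases i
      · simp
      · exact absurd hi hJ
      · simp
    have hfac : ∀ (j : Fin 3) (a : ℤ), χ j (s j ^ a) = χ j x →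
        s j ^ a ∈ Subgroup.closure (s '' (J ∩ K)) := by
      intro j a h
      by_cases hj : χ j x = 1
      · rw [hj, map_zpow, hχ, if_pos rfl] at h
        obtain ⟨b, rfl⟩ := units_neg_one_zpow_eq_one h
        rw [zpow_mul, zpow_two, hs, one_zpow]
        exact one_mem _
      · exact zpow_mem (hmem (J ∩ K) j (Set.mem_inter (hF J j x hxJ hj) (hF K j x hxK hj))) _
    have key : ∀ a b : ℤ, x = s 0 ^ a * s 2 ^ b → x ∈ Subgroup.closure (s '' (J ∩ K)) := by
      intro a b hab
      have h0 := hfac 0 a (by rw [hab]; simp [hχ])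
      have h2 := hfac 2 b (by rw [hab]; simp [hχ])
      rw [hab]
      exact mul_mem h0 h2
    obtain ⟨n, h | h⟩ := mem_closure_pair_of_involutions (hs 0) (hs 2) hx
    · exact key n n (by rw [h, hcomm.mul_zpow])
    · exact key n (n + 1) (by rw [h, hcomm.mul_zpow, mul_assoc, zpow_add_one])
  have heven : ∀ i : Fin 3, i ≠ 1 → ∀ x, x ∈ Subgroup.closure (s '' {i, 1}) → χ i x = 1 →
      ∃ m : ℤ, x = ((s i * s 1) ^ 2) ^ m ∨ x = ((s i * s 1) ^ 2) ^ m * s 1 := by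
    intro i hi x hx hχx
    rw [Set.image_pair] at hx
    have hz : ∀ n : ℤ, χ i ((s i * s 1) ^ n) = 1 →
        ∃ m : ℤ, (s i * s 1) ^ n = ((s i * s 1) ^ 2) ^ m := by
      intro n hn
      rw [map_zpow, map_mul, hχ, hχ, if_pos rfl, if_neg hi, mul_one] at hn
      obtain ⟨m, rfl⟩ := units_neg_one_zpow_eq_one hn
      exact ⟨m, by rw [zpow_mul]; exact_mod_cast rfl⟩
    obtain ⟨n, rfl | rfl⟩ := mem_closure_pair_of_involutions (hs i) (hs 1) hx
    · obtain ⟨m, h⟩ := hz n hχx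
      exact ⟨m, Or.inl h⟩
    · obtain ⟨m, h⟩ := hz n (by simpa [hχ, hi] using hχx)
      exact ⟨m, Or.inr (by rw [h])⟩
  have hcore : ∀ x, x ∈ Subgroup.closure (s '' {0, 1}) → x ∈ Subgroup.closure (s '' {2, 1}) →
      x ∈ Subgroup.closure (s '' {1}) := by
    intro x h0 h2
    have c2 : χ 2 x = 1 := by
      by_contra h
      simpa using hF _ 2 x h0 h
    have c0 : χ 0 x = 1 := by
      by_contra h
      simpa using hF _ 0 x h2 h
    have hsq : ∀ (i : Fin 3) (m : ℤ), χ 1 (((s i * s 1) ^ 2) ^ m) = 1 := by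
      intro i m
      rw [map_zpow, map_pow, Int.units_sq, one_zpow]
    have d1 : χ 1 (s 1) = -1 := by rw [hχ, if_pos rfl]
    have m1 := hmem {1} 1 rfl
    obtain ⟨m, h | h⟩ := heven 0 (by decide) x h0 c0 <;>
      obtain ⟨l, h' | h'⟩ := heven 2 (by decide) x h2 c2
    · rw [h, hkey m l (h.symm.trans h')]
      exact one_mem _
    · have := congrArg (χ 1) (h.symm.trans h')
      rw [map_mul, hsq, hsq, d1] at this
      exact absurd this (by decide)
    · have := congrArg (χ 1) (h.symm.trans h')
      rw [map_mul, hsq, hsq, d1] at this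
      exact absurd this (by decide)
    · rw [h, hkey m l (mul_right_cancel (h.symm.trans h')), one_mul]
      exact m1
  -- Two incomparable sets that both contain 1 must be {0, 1} and {2, 1}.
  have hsub : ∀ J : Set (Fin 3), ∀ i j : Fin 3, i ∉ J → 1 ∈ J → j ∈ J → i ≠ j → j ≠ 1 → i ≠ 1 →
      J = {j, 1} := by
    intro J i j hi h1 hj hij hj1 hi1
    ext l
    simp only [Set.mem_insert_iff, Set.mem_singleton_iff]
    constructor
    · intro hl
      have : l ≠ i := by rintro rfl; exact hi hl
      omega
    · rintro (rfl | rfl) <;> assumption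
  intro J K
  apply le_antisymm
  · rintro x ⟨hxJ, hxK⟩
    by_cases h1J : 1 ∈ J
    · by_cases h1K : 1 ∈ K
      · by_cases hJK : J ⊆ K
        · rwa [Set.inter_eq_left.2 hJK]
        · by_cases hKJ : K ⊆ J
          · rwa [Set.inter_eq_right.2 hKJ]
          · obtain ⟨j, hjJ, hjK⟩ := Set.not_subset.1 hJK
            obtain ⟨i, hiK, hiJ⟩ := Set.not_subset.1 hKJ
            have hj1 : j ≠ 1 := by rintro rfl; exact hjK h1K
            have hi1 : i ≠ 1 := by rintro rfl; exact hiJ h1J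
            have hij : i ≠ j := by rintro rfl; exact hiJ hjJ
            rw [hsub J i j hiJ h1J hjJ hij hj1 hi1] at hxJ
            rw [hsub K j i hjK h1K hiK hij.symm hi1 hj1] at hxK
            refine Subgroup.closure_mono (Set.image_mono
              (Set.singleton_subset_iff.2 (Set.mem_inter h1J h1K) :
                ({1} : Set (Fin 3)) ⊆ J ∩ K)) ?_
            obtain ⟨rfl, rfl⟩ | ⟨rfl, rfl⟩ : (j = 0 ∧ i = 2) ∨ (j = 2 ∧ i = 0) := by omega
            · exact hcore x hxJ hxK
            · exact hcore x hxK hxJ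
      · rw [Set.inter_comm]
        exact hno1 K J h1K x hxK hxJ
    · exact hno1 J K h1J x hxJ hxK
  · exact le_inf (Subgroup.closure_mono (Set.image_mono Set.inter_subset_left))
      (Subgroup.closure_mono (Set.image_mono Set.inter_subset_right))

end Intersection

/-! ### The two string C-groups -/

section StringCGroups

lemma isConnectedStringDiagram_three {G : Type*} [Group G] {s : Fin 3 → G}
    (hinj : Function.Injective s) (hs : ∀ j, orderOf (s j) = 2)
    (h02 : Commute (s 0) (s 2)) (h01 : (s 0 * s 1) ^ 2 ≠ 1) (h12 : (s 1 * s 2) ^ 2 ≠ 1) :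
    IsConnectedStringDiagram s := by
  have key : ∀ x : G, x ^ 2 ≠ 1 → 2 < orderOf x ∨ orderOf x = 0 := by
    intro x hx
    have h1 : orderOf x ≠ 1 := by
      intro h
      rw [orderOf_eq_one_iff] at h
      simp [h] at hx
    have h2 : orderOf x ≠ 2 := by
      intro h
      exact hx (h ▸ pow_orderOf_eq_one x)
    omega
  refine ⟨⟨hinj, hs, ?_⟩, ?_⟩
  · intro j k hjk
    obtain ⟨rfl, rfl⟩ : j = 0 ∧ k = 2 := by omega
    rw [orderOf_eq_two_iff', h02.symm.mul_mul_mul_comm, (orderOf_eq_two_iff'.1 (hs 0)).1,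
      (orderOf_eq_two_iff'.1 (hs 2)).1, one_mul]
    refine ⟨rfl, fun h => ?_⟩
    have := hinj (eq_inv_of_mul_eq_one_left h |>.trans (inv_eq_self_of_orderOf_eq_two (hs 2)))
    exact absurd this (by decide)
  · intro j k hjk
    obtain ⟨rfl, rfl⟩ | ⟨rfl, rfl⟩ : (j = 0 ∧ k = 1) ∨ (j = 1 ∧ k = 2) := by omega
    · exact key _ h01
    · exact key _ h12

/-- The triple is r, qr, qp. Here s₀s₁ = q³, so (s₀s₁)² has order two and maps to (1, ρ²), with ρ
the rotation `r 1`. Since (s₂s₁)² maps to (ρ², ρ²), none of its powers equals (s₀s₁)². -/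
lemma isConnectedStringCGroup_of_relations {G : Type*} [Group G] {p q r : G}
    (hgen : Subgroup.closure {p, q, r} = ⊤) (hq : q ^ 4 = 1) (hr : r ^ 2 = 1)
    (hpq : q⁻¹ * p * q = q ^ 2 * p⁻¹) (hpr : r⁻¹ * p * r = q ^ 2 * p) (hqr : r⁻¹ * q * r = q ^ 3)
    {φ : G →* DihedralGroup 4 × DihedralGroup 4} (hφp : φ p = (.r 1, .sr 0))
    (hφq : φ q = (.sr 0, .r 1)) (hφr : φ r = (1, .sr 1))
    {ψ : G →* ElementaryAbelianEight} (hψp : ψ p = (-1, 1, 1)) (hψq : ψ q = (1, -1, 1))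
    (hψr : ψ r = (1, 1, -1)) : IsConnectedStringCGroup G := by
  have hr' : r⁻¹ = r := inv_eq_of_mul_eq_one_left (by rw [← pow_two, hr])
  have hqr' : r * q * r = q ^ 3 := by rw [← hqr, hr']
  have e1 : (q * r) * (q * r) = 1 := by
    rw [mul_assoc, ← mul_assoc r, hqr', ← pow_succ', hq]
  have e2 : (q * p) * (q * p) = 1 := by
    calc (q * p) * (q * p) = q ^ 2 * (q⁻¹ * p * q) * p := by rw [pow_two]; group
      _ = q ^ 2 * q ^ 2 := by rw [hpq]; group
      _ = 1 := by rw [← pow_add, hq]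
  have e02 : Commute r (q * p) := by
    refine commute_of_inv_mul_mul_eq ?_
    calc r⁻¹ * (q * p) * r = (r⁻¹ * q * r) * (r⁻¹ * p * r) := by group
      _ = q ^ 4 * (q * p) := by rw [hqr, hpr]; group
      _ = q * p := by rw [hq, one_mul]
  have e01 : r * (q * r) = q ^ 3 := by rw [← mul_assoc, hqr']
  obtain ⟨s, hs⟩ : ∃ s : Fin 3 → G, s = ![r, q * r, q * p] := ⟨_, rfl⟩
  have s0 : s 0 = r := by rw [hs]; rfl
  have s1 : s 1 = q * r := by rw [hs]; rfl
  have s2 : s 2 = q * p := by rw [hs]; rfl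
  have hss : ∀ j, s j * s j = 1 := by
    intro j
    fin_cases j
    · simpa [s0, pow_two] using hr
    · simpa [s1] using e1
    · simpa [s2] using e2
  have hψ : ∀ j, ψ (s j) = ![(1, 1, -1), (1, -1, -1), (-1, -1, 1)] j := by
    intro j
    fin_cases j
    · simp [s0, hψr]
    · simp [s1, hψq, hψr]
    · simp [s2, hψq, hψp]
  have hA : φ ((s 0 * s 1) ^ 2) = (1, .r 2) := by
    rw [s0, s1, e01, map_pow, map_pow, hφq]; decide
  have hB : φ ((s 2 * s 1) ^ 2) = ((.sr 0, .r 1) * (.r 1, .sr 0) * ((.sr 0, .r 1) * (1, .sr 1))) ^ 2 := by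
    rw [s2, s1, map_pow, map_mul, map_mul, map_mul, hφq, hφp, hφr]
  refine ⟨3, by norm_num, s, ?_, ?_, ?_⟩
  · rw [eq_top_iff, ← hgen, Subgroup.closure_le]
    have m : ∀ j, s j ∈ Subgroup.closure (Set.range s) := fun j => Subgroup.subset_closure ⟨j, rfl⟩
    have hrm : r ∈ Subgroup.closure (Set.range s) := s0 ▸ m 0
    have hqm : q ∈ Subgroup.closure (Set.range s) := by
      simpa [s1] using mul_mem (m 1) (inv_mem hrm)
    have hpm : p ∈ Subgroup.closure (Set.range s) := by
      simpa [s2] using mul_mem (inv_mem hqm) (m 2)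
    rintro x (rfl | rfl | rfl) <;> assumption
  · refine isConnectedStringDiagram_three ?_ ?_ (by rw [s0, s2]; exact e02) ?_ ?_
    · intro i j hij
      have := congrArg ψ hij
      rw [hψ, hψ] at this
      clear hij
      revert i j
      decide
    · intro j
      rw [orderOf_eq_two_iff']
      refine ⟨hss j, fun h => ?_⟩
      have := congrArg ψ h
      rw [hψ, map_one] at this
      clear h
      revert j
      decide
    · intro h
      rw [h, map_one] at hA
      exact absurd hA (by decide)
    · intro h
      have h' := congrArg φ h
      rw [map_pow, map_mul, s1, s2, map_mul, map_mul, hφq, hφp, hφr, map_one] at h'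
      exact absurd h' (by decide)
  · have hsq : ((s 0 * s 1) ^ 2) ^ 2 = 1 := by
      rw [s0, s1, e01, ← pow_mul, ← pow_mul, show 3 * 2 * 2 = 4 * 3 by norm_num, pow_mul, hq,
        one_pow]
    let α : G →* ℤˣ := (MonoidHom.fst _ _).comp ψ
    let β : G →* ℤˣ := (MonoidHom.fst _ _).comp ((MonoidHom.snd _ _).comp ψ)
    let γ : G →* ℤˣ := (MonoidHom.snd _ _).comp ((MonoidHom.snd _ _).comp ψ)
    -- The signs (α, β, γ) of r, qr, qp are (+,+,-), (+,-,-), (-,-,+); these products form the dual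
    -- basis.
    refine intersectionCondition_of_characters hss (by rw [s0, s2]; exact e02)
      ![α * β * γ, α * β, α] ?_ ?_
    · intro i j
      fin_cases i <;> simp only [α, β, γ] <;> simp [hψ] <;> revert j <;> decide
    · intro m l h
      have hsq' : ((s 0 * s 1) ^ 2) ^ (2 : ℤ) = 1 := by exact_mod_cast hsq
      rcases Int.even_or_odd' m with ⟨n, rfl | rfl⟩
      · rw [zpow_mul, hsq', one_zpow]
      · rw [zpow_add, zpow_mul, hsq', one_zpow, one_mul, zpow_one] at h
        have h' := congrArg φ h
        rw [hA, map_zpow, hB] at h'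
        obtain ⟨i, hi⟩ := exists_fin_zpow_eq (n := 2) (by decide :
          ((((.sr 0, .r 1) * (.r 1, .sr 0) * ((.sr 0, .r 1) * (1, .sr 1))) ^ 2) ^ 2 :
            DihedralGroup 4 × DihedralGroup 4) = 1) l
        rw [hi] at h'
        clear hi
        exfalso
        revert i
        decide

end StringCGroups

/-! ### Application to M_{II-D,3} and M_{II-D,19}. -/

section Relations

variable {H : Type*} [Group H] {k : ℕ} {f : Fin 3 → H}

lemma relMIID_relations {e₁ e₂ e₅ e₆ e₈ : ℤ}
    (h : ∀ x ∈ relMIID (k + 7) (k + 3) e₁ e₂ 0 0 e₅ e₆ 0 e₈, FreeGroup.lift f x = 1) :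
    f 0 ^ 2 ^ (k + 4) = 1 ∧ f 1 ^ 4 = 1 ∧ f 2 ^ 2 = 1 ∧
    (f 1)⁻¹ * f 0 * f 1 = f 1 ^ 2 * (f 0)⁻¹ ∧
    (f 1 ^ 2)⁻¹ * f 0 * f 1 ^ 2 = f 0 ^ (1 + 2 ^ (k + 3) * e₆) ∧
    (f 2)⁻¹ * f 0 * f 2 = f 1 ^ (2 * e₁) * f 0 ^ (e₈ + 2 ^ (k + 3) * e₅) ∧
    (f 2)⁻¹ * f 1 * f 2 = f 1 ^ (1 + 2 * e₂) := by
  simpa [relMIID, div_eq_one] using h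

end Relations

lemma MIID_isConnectedStringCGroup (k : ℕ) : ∀ n ∈ ({3, 19} : Set ℕ),
    IsConnectedStringCGroup (MIID n (k + 7)) := by
  intro n hn
  obtain ⟨φ, hφp, hφq, hφr⟩ := MIID_exists_dihedral k n (by rcases hn with rfl | rfl <;> simp)
  obtain ⟨ψ, -, hψp, hψq, hψr⟩ := MIID_exists_surjective k n (by rcases hn with rfl | rfl <;> simp)
  rcases hn with rfl | rfl
  all_goals
    obtain ⟨-, hq, hr, hpq, -, hpr, hqr⟩ := relMIID_relations (PresentedGroup.lift_of_eq_one _)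
    exact isConnectedStringCGroup_of_relations (PresentedGroup.closure_of_three _) hq hr hpq
      hpr hqr hφp hφq hφr hψp hψq hψr

/-! ### The groups `M_{II-D,17}` and `M_{II-D,18}` -/

section PairNormal

variable {G : Type*} [Group G]

lemma zpow_mul_zpow_zpow_two_mul {p u : G} (h : Commute p u) (hu : u ^ 2 = 1) (a b i : ℤ) :
    (u ^ a * p ^ b) ^ (2 * i) = (p ^ b) ^ (2 * i) := by
  have hu' : u ^ (2 : ℤ) = 1 := by exact_mod_cast hu
  rw [(h.symm.zpow_zpow a b).mul_zpow, ← zpow_mul, show a * (2 * i) = 2 * (a * i) by ring,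
    zpow_mul u, hu', one_zpow, one_mul]

/-- Conjugating an even power of p removes the extra factor q², whose square is 1, and leaves an odd
power; that fixes p²ⁱ because p⁴ⁱ = 1. -/
lemma zpow_two_mul_mul_zpow_central {p q r : G} {a b c d : ℤ}
    (hgen : Subgroup.closure {p, q, r} = ⊤) (hpu : Commute p (q ^ 2)) (hu : (q ^ 2) ^ 2 = 1)
    (hur : Commute r (q ^ 2)) (hb : Odd b) (hd : Odd d)
    (hpq : q⁻¹ * p * q = (q ^ 2) ^ a * p ^ b) (hpr : r⁻¹ * p * r = (q ^ 2) ^ c * p ^ d) {i : ℤ}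
    (hi : p ^ (2 * (2 * i)) = 1) (j : ℤ) (g : G) :
    g * (p ^ (2 * i) * (q ^ 2) ^ j) = p ^ (2 * i) * (q ^ 2) ^ j * g := by
  refine commute_of_generators hgen ?_ g
  rintro y (rfl | rfl | rfl)
  · exact commute_zpow_mul_zpow (by group) hpu
  · exact commute_zpow_mul_zpow (by rw [inv_mul_zpow_mul, hpq,
      zpow_mul_zpow_zpow_two_mul hpu hu, zpow_odd_of_zpow_two_mul hi hb]) (Commute.self_pow y 2)
  · exact commute_zpow_mul_zpow (by rw [inv_mul_zpow_mul, hpr,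
      zpow_mul_zpow_zpow_two_mul hpu hu, zpow_odd_of_zpow_two_mul hi hd]) hur

lemma conj_eq_of_sq_commute {x y : G} (h : Commute y (x ^ 2)) : x * y * x⁻¹ = x⁻¹ * y * x := by
  calc x * y * x⁻¹ = x⁻¹ * (x ^ 2 * y) * x⁻¹ := by rw [pow_two]; group
    _ = x⁻¹ * y * x := by rw [← h.eq, pow_two]; group

lemma conj_mul_eq_zpow_mul_zpow {p q r : G} {a b c d : ℤ} (hpu : Commute p (q ^ 2))
    (hr : r ^ 2 = 1) (hpq : q⁻¹ * p * q = (q ^ 2) ^ a * p ^ b)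
    (hpr : r⁻¹ * p * r = (q ^ 2) ^ c * p ^ d) :
    (q * r) * p * (q * r)⁻¹ = (q ^ 2) ^ (c + a * d) * p ^ (b * d) := by
  calc (q * r) * p * (q * r)⁻¹ = q * (r * p * r⁻¹) * q⁻¹ := by group
    _ = q * (q ^ 2) ^ c * q⁻¹ * (q * p ^ d * q⁻¹) := by
      rw [conj_eq_of_sq_commute (x := r) (y := p)
        (by rw [hr]; exact Commute.one_right p), hpr]; group
    _ = (q ^ 2) ^ c * (q * p * q⁻¹) ^ d := by rw [conj_zpow]; group
    _ = (q ^ 2) ^ (c + a * d) * p ^ (b * d) := by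
      rw [conj_eq_of_sq_commute hpu, hpq, (hpu.symm.zpow_zpow a b).mul_zpow, ← zpow_mul, ← zpow_mul,
        zpow_add, mul_assoc]

end PairNormal

section MIID

variable {G : Type*} [Group G]

lemma sq_r_one_sr_zero : ((.r 1, .sr 0) ^ 2 : DihedralGroup 4 × DihedralGroup 4) ^ 2 = 1 := by
  decide

lemma sq_sr_zero_r_one : ((.sr 0, .r 1) ^ 2 : DihedralGroup 4 × DihedralGroup 4) ^ 2 = 1 := by
  decide

/-- The square is p²ⁱ, and for odd i its image in the dihedral product is not 1. -/
lemma even_of_sq_zpow_mul_zpow {p q : G} (hpu : Commute p (q ^ 2)) (hu : (q ^ 2) ^ 2 = 1)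
    {φ : G →* DihedralGroup 4 × DihedralGroup 4} (hφp : φ p = (.r 1, .sr 0)) {i j : ℤ}
    (h : p ^ i * (q ^ 2) ^ j * (p ^ i * (q ^ 2) ^ j) = 1) :
    ∃ i', i = 2 * i' := by
  rw [zpow_mul_zpow_sq hpu hu] at h
  rcases Int.even_or_odd' i with ⟨i', rfl | rfl⟩
  · exact ⟨i', rfl⟩
  · exfalso
    have h' := congrArg φ h
    rw [map_zpow, zpow_mul, zpow_add, zpow_mul, hφp, map_one] at h'
    have e : (((.r 1, .sr 0) : DihedralGroup 4 × DihedralGroup 4) ^ (2 : ℤ)) ^ (2 : ℤ) = 1 := by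
      decide
    rw [e, one_zpow] at h'
    exact absurd h' (by decide)

/-- With N = ⟨p, q²⟩, ker χ is N ∪ Nqr. Involutions of N are central. In Nqr the square has a
nontrivial first dihedral coordinate when the exponent of p is odd, and a nontrivial second one when
it is even. -/
lemma commonCentralPower_of_inverting {p q r : G} {k : ℕ}
    (hgen : Subgroup.closure {p, q, r} = ⊤) (hp : p ^ 2 ^ (k + 1) = 1) (hq : q ^ 4 = 1)
    (hr : r ^ 2 = 1) (hpq : q⁻¹ * p * q = q ^ 2 * p⁻¹) (hpr : r⁻¹ * p * r = p⁻¹)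
    (hqr : Commute r q) (hpu : Commute p (q ^ 2))
    {φ : G →* DihedralGroup 4 × DihedralGroup 4} (hφp : φ p = (.r 1, .sr 0))
    (hφq : φ q = (.sr 0, .r 1)) (hφr : φ r = (.sr 0, 1))
    {χ : G →* ℤˣ} (hχp : χ p = 1) (hχq : χ q = -1) (hχr : χ r = -1) :
    TriplesHaveCommonCentralPower G := by
  have hu : (q ^ 2) ^ 2 = 1 := by rw [← pow_mul]; exact hq
  replace hpq : q⁻¹ * p * q = (q ^ 2) ^ (1 : ℤ) * p ^ (-1 : ℤ) := by simpa using hpq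
  replace hpr : r⁻¹ * p * r = (q ^ 2) ^ (0 : ℤ) * p ^ (-1 : ℤ) := by simpa using hpr
  obtain ⟨hrep, hsq⟩ := pair_structure (e := 0) (f := 0) hgen
    (mem_normalizer_zpowers_of_commute hpu) hr hpq hpr (by
      rw [mul_assoc, ← hqr.eq, inv_mul_cancel_left]; simp)
  refine triplesHaveCommonCentralPower_of_character χ ?_ (exists_pow_two_pow_eq_one hpu hp hu hsq)
  intro x hx hχx
  have hxx := (orderOf_eq_two_iff'.1 hx).1
  obtain ⟨i, j, rfl | rfl | rfl | rfl⟩ := hrep x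
  · obtain ⟨i, rfl⟩ := even_of_sq_zpow_mul_zpow hpu hu hφp hxx
    rw [zpow_mul_zpow_sq hpu hu] at hxx
    exact zpow_two_mul_mul_zpow_central hgen hpu hu (hqr.pow_right 2) (by decide) (by decide)
      hpq hpr hxx j
  · exfalso; simp [hχp, hχq] at hχx
  · exfalso; simp [hχp, hχq, hχr] at hχx
  · exfalso
    have h := congrArg φ hxx
    simp only [map_mul, map_zpow, map_pow, hφp, hφq, hφr, map_one] at h
    obtain ⟨i', hi⟩ := exists_fin_zpow_eq (n := 4)
      (by decide : ((.r 1, .sr 0) : DihedralGroup 4 × DihedralGroup 4) ^ 4 = 1) i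
    obtain ⟨j', hj⟩ := exists_fin_zpow_eq sq_sr_zero_r_one j
    rw [hi, hj] at h
    clear hi hj hχx hx hxx
    revert i' j'
    decide

/-- The kernel of χ meets all four cosets of ⟨p, q²⟩, with the exponent of p even in the first two
and odd in the last two. The dihedral quotient excludes involutions in the cosets of q and r. In the
coset of qr it is the twist 2^(k+1) in the action of r on p that excludes them, and there the exact
order of p is needed. -/
lemma commonCentralPower_of_twisting {p q r : G} {k : ℕ}
    (hgen : Subgroup.closure {p, q, r} = ⊤) (hp : p ^ 2 ^ (k + 2) = 1) (hz : p ^ 2 ^ (k + 1) ≠ 1)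
    (hq : q ^ 4 = 1) (hr : r ^ 2 = 1) (hpq : q⁻¹ * p * q = q ^ 2 * p⁻¹)
    (hpr : r⁻¹ * p * r = q ^ 2 * p ^ (1 + 2 ^ (k + 1) : ℤ))
    (hqr : r⁻¹ * q * r = q ^ 3) (hpu : Commute p (q ^ 2))
    {φ : G →* DihedralGroup 4 × DihedralGroup 4} (hφp : φ p = (.r 1, .sr 0))
    (hφq : φ q = (.sr 0, .r 1)) (hφr : φ r = (1, .sr 1))
    {χ : G →* ℤˣ} (hχp : χ p = -1) (hχq : χ q = 1) (hχr : χ r = -1) :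
    TriplesHaveCommonCentralPower G := by
  have hu : (q ^ 2) ^ 2 = 1 := by rw [← pow_mul]; exact hq
  replace hpq : q⁻¹ * p * q = (q ^ 2) ^ (1 : ℤ) * p ^ (-1 : ℤ) := by simpa using hpq
  replace hpr : r⁻¹ * p * r = (q ^ 2) ^ (1 : ℤ) * p ^ (1 + 2 ^ (k + 1) * 1 : ℤ) := by
    simpa using hpr
  have hodd : Odd (1 + 2 ^ (k + 1) * 1 : ℤ) := odd_add_two_pow_mul odd_one _ _
  have hur : Commute r (q ^ 2) := by
    refine commute_of_inv_mul_mul_eq ?_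
    calc r⁻¹ * q ^ 2 * r = (r⁻¹ * q * r) * (r⁻¹ * q * r) := by rw [pow_two]; group
      _ = q ^ 4 * q ^ 2 := by rw [hqr]; group
      _ = q ^ 2 := by rw [hq, one_mul]
  obtain ⟨hrep, hsq⟩ := pair_structure (e := 1) (f := 0) hgen
    (mem_normalizer_zpowers_of_commute hpu) hr hpq hpr (by rw [hqr, pow_succ']; simp)
  refine triplesHaveCommonCentralPower_of_character χ ?_ (exists_pow_two_pow_eq_one hpu hp hu hsq)
  intro x hx hχx
  have hxx := (orderOf_eq_two_iff'.1 hx).1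
  obtain ⟨i, j, rfl | rfl | rfl | rfl⟩ := hrep x
  · obtain ⟨i, rfl⟩ := even_of_sq_zpow_mul_zpow hpu hu hφp hxx
    rw [zpow_mul_zpow_sq hpu hu] at hxx
    exact zpow_two_mul_mul_zpow_central hgen hpu hu hur (by decide) hodd hpq hpr hxx j
  · exfalso
    have hi : ∃ i', i = 2 * i' := units_neg_one_zpow_eq_one (by simpa [hχp, hχq] using hχx)
    obtain ⟨i, rfl⟩ := hi
    have h := congrArg φ hxx
    simp only [map_mul, map_zpow, map_pow, hφp, hφq, map_one, zpow_mul] at h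
    obtain ⟨i', hi⟩ := exists_fin_zpow_eq sq_r_one_sr_zero i
    obtain ⟨j', hj⟩ := exists_fin_zpow_eq sq_sr_zero_r_one j
    norm_cast at h
    rw [hi, hj] at h
    clear hi hj hχx hx hxx
    revert i' j'
    decide
  · exfalso
    have hi : ∃ i', i + 1 = 2 * i' := units_neg_one_zpow_eq_one (by
      rw [zpow_add_one]; simpa [hχp, hχq, hχr] using hχx)
    obtain ⟨i', hi⟩ := hi
    obtain rfl : i = 2 * (i' - 1) + 1 := by omega
    have h := congrArg φ hxx
    simp only [map_mul, map_zpow, map_pow, hφp, hφq, hφr, map_one, zpow_mul, zpow_add_one] at h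
    obtain ⟨i', hi⟩ := exists_fin_zpow_eq sq_r_one_sr_zero (i' - 1)
    obtain ⟨j', hj⟩ := exists_fin_zpow_eq sq_sr_zero_r_one j
    norm_cast at h
    rw [hi, hj] at h
    clear hi hj hχx hx hxx
    revert i' j'
    decide
  · exfalso
    have hi : ∃ i', i + 1 = 2 * i' := units_neg_one_zpow_eq_one (by
      rw [zpow_add_one]; simpa [hχp, hχq, hχr] using hχx)
    obtain ⟨i', hi⟩ := hi
    obtain rfl : i = 2 * (i' - 1) + 1 := by omega
    have ht : (q * r) ^ 2 = 1 := by
      calc (q * r) ^ 2 = q * r ^ 2 * (r⁻¹ * q * r) := by rw [pow_two, pow_two]; group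
        _ = 1 := by rw [hr, hqr, mul_one, ← pow_succ', hq]
    -- The exponent of q² in the square is even, so the square is p to the power -2^(k+1)i with i
    -- odd. This is not 1.
    have hsq := sq_zpow_mul_zpow_mul hpu (conj_mul_eq_zpow_mul_zpow hpu hr hpq hpr)
      (δ := 1) (by rw [((Commute.self_pow q 2).mul_left hur).eq]; group) (2 * (i' - 1) + 1) j
    have hu' : (q ^ 2) ^ (2 : ℤ) = 1 := by exact_mod_cast hu
    rw [pow_two, hxx, ht, mul_one, show (1 + 1 * (1 + 2 ^ (k + 1) * 1)) * (2 * (i' - 1) + 1) +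
      (1 + 1) * j = 2 * ((1 + 2 ^ k) * (2 * (i' - 1) + 1) + j) by ring, zpow_mul (q ^ 2), hu',
      one_zpow, mul_one] at hsq
    have := two_pow_dvd_of_zpow_eq_one hp hz hsq.symm
    rw [show (1 + -1 * (1 + 2 ^ (k + 1) * 1)) * (2 * (i' - 1) + 1) =
      2 ^ (k + 1) * -(2 * (i' - 1) + 1) by ring, pow_succ _ (k + 1),
      mul_dvd_mul_iff_left (by positivity)] at this
    omega

lemma MIID_commonCentralPower (k : ℕ) : ∀ n ∈ ({17, 18} : Set ℕ),
    TriplesHaveCommonCentralPower (MIID n (k + 7)) := by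
  rintro n (rfl | rfl)
  · obtain ⟨φ, hφp, hφq, hφr⟩ := MIID_exists_dihedral k 17 (by simp)
    obtain ⟨ψ, -, hψp, hψq, hψr⟩ := MIID_exists_surjective k 17 (by simp)
    obtain ⟨hp, hq, hr, hpq, hpu, hpr, hqr⟩ :=
      relMIID_relations (PresentedGroup.lift_of_eq_one (tableMIID (k + 7) 17))
    refine commonCentralPower_of_twisting (PresentedGroup.closure_of_three _) hp
      (MIID_seventeen_pow_ne_one k) hq hr hpq (by simpa using hpr) hqr
      (commute_of_inv_mul_mul_eq (by simpa using hpu)).symm hφp hφq hφr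
      (χ := (MonoidHom.fst _ _).comp ψ * (MonoidHom.snd _ _).comp ((MonoidHom.snd _ _).comp ψ))
      ?_ ?_ ?_ <;> simp [hψp, hψq, hψr]
  · obtain ⟨φ, hφp, hφq, hφr⟩ := MIID_eighteen_exists_dihedral k
    obtain ⟨ψ, -, hψp, hψq, hψr⟩ := MIID_exists_surjective k 18 (by simp)
    obtain ⟨hp, hq, hr, hpq, hpu, hpr, hqr⟩ :=
      relMIID_relations (PresentedGroup.lift_of_eq_one (tableMIID (k + 7) 18))
    refine commonCentralPower_of_inverting (PresentedGroup.closure_of_three _) hp hq hr hpq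
      (by simpa using hpr) (commute_of_inv_mul_mul_eq (by simpa using hqr))
      (commute_of_inv_mul_mul_eq (by simpa using hpu)).symm hφp hφq hφr
      (χ := (MonoidHom.fst _ _).comp ((MonoidHom.snd _ _).comp ψ) *
        (MonoidHom.snd _ _).comp ((MonoidHom.snd _ _).comp ψ))
      ?_ ?_ ?_ <;> simp [hψp, hψq, hψr]

end MIID

/-! ### The groups in which `q⁴` is the involution in `⟨p⟩` -/

section QuarticInvolution

variable {G : Type*} [Group G]

/-- For even B the element lies in ⟨p⟩ because u² does. For odd B its square is p^(2A + 2ᵏB), and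
`hB` says exactly that this is not 1. -/
lemma reach_of_eq_zpow_mul_zpow {p u y : G} {k : ℕ} (hp : p ^ 2 ^ (k + 1) = 1)
    (hz : p ^ 2 ^ k ≠ 1) (hpu : Commute p u) (hu : u ^ 2 = p ^ 2 ^ k) {A B : ℤ}
    (hy : y = p ^ A * u ^ B) (hB : Odd B → ¬ (2 ^ (k + 1) : ℤ) ∣ 2 * A + 2 ^ k * B) (hne : y ≠ 1) :
    ∃ x : ℤ, y ^ x = p ^ 2 ^ k := by
  have hu' : ∀ C : ℤ, u ^ (2 * C) = p ^ (2 ^ k * C) := by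
    intro C
    have : u ^ (2 : ℤ) = p ^ (2 ^ k : ℤ) := by exact_mod_cast hu
    rw [zpow_mul, this, ← zpow_mul]
  rcases Int.even_or_odd' B with ⟨C, rfl | rfl⟩
  · rw [hu', ← zpow_add] at hy
    rw [hy] at hne ⊢
    exact exists_zpow_eq_involution hp hne
  · have h2 : y ^ (2 : ℤ) = p ^ (2 * A + 2 ^ k * (2 * C + 1)) := by
      rw [hy, (hpu.zpow_zpow _ _).mul_zpow, ← zpow_mul, ← zpow_mul, mul_comm _ (2 : ℤ),
        mul_comm _ (2 : ℤ), hu', ← zpow_add]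
    have hne' : p ^ (2 * A + 2 ^ k * (2 * C + 1)) ≠ 1 := fun h =>
      hB ⟨C, rfl⟩ (two_pow_dvd_of_zpow_eq_one hp hz h)
    obtain ⟨x, hx⟩ := exists_zpow_eq_involution hp hne'
    exact ⟨2 * x, by rw [zpow_mul, h2, hx]⟩

/-- The square of an element of each coset of ⟨p, q²⟩ is put in the form pᴬ(q²)ᴮ. The exponent B is
even in the trivial coset and, since c + a is even, in that of qr. In the coset of q one has A = 0.
In the coset of r an odd B forces 2A ≡ 4 modulo 8. -/
lemma reach_of_quartic_involution {p q r : G} {k : ℕ} {a c e : ℤ}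
    (hgen : Subgroup.closure {p, q, r} = ⊤) (hp : p ^ 2 ^ (k + 4) = 1) (hz : p ^ 2 ^ (k + 3) ≠ 1)
    (hq : q ^ 4 = p ^ 2 ^ (k + 3)) (hr : r ^ 2 = 1) (hpu : Commute p (q ^ 2))
    (hpq : q⁻¹ * p * q = (q ^ 2) ^ a * p ^ (-1 : ℤ))
    (hpr : r⁻¹ * p * r = (q ^ 2) ^ c * p ^ (1 + 2 ^ (k + 3) * e)) (hqr : r⁻¹ * q * r = q⁻¹)
    (hac : Even (c + a)) :
    IsCentralInvolution (p ^ 2 ^ (k + 3)) ∧ NonCommutingProductsReach (p ^ 2 ^ (k + 3)) := by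
  have hu : (q ^ 2) ^ 2 = p ^ 2 ^ (k + 3) := by rw [← pow_mul, ← hq]
  have hzz : p ^ 2 ^ (k + 3) * p ^ 2 ^ (k + 3) = 1 := by
    rw [← pow_add, ← two_mul, ← pow_succ', hp]
  have hrq : ∀ n : ℕ, r⁻¹ * q ^ n * r = (q ^ n)⁻¹ := by
    intro n
    have := inv_mul_zpow_mul r q n
    rw [hqr, inv_zpow] at this
    exact_mod_cast this
  obtain ⟨hrep, -⟩ := pair_structure (e := -1) (f := 0) hgen
    (mem_normalizer_zpowers_of_commute hpu) hr hpq hpr (by rw [hqr, pow_two]; group)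
  have hrr : r * q ^ 2 * r⁻¹ = (q ^ 2) ^ (-1 : ℤ) := by
    rw [conj_eq_of_sq_commute (x := r) (y := q ^ 2) (by rw [hr]; exact Commute.one_right _), hrq]
    simp
  have ht : (q * r) ^ 2 = 1 := by
    calc (q * r) ^ 2 = q * r ^ 2 * (r⁻¹ * q * r) := by rw [pow_two, pow_two]; group
      _ = 1 := by rw [hr, hqr]; group
  refine ⟨⟨orderOf_eq_two_iff'.2 ⟨hzz, hz⟩, ?_⟩, nonCommutingProductsReach_of_sq ?_⟩
  · refine commute_of_generators hgen ?_
    rintro x (rfl | rfl | rfl)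
    · exact Commute.self_pow _ _
    · rw [← hq]; exact Commute.self_pow _ _
    · refine commute_of_inv_mul_mul_eq ?_
      rw [← hq, hrq, hq]
      exact inv_eq_of_mul_eq_one_left hzz
  · intro g
    have hodd : ∀ B : ℤ, Odd B → ¬ (2 ^ (k + 3 + 1) : ℤ) ∣ 2 * 0 + 2 ^ (k + 3) * B := by
      rintro B ⟨C, rfl⟩ h
      rw [mul_zero, zero_add, pow_succ _ (k + 3), mul_dvd_mul_iff_left (by positivity)] at h
      omega
    obtain ⟨i, j, rfl | rfl | rfl | rfl⟩ := hrep g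
    · refine reach_of_eq_zpow_mul_zpow hp hz hpu hu (A := 2 * i) (B := 2 * j) ?_ ?_
      · rw [(hpu.zpow_zpow _ _).mul_pow, mul_comm 2 i, mul_comm 2 j, zpow_mul, zpow_mul,
          zpow_ofNat, zpow_ofNat]
      · rintro ⟨C, hC⟩; omega
    · refine reach_of_eq_zpow_mul_zpow hp hz hpu hu (A := 0) (B := a * i + 2 * j + 1) ?_ (hodd _)
      rw [sq_zpow_mul_zpow_mul (κ := -1) (ε := a) (δ := 1) hpu
        (by rw [conj_eq_of_sq_commute hpu, hpq]) (by group)]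
      simp only [add_neg_cancel, zero_mul, one_add_one_eq_two, zpow_add_one, zpow_zero, mul_assoc]
    · refine reach_of_eq_zpow_mul_zpow hp hz hpu hu (A := (1 + (1 + 2 ^ (k + 3) * e)) * i)
        (B := c * i + (1 + -1) * j) ?_ ?_
      · rw [sq_zpow_mul_zpow_mul hpu (by
          rw [conj_eq_of_sq_commute (x := r) (y := p) (by rw [hr]; exact Commute.one_right _), hpr])
          hrr, hr, mul_one]
      · intro hB h
        have hi : Odd i := by
          rw [add_neg_cancel, zero_mul, add_zero] at hB
          exact (Int.odd_mul.1 hB).2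
        obtain ⟨l, rfl⟩ := hi
        obtain ⟨M, hM⟩ := h
        -- All terms other than 4i are divisible by 8, which contradicts i being odd.
        have h4 : (4 : ℤ) * (2 * l + 1) = 8 * (2 ^ (k + 1) * M - 2 ^ (k + 1) * e * (2 * l + 1) -
          2 ^ k * (c * (2 * l + 1) + (1 + -1) * j)) := by
          linear_combination hM
        omega
    · refine reach_of_eq_zpow_mul_zpow hp hz hpu hu (A := (1 + -1 * (1 + 2 ^ (k + 3) * e)) * i)
        (B := (c + a * (1 + 2 ^ (k + 3) * e)) * i + (1 + -1) * j) ?_ ?_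
      · rw [sq_zpow_mul_zpow_mul hpu (conj_mul_eq_zpow_mul_zpow hpu hr hpq hpr) (δ := -1) (by
          calc q * r * q ^ 2 * (q * r)⁻¹ = q * (r * q ^ 2 * r⁻¹) * q⁻¹ := by group
            _ = (q ^ 2) ^ (-1 : ℤ) := by rw [hrr]; group), ht, mul_one]
      · rintro ⟨C, hC⟩
        obtain ⟨D, hD⟩ := hac
        have : (2 : ℤ) * (D * i + a * 2 ^ (k + 2) * e * i) = 2 * C + 1 := by
          rw [← hC, show c = D + D - a by omega]; ring
        omega

end QuarticInvolution

/-! ### Application to M_{II-C,5} and M_{II-F}. -/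

section Relations

variable {H : Type*} [Group H] {k : ℕ} {f : Fin 3 → H}

lemma relMIIC_relations
    (h : ∀ x ∈ relMIIC (k + 7) (-1) 0, FreeGroup.lift f x = 1) :
    f 0 ^ 2 ^ (k + 4) = 1 ∧ f 1 ^ 4 = f 0 ^ 2 ^ (k + 3) ∧ f 2 ^ 2 = 1 ∧
    (f 1)⁻¹ * f 0 * f 1 = (f 0)⁻¹ ∧ (f 2)⁻¹ * f 0 * f 2 = f 0 ∧
    (f 2)⁻¹ * f 1 * f 2 = (f 1)⁻¹ := by
  have := h
  simp only [relMIIC, Set.mem_insert_iff, Set.mem_singleton_iff, forall_eq_or_imp, forall_eq] at this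
  simpa [div_eq_one, mul_eq_one_iff_eq_inv] using this

lemma relMIIF_relations {e : ℤ}
    (h : ∀ x ∈ relMIIF (k + 7) 0 e 1 1 0, FreeGroup.lift f x = 1) :
    f 0 ^ 2 ^ (k + 4) = 1 ∧ f 1 ^ 4 = f 0 ^ 2 ^ (k + 3) ∧ f 2 ^ 2 = 1 ∧
    (f 1)⁻¹ * f 0 * f 1 = f 1 ^ 2 * (f 0)⁻¹ ∧ (f 1 ^ 2)⁻¹ * f 0 * f 1 ^ 2 = f 0 ∧
    (f 2)⁻¹ * f 0 * f 2 = f 1 ^ 2 * f 0 ^ (1 + 2 ^ (k + 3) * e) ∧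
    (f 2)⁻¹ * f 1 * f 2 = f 1 ^ 3 * f 0 ^ (2 ^ (k + 3) : ℤ) := by
  simpa [relMIIF, div_eq_one] using h

end Relations

lemma MIIC_reach (k : ℕ) : ∀ n ∈ ({5} : Set ℕ),
    IsCentralInvolution (pMIIC n (k + 7) ^ 2 ^ (k + 3)) ∧
    NonCommutingProductsReach (pMIIC n (k + 7) ^ 2 ^ (k + 3)) := by
  rintro n rfl
  obtain ⟨hp, hq, hr, hpq, hpr, hqr⟩ :=
    relMIIC_relations (PresentedGroup.lift_of_eq_one (tableMIIC (k + 7) 5))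
  refine reach_of_quartic_involution (a := 0) (c := 0) (e := 0) (PresentedGroup.closure_of_three _)
    hp (MIIC_five_pow_ne_one k) hq hr ?_ (by simpa using hpq) (by simpa using hpr) hqr (by simp)
  -- The exponent -1 has square exactly 1, so the modulus 0 suffices.
  exact commute_sq_of_conj (n := 0) (a := -1) (by simp) (by simpa using hpq) (by simp)

lemma relMIIF_reach (k : ℕ) {e : ℤ}
    (hz : (PresentedGroup.of 0 : PresentedGroup (relMIIF (k + 7) 0 e 1 1 0)) ^ 2 ^ (k + 3) ≠ 1) :
    IsCentralInvolution
      ((PresentedGroup.of 0 : PresentedGroup (relMIIF (k + 7) 0 e 1 1 0)) ^ 2 ^ (k + 3)) ∧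
    NonCommutingProductsReach
      ((PresentedGroup.of 0 : PresentedGroup (relMIIF (k + 7) 0 e 1 1 0)) ^ 2 ^ (k + 3)) := by
  obtain ⟨hp, hq, hr, hpq, hpu, hpr, hqr⟩ :=
    relMIIF_relations (PresentedGroup.lift_of_eq_one (relMIIF (k + 7) 0 e 1 1 0))
  refine reach_of_quartic_involution (a := 1) (c := 1) (PresentedGroup.closure_of_three _)
    hp hz hq hr (commute_of_inv_mul_mul_eq hpu).symm (by simpa using hpq) (by simpa using hpr) ?_
    (by decide)
  have hp' : ∀ x : PresentedGroup (relMIIF (k + 7) 0 e 1 1 0), x ^ 2 ^ (k + 4) = 1 →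
      x ^ 2 ^ (k + 3) * x ^ 2 ^ (k + 3) = 1 := by
    intro x hx
    rw [← pow_add, ← two_mul, ← pow_succ', hx]
  -- For z = q⁴ with z² = 1, the element q³z is q⁻¹.
  rw [hqr, eq_inv_iff_mul_eq_one]
  have e1 : ∀ x z : PresentedGroup (relMIIF (k + 7) 0 e 1 1 0), x ^ 4 = z → z * z = 1 →
      x ^ 3 * z * x = 1 := by
    rintro x _ rfl h
    rw [← h]; group
  exact e1 _ _ (by exact_mod_cast hq) (by exact_mod_cast hp' _ hp)

lemma MIIF_reach (k : ℕ) : ∀ n ∈ ({8, 9} : Set ℕ),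
    IsCentralInvolution (pMIIF n (k + 7) ^ 2 ^ (k + 3)) ∧
    NonCommutingProductsReach (pMIIF n (k + 7) ^ 2 ^ (k + 3)) := by
  rintro n (rfl | rfl)
  · exact relMIIF_reach k (MIIF_eight_pow_ne_one k)
  · exact relMIIF_reach k (MIIF_nine_pow_ne_one k)

/-! ### The group `M_{II-E,1}` -/

section MIIE

variable {G : Type*} [Group G]

lemma mem_normalizer_zpowers_of_conj {p u : G} {c : ℤ} (hu : u ^ 2 = 1) (h : u⁻¹ * p * u = p ^ c) :
    u ∈ Subgroup.normalizer (Subgroup.zpowers p : Set G) := by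
  have hu' : u⁻¹ = u := inv_eq_of_mul_eq_one_left (by rw [← pow_two, hu])
  have key : ∀ x ∈ Subgroup.zpowers p, u * x * u⁻¹ ∈ Subgroup.zpowers p := by
    rintro _ ⟨i, rfl⟩
    refine ⟨c * i, ?_⟩
    dsimp only
    rw [zpow_mul, ← h, ← inv_mul_zpow_mul, hu']
  rw [Subgroup.mem_normalizer_iff]
  refine fun x => ⟨key x, fun hx => ?_⟩
  have := key _ hx
  rwa [show u * (u * x * u⁻¹) * u⁻¹ = u ^ 2 * x * (u ^ 2)⁻¹ by rw [pow_two]; group, hu, one_mul,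
    inv_one, mul_one] at this

/-- The elements of the kernel of `χ` commute with `u` if every generator does so up to the
central involution `z`, according to the value of `χ`. -/
lemma commute_of_character_eq_one {S : Set G} (hS : Subgroup.closure S = ⊤) {u z : G}
    (hz : IsCentralInvolution z) {χ : G →* ℤˣ}
    (h : ∀ x ∈ S, (χ x = 1 ∧ x * u = u * x) ∨ (χ x = -1 ∧ x * u = u * x * z)) {g : G}
    (hg : χ g = 1) : Commute g u := by
  have hzz := (orderOf_eq_two_iff'.1 hz.1).1
  have key : (χ g = 1 ∧ g * u = u * g) ∨ (χ g = -1 ∧ g * u = u * g * z) := by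
    clear hg
    have hgS : g ∈ Subgroup.closure S := hS ▸ Subgroup.mem_top g
    induction hgS using Subgroup.closure_induction with
    | mem x hx => exact h x hx
    | one => simp
    | mul x y _ _ hx hy =>
      rw [map_mul]
      rcases hx with ⟨cx, hx⟩ | ⟨cx, hx⟩ <;> rcases hy with ⟨cy, hy⟩ | ⟨cy, hy⟩ <;> rw [cx, cy]
      · exact Or.inl ⟨rfl, by rw [mul_assoc, hy, ← mul_assoc, hx, mul_assoc]⟩
      · exact Or.inr ⟨rfl, by rw [mul_assoc, hy, ← mul_assoc, ← mul_assoc, hx, mul_assoc u]⟩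
      · refine Or.inr ⟨rfl, ?_⟩
        rw [mul_assoc, hy, ← mul_assoc, hx, mul_assoc _ z, ← hz.2 y]
        simp only [mul_assoc]
      · refine Or.inl ⟨rfl, ?_⟩
        rw [mul_assoc, hy, ← mul_assoc, ← mul_assoc, hx, mul_assoc _ z, ← hz.2 y, mul_assoc _ _ z,
          mul_assoc y, hzz, mul_one, mul_assoc]
    | inv x _ hx =>
      rw [map_inv]
      rcases hx with ⟨cx, hx⟩ | ⟨cx, hx⟩ <;> rw [cx]
      · exact Or.inl ⟨rfl, (show Commute x u from hx).inv_left.eq⟩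
      · refine Or.inr ⟨rfl, ?_⟩
        rw [inv_mul_eq_iff_eq_mul, ← mul_assoc, ← mul_assoc, hx, mul_assoc _ z, ← hz.2, mul_assoc u,
          mul_assoc u, ← mul_assoc x, mul_inv_cancel, one_mul, hzz, mul_one]
  rcases key with ⟨-, h⟩ | ⟨h, -⟩
  · exact h
  · rw [hg] at h
    exact absurd h (by decide)

/-- Let z be the involution of ⟨p⟩ and χ the product of the signs of p and r. Both p and r commute
with q² up to z, so ker χ centralises q². If χ(s₁) = 1, comparing the classes of involutions modulo
ker ψ shows that s₀s₂ commutes with s₁. If χ(s₁) = -1, the image of s₁ in the second dihedral factor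
is central, which forces (s₀s₁)² and (s₁s₂)² into ⟨p⟩. -/
lemma commonEvenPower_or_conjugatesAgree {p q r : G} {k : ℕ}
    (hgen : Subgroup.closure {p, q, r} = ⊤) (hp : p ^ 2 ^ (k + 4) = 1) (hz : p ^ 2 ^ (k + 3) ≠ 1)
    (hq : q ^ 4 = 1) (hr : r ^ 2 = 1)
    (hpq : q⁻¹ * p * q = q ^ 2 * p ^ (1 - 2 ^ (k + 2) : ℤ))
    (hpu : (q ^ 2)⁻¹ * p * q ^ 2 = p ^ (1 + 2 ^ (k + 3) : ℤ)) (hpr : r⁻¹ * p * r = p⁻¹)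
    (hqr : r⁻¹ * q * r = q * p ^ (2 ^ (k + 2) : ℤ))
    {φ : G →* DihedralGroup 4 × DihedralGroup 4} (hφp : φ p = (.r 1, .sr 0))
    (hφq : φ q = (1, .r 1)) (hφr : φ r = (.sr 0, 1))
    {ψ : G →* ElementaryAbelianEight} (hψp : ψ p = (-1, 1, 1)) (hψq : ψ q = (1, -1, 1))
    (hψr : ψ r = (1, 1, -1)) :
    IsCentralInvolution (p ^ 2 ^ (k + 3)) ∧
    ∀ s₀ s₁ s₂ : G, IsConnectedStringDiagram ![s₀, s₁, s₂] →
      CommonEvenPower s₀ s₁ s₂ (p ^ 2 ^ (k + 3)) ∨ ConjugatesAgree s₀ s₁ s₂ := by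
  have hu : (q ^ 2) ^ 2 = 1 := by rw [← pow_mul]; exact hq
  have hp' : p ^ (2 ^ (k + 4) : ℤ) = 1 := by exact_mod_cast hp
  have hzz : p ^ 2 ^ (k + 3) * p ^ 2 ^ (k + 3) = 1 := by
    rw [← pow_add, ← two_mul, ← pow_succ', hp]
  -- The twists of p by q and by q² cancel on p²: (2 + 2^(k+3))(1 - 2^(k+2)) ≡ 2 modulo 2^(k+4).
  have hqp2 : Commute q (p ^ (2 : ℤ)) := by
    refine commute_of_inv_mul_mul_eq ?_
    calc q⁻¹ * p ^ (2 : ℤ) * q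
        = (q ^ 2) ^ 2 * ((q ^ 2)⁻¹ * p ^ (1 - 2 ^ (k + 2) : ℤ) * q ^ 2) *
            p ^ (1 - 2 ^ (k + 2) : ℤ) := by
          rw [inv_mul_zpow_mul, hpq, zpow_two]; group
      _ = p ^ (2 + 2 ^ (k + 4) * -2 ^ (k + 1) : ℤ) := by
          rw [hu, one_mul, inv_mul_zpow_mul, hpu, ← zpow_mul, ← zpow_add]; congr 1; ring
      _ = p ^ (2 : ℤ) := by rw [zpow_add, zpow_mul _ (2 ^ (k + 4)), hp', one_zpow, mul_one]
  have hq_even : ∀ i : ℤ, Commute q (p ^ (2 * i)) := by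
    intro i
    rw [zpow_mul]
    exact hqp2.zpow_right i
  have hcentral : IsCentralInvolution (p ^ 2 ^ (k + 3)) := by
    refine ⟨orderOf_eq_two_iff'.2 ⟨hzz, hz⟩, commute_of_generators hgen ?_⟩
    rintro x (rfl | rfl | rfl)
    · exact Commute.self_pow _ _
    · have := hq_even (2 ^ (k + 2))
      rw [← pow_succ'] at this
      exact_mod_cast this
    · refine commute_of_inv_mul_mul_eq ?_
      have := inv_mul_zpow_mul x p (2 ^ (k + 3) : ℕ)
      rw [hpr, inv_zpow, zpow_natCast] at this
      rw [this]
      exact inv_eq_of_mul_eq_one_left hzz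
  obtain ⟨hrep, hsq⟩ := pair_structure (a := 1) (b := 1 - 2 ^ (k + 2)) (c := 0) (d := -1) (e := 0)
    (f := 2 ^ (k + 2)) hgen (mem_normalizer_zpowers_of_conj hu hpu) hr (by simpa using hpq)
    (by simpa using hpr) (by simpa using hqr)
  let χ : G →* ℤˣ := (MonoidHom.fst _ _).comp ψ *
    (MonoidHom.snd _ _).comp ((MonoidHom.snd _ _).comp ψ)
  have hχ : ∀ g, χ g = (ψ g).1 * (ψ g).2.2 := fun g => rfl
  have hcomm : ∀ g, χ g = 1 → Commute g (q ^ 2) := by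
    intro g
    refine commute_of_character_eq_one hgen hcentral ?_
    rintro x (rfl | rfl | rfl)
    · refine Or.inr ⟨by rw [hχ, hψp]; rfl, ?_⟩
      calc x * q ^ 2 = q ^ 2 * ((q ^ 2)⁻¹ * x * q ^ 2) := by group
        _ = q ^ 2 * x * x ^ 2 ^ (k + 3) := by
          rw [hpu, zpow_add, zpow_one, mul_assoc]; norm_cast
    · exact Or.inl ⟨by rw [hχ, hψq]; rfl, Commute.self_pow _ _⟩
    · refine Or.inr ⟨by rw [hχ, hψr]; rfl, ?_⟩
      have hb := hq_even (2 ^ (k + 1))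
      rw [← pow_succ'] at hb
      have e : q ^ 2 * x = x * (q ^ 2 * p ^ 2 ^ (k + 3)) := by
        calc q ^ 2 * x = x * ((x⁻¹ * q * x) * (x⁻¹ * q * x)) := by rw [pow_two]; group
          _ = x * (q ^ 2 * (p ^ (2 ^ (k + 2) : ℤ)) ^ (2 : ℤ)) := by
            rw [hqr, ← pow_two, hb.mul_pow, zpow_ofNat]
          _ = x * (q ^ 2 * p ^ 2 ^ (k + 3)) := by
            rw [← zpow_mul, ← pow_succ]; norm_cast
      rw [e, mul_assoc, mul_assoc, hzz, mul_one]
  -- Involutions occur only in the classes of 1, pr, pqr and r, and those in the class of r have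
  -- central second dihedral coordinate. This is a finite check of squares in the combined quotient.
  have hinv : ∀ x : G, x * x = 1 → ψ x = 1 ∨ ψ x = (-1, 1, -1) ∨ ψ x = (-1, -1, -1) ∨
      ψ x = (1, 1, -1) ∧ ((φ x).2 = 1 ∨ (φ x).2 = .r 2) := by
    intro x hxx
    let Φ := φ.prod ψ
    have hΦp : Φ p = ((.r 1, .sr 0), (-1, 1, 1)) := Prod.ext hφp hψp
    have hΦq : Φ q = ((1, .r 1), (1, -1, 1)) := Prod.ext hφq hψq
    have hΦr : Φ r = ((.sr 0, 1), (1, 1, -1)) := Prod.ext hφr hψr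
    have h := congrArg Φ hxx
    change (Φ x).2 = 1 ∨ (Φ x).2 = (-1, 1, -1) ∨ (Φ x).2 = (-1, -1, -1) ∨
      (Φ x).2 = (1, 1, -1) ∧ ((Φ x).1.2 = 1 ∨ (Φ x).1.2 = .r 2)
    obtain ⟨i, j, rfl | rfl | rfl | rfl⟩ := hrep x
    all_goals
      clear hxx
      simp only [map_mul, map_zpow, map_pow, hΦp, hΦq, hΦr, map_one] at h ⊢
      obtain ⟨i', hi⟩ := exists_fin_zpow_eq (n := 4) (by decide : (((.r 1, .sr 0), (-1, 1, 1)) :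
        (DihedralGroup 4 × DihedralGroup 4) × ElementaryAbelianEight) ^ 4 = 1) i
      obtain ⟨j', hj⟩ := exists_fin_zpow_eq (n := 2) (by decide : (((1, .r 1), (1, -1, 1)) ^ 2 :
        (DihedralGroup 4 × DihedralGroup 4) × ElementaryAbelianEight) ^ 2 = 1) j
      rw [hi, hj] at h ⊢
      clear hi hj
      revert i' j'
      decide
  -- Such an involution is p²ⁱ(q²)ʲ with p⁴ⁱ = 1, so p²ⁱ is 1 or z, and ker χ centralises both
  -- factors.
  have hN : ∀ x : G, orderOf x = 2 → ψ x = 1 → ∀ g, χ g = 1 → Commute x g := by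
    intro x hx hψx g hg
    have hxx := (orderOf_eq_two_iff'.1 hx).1
    obtain ⟨i, j, rfl | rfl | rfl | rfl⟩ := hrep x
    · have hi : ∃ i', i = 2 * i' := units_neg_one_zpow_eq_one (by
        simpa [hψp, hψq] using congrArg Prod.fst hψx)
      obtain ⟨i, rfl⟩ := hi
      have hpu2 : Commute (p ^ (2 * i)) (q ^ 2) := hcomm _ (by
        rw [map_zpow, zpow_mul, zpow_ofNat, Int.units_sq, one_zpow])
      have h4 := zpow_mul_zpow_sq hpu2 hu 1 j
      rw [zpow_one, hxx, ← zpow_mul, mul_one, mul_comm _ (2 : ℤ)] at h4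
      refine Commute.mul_left ?_ ((hcomm g hg).symm.zpow_left j)
      rcases zpow_eq_one_or_of_sq hp hz h4.symm with h | h <;> rw [h]
      · exact Commute.one_left g
      · exact (hcentral.2 g).symm
    · exact absurd (congrArg (fun v => v.2.1) hψx) (by simp [hψp, hψq])
    · exact absurd (congrArg (fun v => v.2.2) hψx) (by simp [hψp, hψq, hψr])
    · exact absurd (congrArg (fun v => v.2.2) hψx) (by simp [hψp, hψq, hψr])
  -- The second coordinate of pᴬ(q²)ᴮ is not 1 for odd B, so the hypothesis leaves g² in ⟨p⟩.
  have hreach : ∀ g : G, (φ g).2 ^ 2 = 1 → g ^ 2 ≠ 1 → ∃ x : ℤ, (g ^ 2) ^ x = p ^ 2 ^ (k + 3) := by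
    intro g hg hne
    obtain ⟨A, B, h⟩ := hsq g
    have hu' : (q ^ 2) ^ (2 : ℤ) = 1 := by exact_mod_cast hu
    rcases Int.even_or_odd' B with ⟨C, rfl | rfl⟩
    · rw [zpow_mul, hu', one_zpow, mul_one] at h
      rw [h] at hne ⊢
      exact exists_zpow_eq_involution hp hne
    · exfalso
      rw [zpow_add, zpow_mul, hu', one_zpow, one_mul, zpow_one] at h
      have h' := congrArg ((MonoidHom.snd _ _).comp φ) h
      simp only [map_mul, map_zpow, map_pow, MonoidHom.comp_apply, MonoidHom.coe_snd, hφp, hφq,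
        hg] at h'
      obtain ⟨i', hi⟩ := exists_fin_zpow_eq (n := 2)
        (by decide : (.sr 0 : DihedralGroup 4) ^ 2 = 1) A
      rw [hi] at h'
      clear hi
      revert i'
      decide
  refine ⟨hcentral, fun s₀ s₁ s₂ hs => ?_⟩
  obtain ⟨h0, h1, h2, h02, h01, h12⟩ := hs.triple
  have hinv' : ∀ x : G, orderOf x = 2 → _ := fun x hx => hinv x (orderOf_eq_two_iff'.1 hx).1
  by_cases hχ1 : χ s₁ = 1
  · right
    -- No two distinct nontrivial classes among pr, pqr, r have their product in the list, so one of
    -- s₀, s₂, s₀s₂ lies in ker ψ. The first two would then commute with s₁.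
    have : ψ s₀ = 1 ∨ ψ s₂ = 1 ∨ ψ (s₀ * s₂) = 1 := by
      have hI : ∀ x : G, orderOf x = 2 →
          ψ x = 1 ∨ ψ x = (-1, 1, -1) ∨ ψ x = (-1, -1, -1) ∨ ψ x = (1, 1, -1) := by
        intro x hx
        rcases hinv' x hx with h | h | h | ⟨h, -⟩ <;> simp [h]
      have key : ∀ I : List ElementaryAbelianEight,
          I = [1, (-1, 1, -1), (-1, -1, -1), (1, 1, -1)] →
          ∀ v ∈ I, ∀ w ∈ I, v * w ∈ I → v = 1 ∨ w = 1 ∨ v * w = 1 := by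
        rintro _ rfl; decide
      rw [map_mul]
      exact key _ rfl _ (by simpa using hI _ h0) _ (by simpa using hI _ h2)
        (by simpa using hI _ h02)
    rcases this with h | h | h
    · exact absurd (hN s₀ h0 h s₁ hχ1).eq h01
    · exact absurd (hN s₂ h2 h s₁ hχ1).symm.eq h12
    · exact conjugatesAgree_of_commute h2 (hN _ h02 h s₁ hχ1)
  · left
    -- Of the four classes of involutions, only that of r has χ = -1.
    have hφ1 : (φ s₁).2 = 1 ∨ (φ s₁).2 = .r 2 := by
      rcases hinv' s₁ h1 with h | h | h | h
      · exact absurd (by rw [hχ, h]; decide) hχ1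
      · exact absurd (by rw [hχ, h]; decide) hχ1
      · exact absurd (by rw [hχ, h]; decide) hχ1
      · exact h.2
    have hφt : ∀ t : G, orderOf t = 2 → (φ (t * s₁)).2 ^ 2 = 1 ∧ (φ (s₁ * t)).2 ^ 2 = 1 := by
      intro t ht
      have key : ∀ a b : DihedralGroup 4, a * a = 1 → (b = 1 ∨ b = .r 2) →
          (a * b) ^ 2 = 1 ∧ (b * a) ^ 2 = 1 := by decide
      rw [map_mul, map_mul]
      refine key _ _ ?_ hφ1
      have := congrArg (fun x => (φ x).2) (orderOf_eq_two_iff'.1 ht).1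
      simpa using this
    obtain ⟨x, hx⟩ := hreach (s₀ * s₁) (hφt s₀ h0).1 (sq_mul_ne_one_of_not_commute h0 h1 h01)
    obtain ⟨y, hy⟩ := hreach (s₁ * s₂) (hφt s₂ h2).2 (sq_mul_ne_one_of_not_commute h1 h2 h12)
    exact ⟨x, y, by rw [zpow_mul]; exact_mod_cast hx, by rw [zpow_mul]; exact_mod_cast hy⟩

end MIIE

/-! ### Application to M_{II-E,1}. -/

section Relations

variable {H : Type*} [Group H] {k : ℕ} {f : Fin 3 → H}

lemma relMIIE_relations (h : ∀ x ∈ relMIIE (k + 7) (-1) 1 1 0, FreeGroup.lift f x = 1) :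
    f 0 ^ 2 ^ (k + 4) = 1 ∧ f 1 ^ 4 = 1 ∧ f 2 ^ 2 = 1 ∧
    (f 1)⁻¹ * f 0 * f 1 = f 1 ^ 2 * f 0 ^ (1 - 2 ^ (k + 2) : ℤ) ∧
    (f 1 ^ 2)⁻¹ * f 0 * f 1 ^ 2 = f 0 ^ (1 + 2 ^ (k + 3) : ℤ) ∧
    (f 2)⁻¹ * f 0 * f 2 = (f 0)⁻¹ ∧
    (f 2)⁻¹ * f 1 * f 2 = f 1 * f 0 ^ (2 ^ (k + 2) : ℤ) := by
  have := h
  simp only [relMIIE, Set.mem_insert_iff, Set.mem_singleton_iff, forall_eq_or_imp, forall_eq] at this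
  simpa [div_eq_one, mul_eq_one_iff_eq_inv] using this

end Relations

lemma MIIE_commonEvenPower_or_conjugatesAgree (k : ℕ) : ∀ n ∈ ({1} : Set ℕ),
    IsCentralInvolution (pMIIE n (k + 7) ^ 2 ^ (k + 3)) ∧
    ∀ s₀ s₁ s₂ : MIIE n (k + 7), IsConnectedStringDiagram ![s₀, s₁, s₂] →
      CommonEvenPower s₀ s₁ s₂ (pMIIE n (k + 7) ^ 2 ^ (k + 3)) ∨ ConjugatesAgree s₀ s₁ s₂ := by
  rintro n rfl
  obtain ⟨φ, hφp, hφq, hφr⟩ := MIIE_exists_dihedral k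
  obtain ⟨ψ, -, hψp, hψq, hψr⟩ := MIIE_exists_surjective k 1 (by simp)
  obtain ⟨hp, hq, hr, hpq, hpu, hpr, hqr⟩ :=
    relMIIE_relations (PresentedGroup.lift_of_eq_one (tableMIIE (k + 7) 1))
  exact commonEvenPower_or_conjugatesAgree (PresentedGroup.closure_of_three _) hp
    (MIIE_one_pow_ne_one k) hq hr hpq hpu hpr hqr hφp hφq hφr hψp hψq hψr

/-! ### The main theorem -/

theorem mainTheorem3 :
    (∀ m : ℕ, 6 ≤ m →
      ∀ n ∈ ({3, 4, 5} : Set ℕ),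
        ¬ IsConnectedStringCGroup (NII n m) ∧ TriplesViolateIntersection (NII n m) ∧
        IsCentralInvolution (pNII n m ^ 2 ^ (m - 3)) ∧
        NonCommutingProductsReach (pNII n m ^ 2 ^ (m - 3))) ∧
    (∀ m : ℕ, 7 ≤ m →
      -- the two connected string C-groups
      (∀ n ∈ ({3, 19} : Set ℕ), IsConnectedStringCGroup (MIID n m)) ∧
      -- the groups with a central involution that depends on the triple
      (∀ n ∈ ({39, 40} : Set ℕ),
        ¬ IsConnectedStringCGroup (MIIA n m) ∧ TriplesViolateIntersection (MIIA n m) ∧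
        TriplesHaveCommonCentralPower (MIIA n m)) ∧
      (∀ n ∈ ({19, 20} : Set ℕ),
        ¬ IsConnectedStringCGroup (MIIB n m) ∧ TriplesViolateIntersection (MIIB n m) ∧
        TriplesHaveCommonCentralPower (MIIB n m)) ∧
      (∀ n ∈ ({17, 18} : Set ℕ),
        ¬ IsConnectedStringCGroup (MIID n m) ∧ TriplesViolateIntersection (MIID n m) ∧
        TriplesHaveCommonCentralPower (MIID n m)) ∧
      -- the groups with a fixed central involution
      (∀ n ∈ ({5} : Set ℕ),
        ¬ IsConnectedStringCGroup (MIIC n m) ∧ TriplesViolateIntersection (MIIC n m) ∧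
        IsCentralInvolution (pMIIC n m ^ 2 ^ (m - 4)) ∧
        NonCommutingProductsReach (pMIIC n m ^ 2 ^ (m - 4))) ∧
      (∀ n ∈ ({8, 9} : Set ℕ),
        ¬ IsConnectedStringCGroup (MIIF n m) ∧ TriplesViolateIntersection (MIIF n m) ∧
        IsCentralInvolution (pMIIF n m ^ 2 ^ (m - 4)) ∧
        NonCommutingProductsReach (pMIIF n m ^ 2 ^ (m - 4))) ∧
      (∀ n ∈ ({3, 4, 5, 10, 11, 13, 14} : Set ℕ),
        ¬ IsConnectedStringCGroup (MIII n m) ∧ TriplesViolateIntersection (MIII n m) ∧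
        IsCentralInvolution (pMIII n m ^ 2 ^ (m - 4)) ∧
        NonCommutingProductsReach (pMIII n m ^ 2 ^ (m - 4))) ∧
      -- the remaining group
      (∀ n ∈ ({1} : Set ℕ),
        ¬ IsConnectedStringCGroup (MIIE n m) ∧ TriplesViolateIntersection (MIIE n m) ∧
        IsCentralInvolution (pMIIE n m ^ 2 ^ (m - 4)) ∧
        ∀ s₀ s₁ s₂ : MIIE n m, IsConnectedStringDiagram ![s₀, s₁, s₂] →
          CommonEvenPower s₀ s₁ s₂ (pMIIE n m ^ 2 ^ (m - 4)) ∨ ConjugatesAgree s₀ s₁ s₂)) := by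
  refine ⟨fun m hm n hn => ?_, fun m hm => ?_⟩
  · obtain ⟨k, rfl⟩ : ∃ k, m = k + 6 := ⟨m - 6, by omega⟩
    obtain ⟨φ, hφ, -⟩ := NII_exists_surjective k n hn
    obtain ⟨hz, h⟩ := NII_reach k n hn
    exact ⟨not_isConnectedStringCGroup (h.violates hz) hφ, h.violates hz, hz, h⟩
  obtain ⟨k, rfl⟩ : ∃ k, m = k + 7 := ⟨m - 7, by omega⟩
  refine ⟨MIID_isConnectedStringCGroup k, fun n hn => ?_, fun n hn => ?_, fun n hn => ?_,
    fun n hn => ?_, fun n hn => ?_, fun n hn => ?_, fun n hn => ?_⟩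
  · obtain ⟨φ, hφ, -⟩ := MIIA_exists_surjective k n hn
    have h := MIIA_commonCentralPower k n hn
    exact ⟨not_isConnectedStringCGroup h.violates hφ, h.violates, h⟩
  · obtain ⟨φ, hφ, -⟩ := MIIB_exists_surjective k n hn
    have h := MIIB_commonCentralPower k n hn
    exact ⟨not_isConnectedStringCGroup h.violates hφ, h.violates, h⟩
  · obtain ⟨φ, hφ, -⟩ := MIID_exists_surjective k n (by rcases hn with rfl | rfl <;> simp)
    have h := MIID_commonCentralPower k n hn
    exact ⟨not_isConnectedStringCGroup h.violates hφ, h.violates, h⟩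
  · obtain ⟨φ, hφ, -⟩ := MIIC_exists_surjective k n hn
    obtain ⟨hz, h⟩ := MIIC_reach k n hn
    exact ⟨not_isConnectedStringCGroup (h.violates hz) hφ, h.violates hz, hz, h⟩
  · obtain ⟨φ, hφ, -⟩ := MIIF_exists_surjective k n hn
    obtain ⟨hz, h⟩ := MIIF_reach k n hn
    exact ⟨not_isConnectedStringCGroup (h.violates hz) hφ, h.violates hz, hz, h⟩
  · obtain ⟨φ, hφ, -⟩ := MIII_exists_surjective k n hn
    obtain ⟨hz, h⟩ := MIII_reach k n hn
    exact ⟨not_isConnectedStringCGroup (h.violates hz) hφ, h.violates hz, hz, h⟩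
  · obtain ⟨φ, hφ, -⟩ := MIIE_exists_surjective k n hn
    obtain ⟨hz, h⟩ := MIIE_commonEvenPower_or_conjugatesAgree k n hn
    have hv : TriplesViolateIntersection (MIIE n (k + 7)) :=
      triplesViolateIntersection_of_central_or_agree fun s₀ s₁ s₂ hs =>
        (h s₀ s₁ s₂ hs).imp_left fun hc => ⟨_, hz, hc⟩
    exact ⟨not_isConnectedStringCGroup hv hφ, hv, hz, h⟩
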